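/- **Theorem 1 (minimum-width color-spanning square annulus in $O(n^3+n^2k\log k)$ time and $O(k)$ extra space).** An axis-parallel square annulus is the closed planar region bounded by two concentric axis-parallel squares $C_{in}$ and $C_{out}$ with half side lengths $0<r\le R$ (the squares may coincide). Its width is the Euclidean distance between two closest points of $C_{in}$ and $C_{out}$. Given $n$ points in the plane, each with one of $k\ge 1$ colors and with every color occurring, an annulus is color-spanning if it contains at least one point of each color. There is an algorithm that, for all such $n$, $k$ and all such inputs, computes a color-spanning axis-parallel square annulus of minimum width (its center and its two half side lengths) in $O(n^3+n^2k\log k)$ time using $O(k)$ extra space. The constants are absolute. The model of computation is the real RAM: exact unit-cost arithmetic and comparisons on real numbers without rounding, unit-cost arithmetic on integers of $O(\log n)$ bits, and indirect addressing. The input is given in memory cells that may be overwritten, and extra space is the number of memory cells used beyond those of the input. -/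

import Mathlib

/-! ## Axis-parallel square annuli -/

namespace CSSA

/-- The plane, with the Euclidean metric. -/
abbrev Plane : Type := EuclideanSpace ℝ (Fin 2)

/-- The `L∞` distance between two points of the plane. -/
noncomputable def distInf (a b : Plane) : ℝ := max |a 0 - b 0| |a 1 - b 1|

/-- The boundary curve of the axis-parallel square with centre `c` and side length `2 * r`. -/
def squareCurve (c : Plane) (r : ℝ) : Set Plane := {z | distInf z c = r}

/-- Two concentric axis-parallel squares, given by their common centre and their radii (half side
lengths). The two squares may coincide, so that an annulus of width `0` is allowed. -/
structure SquareAnnulus where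
  center : Plane
  inner : ℝ
  outer : ℝ
  inner_pos : 0 < inner
  inner_le_outer : inner ≤ outer

namespace SquareAnnulus

/-- The inner boundary curve. -/
def innerCurve (A : SquareAnnulus) : Set Plane := squareCurve A.center A.inner

/-- The outer boundary curve. -/
def outerCurve (A : SquareAnnulus) : Set Plane := squareCurve A.center A.outer

/-- The closed region bounded by the two curves. -/
def region (A : SquareAnnulus) : Set Plane :=
  {z | A.inner ≤ distInf z A.center ∧ distInf z A.center ≤ A.outer}

/-- The width: the Euclidean distance between two closest points of the two boundary curves. -/
noncomputable def width (A : SquareAnnulus) : ℝ :=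
  sInf {d | ∃ a ∈ A.innerCurve, ∃ b ∈ A.outerCurve, d = dist a b}

/-- The annulus contains at least one point of each colour. -/
def ColorSpanning {n k : ℕ} (A : SquareAnnulus) (P : Fin n → Plane) (color : Fin n → Fin k) :
    Prop :=
  ∀ i : Fin k, ∃ j : Fin n, color j = i ∧ P j ∈ A.region

/-- A color-spanning square annulus of minimum width. -/
def IsMinWidth {n k : ℕ} (A : SquareAnnulus) (P : Fin n → Plane) (color : Fin n → Fin k) :
    Prop :=
  A.ColorSpanning P color ∧ ∀ B : SquareAnnulus, B.ColorSpanning P color → A.width ≤ B.width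

end SquareAnnulus

/-! ## A real RAM

The machine has integer registers and real registers, of which a program mentions only finitely
many, and two memories with indirect addressing: one whose cells hold natural numbers and one whose
cells hold real numbers. Real numbers can be added, subtracted, multiplied, divided and compared
exactly; they cannot be rounded or turned into integers. Every instruction costs one step. -/

/-- Arithmetic on natural numbers (subtraction is truncated, division rounds down). -/
inductive IntOp
  | add
  | sub
  | mul
  | div

/-- The value of an integer operation. -/
def IntOp.eval : IntOp → ℕ → ℕ → ℕ
  | .add, a, b => a + b
  | .sub, a, b => a - b
  | .mul, a, b => a * b
  | .div, a, b => a / b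

/-- Arithmetic on real numbers. -/
inductive RealOp
  | add
  | sub
  | mul
  | div

/-- The value of a real operation. -/
noncomputable def RealOp.eval : RealOp → ℝ → ℝ → ℝ
  | .add, a, b => a + b
  | .sub, a, b => a - b
  | .mul, a, b => a * b
  | .div, a, b => a / b

/-- The instructions; `d`, `a`, `b`, `s` are register numbers and `l` is a position in the
program. -/
inductive Instr
  /-- `I[d] := c` -/
  | intConst (d c : ℕ)
  /-- `I[d] := I[a] op I[b]` -/
  | intArith (op : IntOp) (d a b : ℕ)
  /-- `I[d] := intMem[I[a]]` -/
  | intLoad (d a : ℕ)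
  /-- `intMem[I[a]] := I[s]` -/
  | intStore (a s : ℕ)
  /-- `R[d] := q`, for a rational constant `q` -/
  | realConst (d : ℕ) (q : ℚ)
  /-- `R[d] := R[a] op R[b]` -/
  | realArith (op : RealOp) (d a b : ℕ)
  /-- `R[d] := realMem[I[a]]` -/
  | realLoad (d a : ℕ)
  /-- `realMem[I[a]] := R[s]` -/
  | realStore (a s : ℕ)
  /-- go to `l` -/
  | jump (l : ℕ)
  /-- if `I[a] < I[b]` then go to `l` -/
  | intLess (a b l : ℕ)
  /-- if `R[a] < R[b]` then go to `l` -/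
  | realLess (a b l : ℕ)

/-- A program is a finite list of instructions. -/
abbrev Program : Type := List Instr

/-- A configuration: program counter, registers and memories. -/
structure Config where
  pc : ℕ
  intReg : ℕ → ℕ
  realReg : ℕ → ℝ
  intMem : ℕ → ℕ
  realMem : ℕ → ℝ

open Classical in
/-- The effect of one instruction. -/
noncomputable def Instr.exec (c : Config) : Instr → Config
  | .intConst d v =>
      { c with pc := c.pc + 1, intReg := Function.update c.intReg d v }
  | .intArith op d a b =>
      { c with
        pc := c.pc + 1
        intReg := Function.update c.intReg d (op.eval (c.intReg a) (c.intReg b)) }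
  | .intLoad d a =>
      { c with
        pc := c.pc + 1
        intReg := Function.update c.intReg d (c.intMem (c.intReg a)) }
  | .intStore a s =>
      { c with
        pc := c.pc + 1
        intMem := Function.update c.intMem (c.intReg a) (c.intReg s) }
  | .realConst d q =>
      { c with pc := c.pc + 1, realReg := Function.update c.realReg d (q : ℝ) }
  | .realArith op d a b =>
      { c with
        pc := c.pc + 1
        realReg := Function.update c.realReg d (op.eval (c.realReg a) (c.realReg b)) }
  | .realLoad d a =>
      { c with
        pc := c.pc + 1
        realReg := Function.update c.realReg d (c.realMem (c.intReg a)) }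
  | .realStore a s =>
      { c with
        pc := c.pc + 1
        realMem := Function.update c.realMem (c.intReg a) (c.realReg s) }
  | .jump l => { c with pc := l }
  | .intLess a b l => { c with pc := if c.intReg a < c.intReg b then l else c.pc + 1 }
  | .realLess a b l => { c with pc := if c.realReg a < c.realReg b then l else c.pc + 1 }

/-- The machine has halted when the program counter has left the program. -/
def Program.Halted (prog : Program) (c : Config) : Prop := prog.length ≤ c.pc

/-- One step of the computation; a halted machine stays as it is. -/
noncomputable def Program.step (prog : Program) (c : Config) : Config :=
  match prog[c.pc]? with
  | some ins => ins.exec c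
  | none => c

/-- The configuration after `t` steps. -/
noncomputable def Program.run (prog : Program) (c : Config) (t : ℕ) : Config :=
  (prog.step)^[t] c

/-- The next step (if any) accesses only cells with addresses `< sI` of the integer memory and
`< sR` of the real memory. -/
def Program.AccessWithin (prog : Program) (sI sR : ℕ) (c : Config) : Prop :=
  match prog[c.pc]? with
  | some (.intLoad _ a) => c.intReg a < sI
  | some (.intStore a _) => c.intReg a < sI
  | some (.realLoad _ a) => c.intReg a < sR
  | some (.realStore a _) => c.intReg a < sR
  | _ => True

/-- All integers held by the registers and the memory are at most `W`. -/
def Config.WordsWithin (W : ℕ) (c : Config) : Prop :=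
  (∀ r, c.intReg r ≤ W) ∧ (∀ a, c.intMem a ≤ W)

/-- The initial configuration on `n` points with colours in `{0, …, k - 1}`: the integer registers
`0` and `1` hold `n` and `k`, the first `n` cells of the integer memory hold the colours, the first
`2 * n` cells of the real memory hold the coordinates, in the order `x₀, y₀, x₁, y₁, …`, and
everything else is `0`. -/
noncomputable def initial {n k : ℕ} (P : Fin n → Plane) (color : Fin n → Fin k) : Config where
  pc := 0
  intReg := fun r => if r = 0 then n else if r = 1 then k else 0
  realReg := fun _ => 0
  intMem := fun a => if h : a < n then (color ⟨a, h⟩ : ℕ) else 0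
  realMem := fun a =>
    if h : a / 2 < n then (if a % 2 = 0 then P ⟨a / 2, h⟩ 0 else P ⟨a / 2, h⟩ 1) else 0

/-- The real registers `0, 1, 2, 3` hold the coordinates of the centre, the inner radius and the
outer radius of `A`. -/
def Config.Outputs (c : Config) (A : SquareAnnulus) : Prop :=
  c.realReg 0 = A.center 0 ∧ c.realReg 1 = A.center 1 ∧
    c.realReg 2 = A.inner ∧ c.realReg 3 = A.outer

end CSSA

namespace CSSA

/-! ## Structured programs for the real RAM -/

/-- A machine state without program counter. -/
structure Store where
  I : ℕ → ℕ
  R : ℕ → ℝ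
  M : ℕ → ℕ
  Z : ℕ → ℝ

/-- The configuration with the given program counter. -/
def Store.at (σ : Store) (pc : ℕ) : Config := ⟨pc, σ.I, σ.R, σ.M, σ.Z⟩

/-- Effect of an instruction that is not a jump. -/
noncomputable def Store.exec (σ : Store) : Instr → Store
  | .intConst d v => { σ with I := Function.update σ.I d v }
  | .intArith op d a b => { σ with I := Function.update σ.I d (op.eval (σ.I a) (σ.I b)) }
  | .intLoad d a => { σ with I := Function.update σ.I d (σ.M (σ.I a)) }
  | .intStore a s => { σ with M := Function.update σ.M (σ.I a) (σ.I s) }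
  | .realConst d q => { σ with R := Function.update σ.R d (q : ℝ) }
  | .realArith op d a b => { σ with R := Function.update σ.R d (op.eval (σ.R a) (σ.R b)) }
  | .realLoad d a => { σ with R := Function.update σ.R d (σ.Z (σ.I a)) }
  | .realStore a s => { σ with Z := Function.update σ.Z (σ.I a) (σ.R s) }
  | _ => σ

/-- Limits on the word size and on the two memories. -/
structure Lim where
  W : ℕ
  sI : ℕ
  sR : ℕ

/-- An instruction that is not a jump respects the limits. -/
def Store.Guard (L : Lim) (σ : Store) : Instr → Prop
  | .intConst _ v => v ≤ L.W
  | .intArith .add _ a b => σ.I a + σ.I b ≤ L.W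
  | .intArith .mul _ a b => σ.I a * σ.I b ≤ L.W
  | .intArith .sub _ _ _ => True
  | .intArith .div _ _ _ => True
  | .intLoad _ a => σ.I a < L.sI
  | .intStore a _ => σ.I a < L.sI
  | .realConst _ _ => True
  | .realArith _ _ _ _ => True
  | .realLoad _ a => σ.I a < L.sR
  | .realStore a _ => σ.I a < L.sR
  | _ => False

/-- Comparisons. -/
inductive Test
  | int (a b : ℕ)
  | real (a b : ℕ)

/-- Truth of a comparison. -/
def Test.Holds (σ : Store) : Test → Prop
  | .int a b => σ.I a < σ.I b
  | .real a b => σ.R a < σ.R b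

/-- The conditional jump of a comparison. -/
def Test.instr (l : ℕ) : Test → Instr
  | .int a b => .intLess a b l
  | .real a b => .realLess a b l

/-- Structured programs. -/
inductive Com
  | skip
  | ins (i : Instr)
  | seq (p q : Com)
  | ite (c : Test) (p q : Com)
  | loop (c : Test) (p : Com)

/-- The length of the code of a structured program. -/
def Com.size : Com → ℕ
  | .skip => 0
  | .ins _ => 1
  | .seq p q => p.size + q.size
  | .ite _ p q => 2 + q.size + p.size
  | .loop _ p => 3 + p.size

/-- The code of a structured program, to be placed at position `off`. -/
def Com.code (off : ℕ) : Com → List Instr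
  | .skip => []
  | .ins i => [i]
  | .seq p q => p.code off ++ q.code (off + p.size)
  | .ite c p q =>
      [c.instr (off + 2 + q.size)] ++ (q.code (off + 1) ++
        ([.jump (off + 2 + q.size + p.size)] ++ p.code (off + 2 + q.size)))
  | .loop c p =>
      [c.instr (off + 2)] ++ ([.jump (off + 3 + p.size)] ++ (p.code (off + 2) ++ [.jump off]))

theorem Com.length_code (p : Com) : ∀ off, (p.code off).length = p.size := by
  induction p with
  | skip => intro off; rfl
  | ins i => intro off; rfl
  | seq p q hp hq => intro off; simp [Com.code, Com.size, hp, hq]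
  | ite c p q hp hq => intro off; simp [Com.code, Com.size, hp, hq]; omega
  | loop c p hp => intro off; simp [Com.code, Com.size, hp]; omega

/-- `l` occurs in `prog` at position `off`. -/
def CodeAt (prog : Program) (off : ℕ) (l : List Instr) : Prop :=
  ∀ i < l.length, prog[off + i]? = l[i]?

theorem CodeAt.left {prog : Program} {off : ℕ} {l m : List Instr} (h : CodeAt prog off (l ++ m)) :
    CodeAt prog off l := by
  intro i hi
  rw [h i (by simp; omega), List.getElem?_append_left hi]

theorem CodeAt.right {prog : Program} {off : ℕ} {l m : List Instr}
    (h : CodeAt prog off (l ++ m)) : CodeAt prog (off + l.length) m := by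
  intro i hi
  rw [add_assoc, h (l.length + i) (by simp; omega), List.getElem?_append_right (by omega)]
  simp

theorem CodeAt.head {prog : Program} {off : ℕ} {i : Instr} {l : List Instr}
    (h : CodeAt prog off (i :: l)) : prog[off]? = some i := by
  simpa using h 0 (by simp)

/-- A computation of `t` steps from `c` to `c'` that respects the limits. -/
def Safe (L : Lim) (prog : Program) (c : Config) (t : ℕ) (c' : Config) : Prop :=
  prog.run c t = c' ∧ (∀ u < t, prog.AccessWithin L.sI L.sR (prog.run c u)) ∧
    ∀ u ≤ t, (prog.run c u).WordsWithin L.W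

theorem Safe.refl {L : Lim} {prog : Program} {c : Config} (h : c.WordsWithin L.W) :
    Safe L prog c 0 c :=
  ⟨rfl, by simp, fun u hu => by obtain rfl := Nat.le_zero.1 hu; exact h⟩

theorem run_add (prog : Program) (c : Config) (t u : ℕ) :
    prog.run c (t + u) = prog.run (prog.run c t) u := by
  unfold Program.run
  rw [add_comm, Function.iterate_add_apply]

theorem Safe.trans {L : Lim} {prog : Program} {c c' c'' : Config} {t u : ℕ}
    (h : Safe L prog c t c') (h' : Safe L prog c' u c'') : Safe L prog c (t + u) c'' := by
  obtain ⟨h1, h2, h3⟩ := h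
  obtain ⟨k1, k2, k3⟩ := h'
  have key : ∀ v, prog.run c (t + v) = prog.run c' v := fun v => by rw [run_add, h1]
  refine ⟨by rw [key, k1], fun v hv => ?_, fun v hv => ?_⟩
  · rcases lt_or_ge v t with hvt | hvt
    · exact h2 v hvt
    · obtain ⟨d, rfl⟩ := Nat.exists_eq_add_of_le hvt
      rw [key]; exact k2 d (by omega)
  · rcases le_or_gt v t with hvt | hvt
    · exact h3 v hvt
    · obtain ⟨d, rfl⟩ := Nat.exists_eq_add_of_le hvt.le
      rw [key]; exact k3 d (by omega)

theorem Safe.words {L : Lim} {prog : Program} {c c' : Config} {t : ℕ}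
    (h : Safe L prog c t c') : c'.WordsWithin L.W := by
  rw [← h.1]; exact h.2.2 t le_rfl

theorem Safe.single {L : Lim} {prog : Program} {c c' : Config}
    (hs : prog.step c = c') (ha : prog.AccessWithin L.sI L.sR c)
    (hw : c.WordsWithin L.W) (hw' : c'.WordsWithin L.W) : Safe L prog c 1 c' := by
  refine ⟨hs, fun u hu => ?_, fun u hu => ?_⟩
  · obtain rfl : u = 0 := by omega
    exact ha
  · obtain rfl | rfl : u = 0 ∨ u = 1 := by omega
    · exact hw
    · show (prog.step c).WordsWithin L.W
      rw [hs]; exact hw'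

/-- Started in the store `σ`, the program `p` ends after at most `t` steps, within the limits, in a
store that satisfies `Q`. -/
def Ok (L : Lim) (p : Com) (σ : Store) (t : ℕ) (Q : Store → Prop) : Prop :=
  ∀ (prog : Program) (off : ℕ), CodeAt prog off (p.code off) → (σ.at off).WordsWithin L.W →
    ∃ u ≤ t, ∃ σ' : Store, Q σ' ∧ Safe L prog (σ.at off) u (σ'.at (off + p.size))

theorem Ok.mono {L : Lim} {p : Com} {σ : Store} {t t' : ℕ} {Q Q' : Store → Prop}
    (h : Ok L p σ t Q) (ht : t ≤ t') (hQ : ∀ σ', Q σ' → Q' σ') : Ok L p σ t' Q' := by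
  intro prog off hc hw
  obtain ⟨u, hu, σ', hq, hs⟩ := h prog off hc hw
  exact ⟨u, hu.trans ht, σ', hQ _ hq, hs⟩

theorem Ok.skip {L : Lim} {σ : Store} {Q : Store → Prop} (h : Q σ) : Ok L .skip σ 0 Q :=
  fun _ _ _ hw => ⟨0, le_rfl, σ, h, Safe.refl hw⟩

theorem words_update {W : ℕ} {f : ℕ → ℕ} (hf : ∀ r, f r ≤ W) {v : ℕ} (hv : v ≤ W) (d r : ℕ) :
    Function.update f d v r ≤ W := by
  rw [Function.update_apply]; split_ifs <;> [exact hv; exact hf r]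

theorem Ok.ins {L : Lim} {i : Instr} {σ : Store} {Q : Store → Prop} (hg : σ.Guard L i)
    (h : Q (σ.exec i)) : Ok L (.ins i) σ 1 Q := by
  intro prog off hc hw
  have hi : prog[off]? = some i := hc.head
  refine ⟨1, le_rfl, σ.exec i, h, Safe.single ?_ ?_ hw ?_⟩
  · have : prog.step (σ.at off) = i.exec (σ.at off) := by
      simp [Program.step, Store.at, hi]
    rw [this]
    cases i <;> first | rfl | exact absurd hg (by simp [Store.Guard])
  · unfold Program.AccessWithin
    simp only [Store.at, hi]
    cases i <;> trivial
  · obtain ⟨h1, h2⟩ := hw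
    cases i with
    | intConst d v => exact ⟨words_update h1 hg d, h2⟩
    | intArith op d a b =>
      refine ⟨words_update h1 ?_ d, h2⟩
      cases op
      · exact hg
      · exact (Nat.sub_le _ _).trans (h1 a)
      · exact hg
      · exact (Nat.div_le_self _ _).trans (h1 a)
    | intLoad d a => exact ⟨words_update h1 (h2 _) d, h2⟩
    | intStore a s => exact ⟨h1, words_update h2 (h1 _) _⟩
    | _ => exact ⟨h1, h2⟩

theorem Ok.seq {L : Lim} {p q : Com} {σ : Store} {t u : ℕ} {Q : Store → Prop}
    (h : Ok L p σ t (fun σ' => Ok L q σ' u Q)) : Ok L (.seq p q) σ (t + u) Q := by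
  intro prog off hc hw
  obtain ⟨a, ha, σ', hq, hs⟩ := h prog off hc.left hw
  have hc' := hc.right
  rw [Com.length_code] at hc'
  obtain ⟨b, hb, σ'', hq', hs'⟩ := hq prog _ hc' hs.words
  exact ⟨a + b, by omega, σ'', hq', by
    have := hs.trans hs'
    rwa [add_assoc] at this⟩

theorem safe_jump {L : Lim} {prog : Program} {σ : Store} {off l : ℕ}
    (h : prog[off]? = some (.jump l)) (hw : (σ.at off).WordsWithin L.W) :
    Safe L prog (σ.at off) 1 (σ.at l) := by
  refine Safe.single ?_ ?_ hw hw
  · simp [Program.step, Store.at, h, Instr.exec]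
  · simp [Program.AccessWithin, Store.at, h]

open Classical in
theorem safe_test {L : Lim} {prog : Program} {σ : Store} {off l : ℕ} {c : Test}
    (h : prog[off]? = some (c.instr l)) (hw : (σ.at off).WordsWithin L.W) :
    Safe L prog (σ.at off) 1 (σ.at (if c.Holds σ then l else off + 1)) := by
  refine Safe.single ?_ ?_ hw hw
  · cases c <;> simp [Program.step, Store.at, h, Test.instr, Instr.exec, Test.Holds] <;> congr
  · cases c <;> simp [Program.AccessWithin, Store.at, h, Test.instr]

theorem Ok.ite {L : Lim} {c : Test} {p q : Com} {σ : Store} {t : ℕ} {Q : Store → Prop}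
    (hp : c.Holds σ → Ok L p σ t Q) (hq : ¬ c.Holds σ → Ok L q σ t Q) :
    Ok L (.ite c p q) σ (2 + t) Q := by
  intro prog off hc hw
  have h1 := hc.left.head
  have h2 := hc.right.left
  have h3 := hc.right.right.left.head
  have h4 := hc.right.right.right
  simp only [Com.length_code, List.length_singleton] at h2 h3 h4
  have hs := safe_test h1 hw
  by_cases hh : c.Holds σ
  · rw [if_pos hh] at hs
    have h4' : CodeAt prog (off + 2 + q.size) (p.code (off + 2 + q.size)) := by
      convert h4 using 1; omega
    obtain ⟨u, hu, σ', hQ, hs'⟩ := hp hh prog _ h4' hs.words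
    refine ⟨1 + u, by omega, σ', hQ, ?_⟩
    convert hs.trans hs' using 2
    simp only [Com.size]; omega
  · rw [if_neg hh] at hs
    obtain ⟨u, hu, σ', hQ, hs'⟩ := hq hh prog _ h2 hs.words
    have hj := safe_jump (σ := σ') (L := L) h3 hs'.words
    refine ⟨1 + u + 1, by omega, σ', hQ, ?_⟩
    convert (hs.trans hs').trans hj using 2
    simp only [Com.size]; omega

/-- Loops, with an invariant and a potential that pays for the running time. -/
theorem Ok.loop {L : Lim} {c : Test} {p : Com} (Inv : Store → Prop) (V : Store → ℕ)
    (step : ∀ σ, Inv σ → c.Holds σ →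
      ∃ t, Ok L p σ t (fun σ' => Inv σ' ∧ t + 2 + V σ' ≤ V σ)) :
    ∀ σ, Inv σ → Ok L (.loop c p) σ (V σ + 2) (fun σ' => Inv σ' ∧ ¬ c.Holds σ') := by
  intro σ hσ prog off hc
  have h1 := hc.left.head
  have h2 := hc.right.left.head
  have h3 := hc.right.right.left
  have h4 := hc.right.right.right.head
  simp only [Com.length_code, List.length_singleton] at h2 h3 h4
  suffices H : ∀ (m : ℕ) (σ : Store), V σ ≤ m → Inv σ → (σ.at off).WordsWithin L.W →
      ∃ u ≤ V σ + 2, ∃ σ' : Store, (Inv σ' ∧ ¬ c.Holds σ') ∧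
        Safe L prog (σ.at off) u (σ'.at (off + (Com.loop c p).size)) from
    H _ σ le_rfl hσ
  intro m
  induction m with
  | zero =>
    intro σ hm hσ hw
    by_cases hh : c.Holds σ
    · obtain ⟨t, ht⟩ := step σ hσ hh
      have hs := safe_test h1 hw
      rw [if_pos hh] at hs
      obtain ⟨u, hu, σ', hQ, hs'⟩ := ht prog _ h3 hs.words
      omega
    · have hs := safe_test h1 hw
      rw [if_neg hh] at hs
      refine ⟨1 + 1, by omega, σ, ⟨hσ, hh⟩, ?_⟩
      convert hs.trans (safe_jump h2 hs.words) using 2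
      simp only [Com.size]; omega
  | succ m ih =>
    intro σ hm hσ hw
    have hs := safe_test h1 hw
    by_cases hh : c.Holds σ
    · obtain ⟨t, ht⟩ := step σ hσ hh
      rw [if_pos hh] at hs
      obtain ⟨u, hu, σ', hQ, hs'⟩ := ht prog _ h3 hs.words
      have hs'' := hs.trans hs'
      have hj : Safe L prog (σ'.at (off + 2 + p.size)) 1 (σ'.at off) :=
        safe_jump h4 hs''.words
      have h5 := hs''.trans hj
      obtain ⟨v, hv, τ, hτ, h6⟩ := ih σ' (by omega) hQ.1 h5.words
      exact ⟨1 + u + 1 + v, by omega, τ, hτ, h5.trans h6⟩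
    · rw [if_neg hh] at hs
      refine ⟨1 + 1, by omega, σ, ⟨hσ, hh⟩, ?_⟩
      convert hs.trans (safe_jump h2 hs.words) using 2
      simp only [Com.size]; omega

/-- Weakest precondition of a program without loops. -/
def wp (L : Lim) : Com → (Store → Prop) → Store → Prop
  | .skip, Q, σ => Q σ
  | .ins i, Q, σ => σ.Guard L i ∧ Q (σ.exec i)
  | .seq p q, Q, σ => wp L p (wp L q Q) σ
  | .ite c p q, Q, σ => (c.Holds σ → wp L p Q σ) ∧ (¬ c.Holds σ → wp L q Q σ)
  | .loop _ _, _, _ => False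

/-- Bound on the running time of a program without loops. -/
def Com.cost : Com → ℕ
  | .skip => 0
  | .ins _ => 1
  | .seq p q => p.cost + q.cost
  | .ite _ p q => 2 + (p.cost + q.cost)
  | .loop _ _ => 0

theorem Ok.of_wp {L : Lim} {p : Com} : ∀ {Q : Store → Prop} {σ : Store}, wp L p Q σ →
    Ok L p σ p.cost Q := by
  induction p with
  | skip => intro Q σ h; exact Ok.skip h
  | ins i => intro Q σ h; exact Ok.ins h.1 h.2
  | seq p q hp hq =>
    intro Q σ h
    exact Ok.seq ((hp h).mono le_rfl fun _ h' => hq h')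
  | ite c p q hp hq =>
    intro Q σ h
    exact Ok.ite (fun hc => (hp (h.1 hc)).mono (Nat.le_add_right _ _) fun _ => id)
      (fun hc => (hq (h.2 hc)).mono (Nat.le_add_left _ _) fun _ => id)
  | loop c p _ => intro Q σ h; exact h.elim

theorem wp_mono {L : Lim} {p : Com} : ∀ {Q Q' : Store → Prop} {σ : Store},
    (∀ σ, Q σ → Q' σ) → wp L p Q σ → wp L p Q' σ := by
  induction p with
  | skip => intro Q Q' σ h; exact h σ
  | ins i => intro Q Q' σ h h'; exact ⟨h'.1, h _ h'.2⟩
  | seq p q hp hq => intro Q Q' σ h h'; exact hp (fun _ => hq h) h'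
  | ite c p q hp hq =>
    intro Q Q' σ h h'
    exact ⟨fun hc => hp h (h'.1 hc), fun hc => hq h (h'.2 hc)⟩
  | loop c p _ => intro Q Q' σ h h'; exact h'

/-- Sequential composition of a list of programs. -/
def block : List Com → Com
  | [] => .skip
  | p :: ps => .seq p (block ps)

theorem Ok.cons {L : Lim} {p : Com} {ps : List Com} {σ : Store} {t u : ℕ} {Q : Store → Prop}
    (h : Ok L p σ t (fun σ' => Ok L (block ps) σ' u Q)) : Ok L (block (p :: ps)) σ (t + u) Q :=
  Ok.seq h

theorem Ok.nil {L : Lim} {σ : Store} {Q : Store → Prop} (h : Q σ) : Ok L (block []) σ 0 Q :=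
  Ok.skip h

/-! ### Abbreviations for instructions -/

def iset (d c : ℕ) : Com := .ins (.intConst d c)
def iadd (d a b : ℕ) : Com := .ins (.intArith .add d a b)
def isub (d a b : ℕ) : Com := .ins (.intArith .sub d a b)
def imul (d a b : ℕ) : Com := .ins (.intArith .mul d a b)
def idiv (d a b : ℕ) : Com := .ins (.intArith .div d a b)
def iload (d a : ℕ) : Com := .ins (.intLoad d a)
def istore (a s : ℕ) : Com := .ins (.intStore a s)
def rset (d : ℕ) (q : ℚ) : Com := .ins (.realConst d q)
def radd (d a b : ℕ) : Com := .ins (.realArith .add d a b)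
def rsub (d a b : ℕ) : Com := .ins (.realArith .sub d a b)
def rmul (d a b : ℕ) : Com := .ins (.realArith .mul d a b)
def rload (d a : ℕ) : Com := .ins (.realLoad d a)

section
variable {L : Lim} {Q : Store → Prop} {σ : Store} {d a b c s : ℕ} {q : ℚ}

theorem wp_iset : wp L (iset d c) Q σ ↔
    c ≤ L.W ∧ Q ⟨Function.update σ.I d c, σ.R, σ.M, σ.Z⟩ := Iff.rfl
theorem wp_iadd : wp L (iadd d a b) Q σ ↔ σ.I a + σ.I b ≤ L.W ∧
    Q ⟨Function.update σ.I d (σ.I a + σ.I b), σ.R, σ.M, σ.Z⟩ := Iff.rfl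
theorem wp_isub : wp L (isub d a b) Q σ ↔
    Q ⟨Function.update σ.I d (σ.I a - σ.I b), σ.R, σ.M, σ.Z⟩ := iff_of_eq (true_and _)
theorem wp_imul : wp L (imul d a b) Q σ ↔ σ.I a * σ.I b ≤ L.W ∧
    Q ⟨Function.update σ.I d (σ.I a * σ.I b), σ.R, σ.M, σ.Z⟩ := Iff.rfl
theorem wp_idiv : wp L (idiv d a b) Q σ ↔
    Q ⟨Function.update σ.I d (σ.I a / σ.I b), σ.R, σ.M, σ.Z⟩ := iff_of_eq (true_and _)
theorem wp_iload : wp L (iload d a) Q σ ↔ σ.I a < L.sI ∧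
    Q ⟨Function.update σ.I d (σ.M (σ.I a)), σ.R, σ.M, σ.Z⟩ := Iff.rfl
theorem wp_istore : wp L (istore a s) Q σ ↔ σ.I a < L.sI ∧
    Q ⟨σ.I, σ.R, Function.update σ.M (σ.I a) (σ.I s), σ.Z⟩ := Iff.rfl
theorem wp_radd : wp L (radd d a b) Q σ ↔
    Q ⟨σ.I, Function.update σ.R d (σ.R a + σ.R b), σ.M, σ.Z⟩ := iff_of_eq (true_and _)
theorem wp_rsub : wp L (rsub d a b) Q σ ↔
    Q ⟨σ.I, Function.update σ.R d (σ.R a - σ.R b), σ.M, σ.Z⟩ := iff_of_eq (true_and _)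
theorem wp_rmul : wp L (rmul d a b) Q σ ↔
    Q ⟨σ.I, Function.update σ.R d (σ.R a * σ.R b), σ.M, σ.Z⟩ := iff_of_eq (true_and _)
theorem wp_rload : wp L (rload d a) Q σ ↔ σ.I a < L.sR ∧
    Q ⟨σ.I, Function.update σ.R d (σ.Z (σ.I a)), σ.M, σ.Z⟩ := Iff.rfl
theorem wp_ite_int {p r : Com} : wp L (.ite (.int a b) p r) Q σ ↔
    (σ.I a < σ.I b → wp L p Q σ) ∧ (¬ σ.I a < σ.I b → wp L r Q σ) := Iff.rfl
theorem wp_ite_real {p r : Com} : wp L (.ite (.real a b) p r) Q σ ↔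
    (σ.R a < σ.R b → wp L p Q σ) ∧ (¬ σ.R a < σ.R b → wp L r Q σ) := Iff.rfl
theorem wp_skip : wp L .skip Q σ ↔ Q σ := Iff.rfl
theorem wp_block_nil : wp L (block []) Q σ ↔ Q σ := Iff.rfl
theorem wp_block_cons {p : Com} {ps : List Com} :
    wp L (block (p :: ps)) Q σ ↔ wp L p (wp L (block ps) Q) σ := Iff.rfl

end

end CSSA

namespace CSSA

/-! ## Color-spanning annuli in terms of their outer square -/

/-- The annulus of width `w` whose outer square is `[x₀, x₀ + s] × [b, b + s]` contains a point of
each of the `k` colors. -/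
def FeasAt (n k : ℕ) (col : ℕ → ℕ) (X Y : ℕ → ℝ) (x₀ s w b : ℝ) : Prop :=
  ∀ c < k, ∃ p < n, col p = c ∧ (x₀ ≤ X p ∧ X p ≤ x₀ + s) ∧ (b ≤ Y p ∧ Y p ≤ b + s) ∧
    ((X p - x₀ ≤ w ∨ x₀ + s - X p ≤ w) ∨ (Y p - b ≤ w ∨ b + s - Y p ≤ w))

variable {n k : ℕ} {col : ℕ → ℕ} {X Y : ℕ → ℝ} {x₀ s w b : ℝ}

theorem FeasAt.mono {w' : ℝ} (h : FeasAt n k col X Y x₀ s w b) (hw : w ≤ w') :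
    FeasAt n k col X Y x₀ s w' b := by
  intro c hc
  obtain ⟨p, hp, h1, h2, h3, h4⟩ := h c hc
  refine ⟨p, hp, h1, h2, h3, ?_⟩
  rcases h4 with (h | h) | (h | h)
  · exact Or.inl (Or.inl (h.trans hw))
  · exact Or.inl (Or.inr (h.trans hw))
  · exact Or.inr (Or.inl (h.trans hw))
  · exact Or.inr (Or.inr (h.trans hw))

theorem FeasAt.half (h : FeasAt n k col X Y x₀ s w b) : FeasAt n k col X Y x₀ s (min w (s / 2)) b := by
  rcases le_total w (s / 2) with hw | hw
  · rwa [min_eq_left hw]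
  · rw [min_eq_right hw]
    intro c hc
    obtain ⟨p, hp, h1, h2, h3, h4⟩ := h c hc
    refine ⟨p, hp, h1, h2, h3, Or.inl ?_⟩
    by_contra hcon
    push Not at hcon
    linarith [hcon.1, hcon.2]

theorem FeasAt.nonneg (h : FeasAt n k col X Y x₀ s w b) (hk : 1 ≤ k) : 0 ≤ w := by
  obtain ⟨p, hp, h1, h2, h3, h4⟩ := h 0 hk
  rcases h4 with (h | h) | (h | h) <;> linarith [h2.1, h2.2, h3.1, h3.2]

/-- The outer square may be moved down until a point enters the annulus. -/
theorem FeasAt.exists_start (h : FeasAt n k col X Y x₀ s w b) (hk : 1 ≤ k) (hws : w ≤ s) :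
    ∃ q < n, FeasAt n k col X Y x₀ s w (Y q - s) ∨ FeasAt n k col X Y x₀ s w (Y q - w) := by
  classical
  choose! f hf using h
  let low : ℕ → ℝ := fun c =>
    if X (f c) - x₀ ≤ w ∨ x₀ + s - X (f c) ≤ w then Y (f c) - s
    else if Y (f c) - b ≤ w then Y (f c) - w else Y (f c) - s
  obtain ⟨m, hm, hmax⟩ := Finset.exists_max_image (Finset.range k) low ⟨0, Finset.mem_range.2 hk⟩
  rw [Finset.mem_range] at hm
  have key : FeasAt n k col X Y x₀ s w (low m) := by
    intro c hc
    obtain ⟨h1, h2, h3, h4, h5⟩ := hf c hc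
    have hle := hmax c (Finset.mem_range.2 hc)
    have hmb : low m ≤ b := by
      obtain ⟨h1, h2, h3, h4, h5⟩ := hf m hm
      simp only [low]
      split_ifs with h6 h7
      · linarith
      · linarith
      · linarith
    refine ⟨f c, h1, h2, h3, ?_⟩
    simp only [low] at hle hmb ⊢
    by_cases h6 : X (f c) - x₀ ≤ w ∨ x₀ + s - X (f c) ≤ w
    · rw [if_pos h6] at hle
      exact ⟨⟨by linarith, by linarith⟩, Or.inl h6⟩
    · rw [if_neg h6] at hle
      have h7 := h5.resolve_left h6
      by_cases h8 : Y (f c) - b ≤ w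
      · rw [if_pos h8] at hle
        exact ⟨⟨by linarith, by linarith⟩, Or.inr (Or.inl (by linarith))⟩
      · rw [if_neg h8] at hle
        have h9 := h7.resolve_left h8
        exact ⟨⟨by linarith, by linarith⟩, Or.inr (Or.inr (by linarith))⟩
  refine ⟨f m, (hf m hm).1, ?_⟩
  simp only [low] at key
  split_ifs at key with h6 h7
  · exact Or.inl key
  · exact Or.inr key
  · exact Or.inl key

/-- The candidates for the width of an optimal annulus with outer side length `s`. -/
def IsCand (n : ℕ) (X Y : ℕ → ℝ) (s v : ℝ) : Prop :=
  ∃ p < n, ∃ q < n, v = X q - X p ∨ v = Y q - Y p ∨ v = (s - (Y q - Y p)) / 2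

theorem FeasAt.exists_cand (h : FeasAt n k col X Y x₀ s w b) (hk : 1 ≤ k) {i j : ℕ} (hi : i < n)
    (hj : j < n) (hxi : X i = x₀) (hxj : X j = x₀ + s) :
    ∃ v ≤ w, IsCand n X Y s v ∧ ∃ b', FeasAt n k col X Y x₀ s v b' := by
  classical
  choose! f hf using h
  have hne : (Finset.range k).Nonempty := ⟨0, Finset.mem_range.2 hk⟩
  obtain ⟨t, ht, htmax⟩ := Finset.exists_max_image (Finset.range k) (fun c => Y (f c)) hne
  obtain ⟨u, hu, humin⟩ := Finset.exists_min_image (Finset.range k) (fun c => Y (f c)) hne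
  simp only [Finset.mem_range] at ht hu htmax humin
  let side : ℕ → Prop := fun c => X (f c) - x₀ ≤ w ∨ x₀ + s - X (f c) ≤ w
  let bot : ℕ → Prop := fun c => Y (f c) - b ≤ w
  let val : ℕ → ℝ → ℝ := fun c b' =>
    if side c then min (X (f c) - x₀) (x₀ + s - X (f c))
    else if bot c then Y (f c) - b' else b' + s - Y (f c)
  have vside : ∀ c b', side c → val c b' = min (X (f c) - x₀) (x₀ + s - X (f c)) :=
    fun c b' h => if_pos h
  have vbot : ∀ c b', ¬ side c → bot c → val c b' = Y (f c) - b' :=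
    fun c b' h h' => (if_neg h).trans (if_pos h')
  have vtop : ∀ c b', ¬ side c → ¬ bot c → val c b' = b' + s - Y (f c) :=
    fun c b' h h' => (if_neg h).trans (if_neg h')
  have sidew : ∀ c, side c → min (X (f c) - x₀) (x₀ + s - X (f c)) ≤ w := by
    intro c h
    rcases h with h | h
    · exact (min_le_left _ _).trans h
    · exact (min_le_right _ _).trans h
  have sidecand : ∀ c < k, IsCand n X Y s (min (X (f c) - x₀) (x₀ + s - X (f c))) := by
    intro c hc
    rcases min_choice (X (f c) - x₀) (x₀ + s - X (f c)) with h | h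
    · exact ⟨i, hi, f c, (hf c hc).1, Or.inl (by rw [h, hxi])⟩
    · exact ⟨f c, (hf c hc).1, j, hj, Or.inl (by rw [h, hxj])⟩
  have topw : ∀ c < k, ¬ side c → ¬ bot c → b + s - Y (f c) ≤ w := by
    intro c hc h h'
    exact ((hf c hc).2.2.2.2.resolve_left h).resolve_left h'
  have hlo : Y (f t) - s ≤ b := by linarith [(hf t ht).2.2.2.1.2]
  have hhi : b ≤ Y (f u) := (hf u hu).2.2.2.1.1
  have feas : ∀ b', Y (f t) - s ≤ b' → b' ≤ Y (f u) → ∀ v, (∀ c < k, val c b' ≤ v) →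
      FeasAt n k col X Y x₀ s v b' := by
    intro b' h1 h2 v hv c hc
    have h3 := hv c hc
    refine ⟨f c, (hf c hc).1, (hf c hc).2.1, (hf c hc).2.2.1,
      ⟨h2.trans (humin c hc), by linarith [htmax c hc]⟩, ?_⟩
    by_cases hs : side c
    · rw [vside c b' hs, min_le_iff] at h3
      exact Or.inl h3
    · by_cases hb : bot c
      · rw [vbot c b' hs hb] at h3
        exact Or.inr (Or.inl h3)
      · rw [vtop c b' hs hb] at h3
        exact Or.inr (Or.inr h3)
  have hmaxi : ∀ b', ∃ m < k, ∀ c < k, val c b' ≤ val m b' := by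
    intro b'
    obtain ⟨m, hm, h⟩ := Finset.exists_max_image (Finset.range k) (fun c => val c b') hne
    exact ⟨m, by simpa using hm, fun c hc => h c (by simpa using hc)⟩
  obtain ⟨m, hm, hmm⟩ := hmaxi (Y (f t) - s)
  obtain ⟨m', hm', hmm'⟩ := hmaxi (Y (f u))
  have hsidecase : ∀ b' m, m < k → Y (f t) - s ≤ b' → b' ≤ Y (f u) → side m →
      (∀ c < k, val c b' ≤ val m b') →
      ∃ v ≤ w, IsCand n X Y s v ∧ ∃ b', FeasAt n k col X Y x₀ s v b' := by
    intro b' m hm h1 h2 hs hmm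
    refine ⟨val m b', ?_, ?_, b', feas b' h1 h2 _ hmm⟩
    · rw [vside m b' hs]; exact sidew m hs
    · rw [vside m b' hs]; exact sidecand m hm
  by_cases hs : side m
  · exact hsidecase _ m hm le_rfl (hlo.trans hhi) hs hmm
  by_cases hb : bot m
  swap
  · refine ⟨_, ?_, ?_, _, feas _ le_rfl (hlo.trans hhi) _ hmm⟩
    · rw [vtop m _ hs hb]; linarith [topw m hm hs hb]
    · rw [vtop m _ hs hb]
      exact ⟨f m, (hf m hm).1, f t, (hf t ht).1, Or.inr (Or.inl (by ring))⟩
  by_cases hs' : side m'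
  · exact hsidecase _ m' hm' (hlo.trans hhi) le_rfl hs' hmm'
  by_cases hb' : bot m'
  · refine ⟨_, ?_, ?_, _, feas _ (hlo.trans hhi) le_rfl _ hmm'⟩
    · rw [vbot m' _ hs' hb']
      have : Y (f m') - b ≤ w := hb'
      linarith
    · rw [vbot m' _ hs' hb']
      exact ⟨f u, (hf u hu).1, f m', (hf m' hm').1, Or.inr (Or.inl rfl)⟩
  -- the two families balance each other
  set b' := (Y (f m) + Y (f m') - s) / 2 with hb'def
  have h1 := hmm m' hm'
  rw [vtop m' _ hs' hb', vbot m _ hs hb] at h1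
  have h2 := hmm' m hm
  rw [vtop m' _ hs' hb', vbot m _ hs hb] at h2
  have hl : Y (f t) - s ≤ b' := by rw [hb'def]; linarith
  have hr : b' ≤ Y (f u) := by rw [hb'def]; linarith
  obtain ⟨q, hq, hqm⟩ := hmaxi b'
  by_cases hsq : side q
  · exact hsidecase _ q hq hl hr hsq hqm
  have hv : val q b' = (s - (Y (f m') - Y (f m))) / 2 := by
    apply le_antisymm
    · by_cases hbq : bot q
      · have := hmm q hq
        rw [vbot q _ hsq hbq, vbot m _ hs hb] at this
        rw [vbot q _ hsq hbq, hb'def]; linarith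
      · have := hmm' q hq
        rw [vtop q _ hsq hbq, vtop m' _ hs' hb'] at this
        rw [vtop q _ hsq hbq, hb'def]; linarith
    · have := hqm m hm
      rw [vbot m _ hs hb] at this
      rw [hb'def] at this ⊢
      linarith
  refine ⟨val q b', ?_, ?_, b', feas b' hl hr _ hqm⟩
  · have h3 := topw m' hm' hs' hb'
    have h4 : Y (f m) - b ≤ w := hb
    rw [hv]; linarith
  · rw [hv]
    exact ⟨f m, (hf m hm).1, f m', (hf m' hm').1, Or.inr (Or.inr rfl)⟩

/-- An annulus may be shrunk until its outer square is as wide as the chosen points. -/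
theorem feasAt_of_annulus_aux {cx cy r R : ℝ} {f : ℕ → ℕ}
    (hf : ∀ c < k, f c < n ∧ col (f c) = c ∧ r ≤ max |X (f c) - cx| |Y (f c) - cy| ∧
      max |X (f c) - cx| |Y (f c) - cy| ≤ R)
    {i j t u : ℕ} (hi : i < k) (hj : j < k) (ht : t < k)
    (himin : ∀ c < k, X (f i) ≤ X (f c)) (hjmax : ∀ c < k, X (f c) ≤ X (f j))
    (humin : ∀ c < k, Y (f u) ≤ Y (f c)) (htmax : ∀ c < k, Y (f c) ≤ Y (f t))
    (hle : Y (f t) - Y (f u) ≤ X (f j) - X (f i)) :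
    ∃ i < n, ∃ j < n, ∃ w b, w ≤ R - r ∧ w ≤ (X j - X i) / 2 ∧
      FeasAt n k col X Y (X i) (X j - X i) w b := by
  have hbox : ∀ c < k, cx - R ≤ X (f c) ∧ X (f c) ≤ cx + R ∧ cy - R ≤ Y (f c) ∧
      Y (f c) ≤ cy + R := by
    intro c hc
    obtain ⟨_, _, _, h⟩ := hf c hc
    rw [max_le_iff, abs_le, abs_le] at h
    exact ⟨by linarith, by linarith, by linarith, by linarith⟩
  have hfe : FeasAt n k col X Y (X (f i)) (X (f j) - X (f i)) (R - r)
      (max (cy - R) (Y (f t) - (X (f j) - X (f i)))) := by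
    intro c hc
    obtain ⟨h1, h2, h3, h4⟩ := hf c hc
    have h5 := hbox c hc
    have h6 := hbox i hi
    have h7 := hbox j hj
    have hb1 := le_max_left (cy - R) (Y (f t) - (X (f j) - X (f i)))
    have hb2 := le_max_right (cy - R) (Y (f t) - (X (f j) - X (f i)))
    have hb3 : max (cy - R) (Y (f t) - (X (f j) - X (f i))) + (X (f j) - X (f i)) ≤ cy + R := by
      rcases max_choice (cy - R) (Y (f t) - (X (f j) - X (f i))) with h | h <;> rw [h]
      · linarith
      · linarith [hbox t ht]
    refine ⟨f c, h1, h2, ⟨himin c hc, by linarith [hjmax c hc]⟩,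
      ⟨max_le (by linarith) (by linarith [humin c hc]), by linarith [htmax c hc]⟩, ?_⟩
    rw [le_max_iff, le_abs, le_abs] at h3
    rcases h3 with (h3 | h3) | (h3 | h3)
    · exact Or.inl (Or.inr (by linarith))
    · exact Or.inl (Or.inl (by linarith))
    · exact Or.inr (Or.inr (by linarith))
    · exact Or.inr (Or.inl (by linarith))
  exact ⟨f i, (hf i hi).1, f j, (hf j hj).1, _, _, min_le_left _ _, min_le_right _ _, hfe.half⟩

theorem feasAt_of_annulus {cx cy r R : ℝ} (hk : 1 ≤ k)
    (h : ∀ c < k, ∃ p < n, col p = c ∧ r ≤ max |X p - cx| |Y p - cy| ∧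
      max |X p - cx| |Y p - cy| ≤ R) :
    (∃ i < n, ∃ j < n, ∃ w b, w ≤ R - r ∧ w ≤ (X j - X i) / 2 ∧
      FeasAt n k col X Y (X i) (X j - X i) w b) ∨
    (∃ i < n, ∃ j < n, ∃ w b, w ≤ R - r ∧ w ≤ (Y j - Y i) / 2 ∧
      FeasAt n k col Y X (Y i) (Y j - Y i) w b) := by
  choose! f hf using h
  have hne : (Finset.range k).Nonempty := ⟨0, Finset.mem_range.2 hk⟩
  obtain ⟨t, ht, htmax⟩ := Finset.exists_max_image (Finset.range k) (fun c => Y (f c)) hne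
  obtain ⟨u, hu, humin⟩ := Finset.exists_min_image (Finset.range k) (fun c => Y (f c)) hne
  obtain ⟨j, hj, hjmax⟩ := Finset.exists_max_image (Finset.range k) (fun c => X (f c)) hne
  obtain ⟨i, hi, himin⟩ := Finset.exists_min_image (Finset.range k) (fun c => X (f c)) hne
  simp only [Finset.mem_range] at ht hu hi hj htmax humin hjmax himin
  rcases le_total (Y (f t) - Y (f u)) (X (f j) - X (f i)) with hle | hle
  · exact Or.inl (feasAt_of_annulus_aux hf hi hj ht himin hjmax humin htmax hle)
  · refine Or.inr (feasAt_of_annulus_aux (X := Y) (Y := X) (cx := cy) (cy := cx) (f := f) ?_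
      hu ht hj humin htmax himin hjmax hle)
    intro c hc
    have := hf c hc
    rwa [max_comm] at this

/-! ### Squares and annuli in the plane -/

theorem distInf_le_dist (a b : Plane) : distInf a b ≤ dist a b := by
  rw [EuclideanSpace.dist_eq, Fin.sum_univ_two, distInf]
  apply Real.le_sqrt_of_sq_le
  rw [Real.dist_eq, Real.dist_eq]
  rcases max_choice |a 0 - b 0| |a 1 - b 1| with h | h <;> rw [h]
  · linarith [sq_nonneg |a 1 - b 1|]
  · linarith [sq_nonneg |a 0 - b 0|]

theorem SquareAnnulus.width_eq (A : SquareAnnulus) : A.width = A.outer - A.inner := by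
  have hi := A.inner_pos
  have ho := A.inner_le_outer
  apply IsLeast.csInf_eq
  constructor
  · refine ⟨!₂[A.center 0 + A.inner, A.center 1], ?_, !₂[A.center 0 + A.outer, A.center 1], ?_, ?_⟩
    · simp [SquareAnnulus.innerCurve, squareCurve, distInf, abs_of_pos hi, hi.le]
    · simp [SquareAnnulus.outerCurve, squareCurve, distInf, abs_of_pos (hi.trans_le ho),
        (hi.trans_le ho).le]
    · rw [EuclideanSpace.dist_eq, Fin.sum_univ_two]
      simp only [Real.dist_eq]
      simp [Real.sqrt_sq_eq_abs, abs_sub_comm A.inner, abs_of_nonneg (sub_nonneg.2 ho)]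
  · rintro d ⟨a, ha, b, hb, rfl⟩
    have ha' : max |a 0 - A.center 0| |a 1 - A.center 1| = A.inner := ha
    have hb' : max |b 0 - A.center 0| |b 1 - A.center 1| = A.outer := hb
    have h := distInf_le_dist a b
    refine le_trans ?_ h
    have h0 : |b 0 - A.center 0| ≤ |a 0 - b 0| + |a 0 - A.center 0| := by
      have := abs_sub_le (b 0) (a 0) (A.center 0)
      rwa [abs_sub_comm (b 0) (a 0)] at this
    have h1 : |b 1 - A.center 1| ≤ |a 1 - b 1| + |a 1 - A.center 1| := by
      have := abs_sub_le (b 1) (a 1) (A.center 1)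
      rwa [abs_sub_comm (b 1) (a 1)] at this
    have h2 : |a 0 - A.center 0| ≤ A.inner := ha' ▸ le_max_left _ _
    have h3 : |a 1 - A.center 1| ≤ A.inner := ha' ▸ le_max_right _ _
    have h4 : |a 0 - b 0| ≤ distInf a b := le_max_left _ _
    have h5 : |a 1 - b 1| ≤ distInf a b := le_max_right _ _
    have : A.outer ≤ distInf a b + A.inner := by
      rw [← hb']; exact max_le (by linarith) (by linarith)
    linarith

/-- The annulus with a given outer square contains a point of the annular shape. -/
theorem region_of_shape {x₀ s w b x y : ℝ} (hx : x₀ ≤ x ∧ x ≤ x₀ + s) (hy : b ≤ y ∧ y ≤ b + s)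
    (h : (x - x₀ ≤ w ∨ x₀ + s - x ≤ w) ∨ (y - b ≤ w ∨ b + s - y ≤ w)) :
    s / 2 - w ≤ max |x - (x₀ + s / 2)| |y - (b + s / 2)| ∧
      max |x - (x₀ + s / 2)| |y - (b + s / 2)| ≤ s / 2 := by
  constructor
  · rw [le_max_iff, le_abs, le_abs]
    rcases h with (h | h) | (h | h)
    · exact Or.inl (Or.inr (by linarith))
    · exact Or.inl (Or.inl (by linarith))
    · exact Or.inr (Or.inr (by linarith))
    · exact Or.inr (Or.inl (by linarith))
  · exact max_le (abs_le.2 ⟨by linarith, by linarith⟩) (abs_le.2 ⟨by linarith, by linarith⟩)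

/-- Moving the center slightly turns a square into an annulus with a small hole. -/
theorem region_shift {cx cy x y R ε : ℝ} (hε : 0 < ε)
    (h : 0 < max |x - cx| |y - cy| → 2 * ε ≤ max |x - cx| |y - cy|)
    (hR : max |x - cx| |y - cy| ≤ R) :
    ε ≤ max |x - (cx + ε)| |y - cy| ∧ max |x - (cx + ε)| |y - cy| ≤ R + ε := by
  have h1 : |x - (cx + ε)| ≤ |x - cx| + ε := by
    have := abs_sub_le x cx (cx + ε)
    rwa [show cx - (cx + ε) = -ε by ring, abs_neg, abs_of_pos hε] at this
  have h2 : |x - cx| ≤ |x - (cx + ε)| + ε := by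
    have := abs_sub_le x (cx + ε) cx
    rwa [show cx + ε - cx = ε by ring, abs_of_pos hε] at this
  have h3 := le_max_left |x - cx| |y - cy|
  have h4 := le_max_right |x - cx| |y - cy|
  refine ⟨?_, max_le (by linarith) (by linarith)⟩
  rcases (le_max_of_le_left (abs_nonneg (x - cx)) : 0 ≤ max |x - cx| |y - cy|).eq_or_lt with h0 | h0
  · have h5 : |x - cx| = 0 := le_antisymm (by linarith) (abs_nonneg _)
    rw [abs_eq_zero] at h5
    refine le_max_of_le_left ?_
    rw [show x - (cx + ε) = -ε by linarith, abs_neg, abs_of_pos hε]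
  · have h5 := h h0
    rw [le_max_iff] at h5
    rcases h5 with h5 | h5
    · exact le_max_of_le_left (by linarith)
    · exact le_max_of_le_right (by linarith)

end CSSA

namespace CSSA

/-! ## The data in memory -/

/-- `σ'` differs from `σ` at most in the integer registers `li`, the real registers `lr` and the
integer memory. -/
def Frame (li lr : List ℕ) (σ σ' : Store) : Prop :=
  (∀ r, r ∉ li → σ'.I r = σ.I r) ∧ (∀ r, r ∉ lr → σ'.R r = σ.R r) ∧ σ'.Z = σ.Z

theorem Frame.refl (li lr : List ℕ) (σ : Store) : Frame li lr σ σ :=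
  ⟨fun _ _ => rfl, fun _ _ => rfl, rfl⟩

theorem Frame.trans {li lr : List ℕ} {σ σ' σ'' : Store} (h : Frame li lr σ σ')
    (h' : Frame li lr σ' σ'') : Frame li lr σ σ'' :=
  ⟨fun r hr => (h'.1 r hr).trans (h.1 r hr), fun r hr => (h'.2.1 r hr).trans (h.2.1 r hr),
    h'.2.2.trans h.2.2⟩

theorem Frame.weaken {li lr li' lr' : List ℕ} {σ σ' : Store} (h : Frame li lr σ σ')
    (hi : li ⊆ li') (hr : lr ⊆ lr') : Frame li' lr' σ σ' :=
  ⟨fun r h' => h.1 r fun h'' => h' (hi h''), fun r h' => h.2.1 r fun h'' => h' (hr h''), h.2.2⟩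

theorem Frame.base {li lr : List ℕ} {σ : Store} {M : ℕ → ℕ} {Z : ℕ → ℝ} (h : σ.Z = Z) :
    Frame li lr σ ⟨σ.I, σ.R, M, Z⟩ :=
  ⟨fun _ _ => rfl, fun _ _ => rfl, h.symm⟩

theorem Frame.updI {li lr : List ℕ} {σ : Store} {I : ℕ → ℕ} {R : ℕ → ℝ} {M : ℕ → ℕ} {Z : ℕ → ℝ}
    {d v : ℕ} (h : Frame li lr σ ⟨I, R, M, Z⟩) (hd : d ∈ li) :
    Frame li lr σ ⟨Function.update I d v, R, M, Z⟩ :=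
  ⟨fun r hr => (Function.update_of_ne (fun h' => hr (by rw [h']; exact hd)) _ _).trans (h.1 r hr), h.2⟩

theorem Frame.updR {li lr : List ℕ} {σ : Store} {I : ℕ → ℕ} {R : ℕ → ℝ} {M : ℕ → ℕ} {Z : ℕ → ℝ}
    {d : ℕ} {v : ℝ} (h : Frame li lr σ ⟨I, R, M, Z⟩) (hd : d ∈ lr) :
    Frame li lr σ ⟨I, Function.update R d v, M, Z⟩ :=
  ⟨h.1, fun r hr => (Function.update_of_ne (fun h' => hr (by rw [h']; exact hd)) _ _).trans (h.2.1 r hr), h.2.2⟩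

/-- The `n` points have coordinates `Z (2 p)`, `Z (2 p + 1)` and colors `col p`. The cell `a` of the
integer memory packs the color of the point `a` and the indices of the points that come at position
`a` in the orders by the two coordinates. -/
structure Layout (n k : ℕ) (L : Lim) (Z : ℕ → ℝ) (mem col : ℕ → ℕ) (P : ℕ → ℕ → ℕ) : Prop where
  one_le_n : 1 ≤ n
  one_le_k : 1 ≤ k
  mem_le : ∀ a < n, mem a ≤ L.W
  field : ∀ a < n, ∀ o < 2, mem a / n ^ (o + 1) % n = P o a
  color : ∀ a < n, mem a % n = col a
  lt : ∀ a < n, ∀ o < 2, P o a < n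
  surj : ∀ p < n, ∀ o < 2, ∃ a < n, P o a = p
  sorted : ∀ o < 2, ∀ a b, a ≤ b → b < n → Z (2 * P o a + o) ≤ Z (2 * P o b + o)
  col_lt : ∀ p < n, col p < k
  int_cells : n + k ≤ L.sI
  real_cells : 2 * n ≤ L.sR
  words : 2 * n + k + 10 ≤ L.W

/-- The coordinate `o` of the point at position `a` in the order by this coordinate. -/
def srt (Z : ℕ → ℝ) (P : ℕ → ℕ → ℕ) (o a : ℕ) : ℝ := Z (2 * P o a + o)

/-- The constant registers and the input data are in place; the orientation is `o`. -/
structure Ctx (n k : ℕ) (Z : ℕ → ℝ) (mem : ℕ → ℕ) (o : ℕ) (σ : Store) : Prop where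
  reg0 : σ.I 0 = n
  reg1 : σ.I 1 = k
  reg2 : σ.I 2 = 0
  reg3 : σ.I 3 = 1
  reg6 : σ.I 6 = o
  reg7 : σ.I 7 = 1 - o
  reg8 : σ.I 8 = n ^ (o + 1)
  reg9 : σ.I 9 = n ^ (1 - o + 1)
  real9 : σ.R 9 = 0
  real10 : σ.R 10 = 1
  real11 : σ.R 11 = 1 / 2
  mem_eq : ∀ a < n, σ.M a = mem a
  pts : σ.Z = Z

theorem Ctx.of_frame {n k : ℕ} {Z : ℕ → ℝ} {mem : ℕ → ℕ} {o : ℕ} {σ σ' : Store} {li lr : List ℕ}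
    (h : Ctx n k Z mem o σ) (hf : Frame li lr σ σ')
    (hi : ∀ r ∈ [0, 1, 2, 3, 6, 7, 8, 9], r ∉ li) (hr : ∀ r ∈ [9, 10, 11], r ∉ lr)
    (hM : ∀ a < n, σ'.M a = σ.M a) : Ctx n k Z mem o σ' where
  reg0 := (hf.1 0 (hi 0 (by simp))).trans h.reg0
  reg1 := (hf.1 1 (hi 1 (by simp))).trans h.reg1
  reg2 := (hf.1 2 (hi 2 (by simp))).trans h.reg2
  reg3 := (hf.1 3 (hi 3 (by simp))).trans h.reg3
  reg6 := (hf.1 6 (hi 6 (by simp))).trans h.reg6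
  reg7 := (hf.1 7 (hi 7 (by simp))).trans h.reg7
  reg8 := (hf.1 8 (hi 8 (by simp))).trans h.reg8
  reg9 := (hf.1 9 (hi 9 (by simp))).trans h.reg9
  real9 := (hf.2.1 9 (hr 9 (by simp))).trans h.real9
  real10 := (hf.2.1 10 (hr 10 (by simp))).trans h.real10
  real11 := (hf.2.1 11 (hr 11 (by simp))).trans h.real11
  mem_eq := fun a ha => (hM a ha).trans (h.mem_eq a ha)
  pts := hf.2.2.trans h.pts

/-! ### Reading a coordinate at a position of a sorted order -/

/-- Real register `d` receives the coordinate `I[o]` of the point at position `I[a]` in the order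
whose field divisor is `I[D]`. -/
def ldS (a D o d : ℕ) : Com :=
  block [iload 4 a, idiv 4 4 D, idiv 5 4 0, imul 5 5 0, isub 4 4 5, iadd 4 4 4, iadd 4 4 o,
    rload d 4]

theorem wp_ldS {n k : ℕ} {L : Lim} {Z : ℕ → ℝ} {mem col : ℕ → ℕ} {P : ℕ → ℕ → ℕ}
    (hL : Layout n k L Z mem col P) {a D o d : ℕ} (hD4 : D ≠ 4) (ho4 : o ≠ 4) (ho5 : o ≠ 5) {σ : Store} {Q : Store → Prop}
    (h0 : σ.I 0 = n) (hM : ∀ a < n, σ.M a = mem a) (hZ : σ.Z = Z)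
    (ha : σ.I a < n) {e : ℕ} (he : e < 2) (hD : σ.I D = n ^ (e + 1)) (ho : σ.I o = e)
    (hQ : ∀ v4 v5, Q ⟨Function.update (Function.update σ.I 4 v4) 5 v5,
      Function.update σ.R d (srt Z P e (σ.I a)), σ.M, Z⟩) : wp L (ldS a D o d) Q σ := by
  have h1 := hL.field _ ha e he
  have h2 := hL.mem_le _ ha
  have h3 := hL.lt _ ha e he
  have h4 := hL.int_cells
  have h5 := hL.real_cells
  have h6 := hL.words
  simp only [ldS, wp_block_cons, wp_block_nil, wp_iload, wp_idiv, wp_imul, wp_isub, wp_iadd,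
    wp_rload, Function.update_apply, reduceIte, Nat.reduceEqDiff, OfNat.zero_ne_ofNat, hD4, ho4, ho5]
  rw [h0, hM _ ha, hD, ho, hZ]
  have h7 : mem (σ.I a) / n ^ (e + 1) - mem (σ.I a) / n ^ (e + 1) / n * n = P e (σ.I a) := by
    rw [← h1, Nat.mod_eq_sub, mul_comm]
  rw [h7]
  refine ⟨by omega, ?_, by omega, by omega, by omega, ?_⟩
  · exact (Nat.div_mul_le_self _ _).trans ((Nat.div_le_self _ _).trans h2)
  · have h8 := hQ (P e (σ.I a) + P e (σ.I a) + e) (mem (σ.I a) / n ^ (e + 1) / n * n)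
    convert h8 using 2
    · funext r
      simp only [Function.update_apply]
      split_ifs <;> simp_all
    · rw [srt, two_mul]

/-! ### The largest candidate below a bound -/

/-- One step of the search for the largest value `(A - (z_b - z_a)) h` below `w`. -/
def candBody (D o rA rh rw : ℕ) : Com :=
  .ite (.int 13 0)
    (block [ldS 12 D o 12, ldS 13 D o 13, rsub 14 13 12, rsub 14 rA 14, rmul 14 14 rh,
      .ite (.real 14 rw) (block [.ite (.real 7 14) (radd 7 14 9) .skip, iadd 12 12 3])
        (iadd 13 13 3)])
    (iadd 12 12 3)

/-- Raise real register `7` to the largest value `(A - (z_b - z_a)) h` below `w`. -/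
def cand (D o rA rh rw : ℕ) : Com :=
  block [iset 12 0, iset 13 0, .loop (.int 12 0) (candBody D o rA rh rw)]

/-- The value considered by `cand`. -/
def cval (z : ℕ → ℝ) (A h : ℝ) (a b : ℕ) : ℝ := (A - (z b - z a)) * h

theorem cval_mono_left {z : ℕ → ℝ} {n : ℕ} (hz : ∀ a b, a ≤ b → b < n → z a ≤ z b) {A h : ℝ}
    (hh : 0 ≤ h) {a a' b : ℕ} (haa : a ≤ a') (ha : a' < n) : cval z A h a b ≤ cval z A h a' b :=
  mul_le_mul_of_nonneg_right (by linarith [hz a a' haa ha]) hh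

theorem cval_anti_right {z : ℕ → ℝ} {n : ℕ} (hz : ∀ a b, a ≤ b → b < n → z a ≤ z b) {A h : ℝ}
    (hh : 0 ≤ h) {a b b' : ℕ} (hbb : b ≤ b') (hb : b' < n) : cval z A h a b' ≤ cval z A h a b :=
  mul_le_mul_of_nonneg_right (by linarith [hz b b' hbb hb]) hh

/-- `m` is the largest of `m₀` and the values below `w`. -/
def IsMaxBelow (n : ℕ) (z : ℕ → ℝ) (A h w m₀ m : ℝ) : Prop :=
  m₀ ≤ m ∧ (m = m₀ ∨ ∃ a < n, ∃ b < n, cval z A h a b = m ∧ m < w) ∧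
    ∀ a < n, ∀ b < n, cval z A h a b < w → cval z A h a b ≤ m

theorem cand_ok {n k : ℕ} {L : Lim} {Z : ℕ → ℝ} {mem col : ℕ → ℕ} {P : ℕ → ℕ → ℕ}
    (hL : Layout n k L Z mem col P) {o : ℕ} {σ : Store} (hσ : Ctx n k Z mem o σ)
    {D oo e rA rh rw : ℕ} (he : e < 2)
    (hDo : (D = 8 ∧ oo = 6 ∧ e = o) ∨ (D = 9 ∧ oo = 7 ∧ e = 1 - o))
    (hrA : rA ∉ [7, 12, 13, 14]) (hrh : rh ∉ [7, 12, 13, 14]) (hrw : rw ∉ [7, 12, 13, 14])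
    (hh : 0 ≤ σ.R rh) :
    Ok L (cand D oo rA rh rw) σ (100 * n + 10) (fun σ' =>
      Frame [4, 5, 12, 13] [7, 12, 13, 14] σ σ' ∧ σ'.M = σ.M ∧
      IsMaxBelow n (srt Z P e) (σ.R rA) (σ.R rh) (σ.R rw) (σ.R 7) (σ'.R 7)) := by
  set z := srt Z P e with hz
  have hzm : ∀ a b, a ≤ b → b < n → z a ≤ z b := hL.sorted e he
  set A := σ.R rA with hA
  set h := σ.R rh with hhdef
  set w := σ.R rw with hw
  have hWs := hL.words
  have hD4 : D ≠ 4 := by rcases hDo with h | h <;> omega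
  have ho4 : oo ≠ 4 := by rcases hDo with h | h <;> omega
  have ho5 : oo ≠ 5 := by rcases hDo with h | h <;> omega
  simp only [List.mem_cons, List.not_mem_nil, or_false, not_or] at hrA hrh hrw
  let Inv : Store → Prop := fun τ =>
    Frame [4, 5, 12, 13] [7, 12, 13, 14] σ τ ∧ τ.M = σ.M ∧ τ.I 12 ≤ n ∧ τ.I 13 ≤ n ∧
      (τ.I 12 < n → ∀ b < τ.I 13, w ≤ cval z A h (τ.I 12) b) ∧ σ.R 7 ≤ τ.R 7 ∧
      (τ.R 7 = σ.R 7 ∨ ∃ a < n, ∃ b < n, cval z A h a b = τ.R 7 ∧ τ.R 7 < w) ∧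
      ∀ a < τ.I 12, ∀ b < n, cval z A h a b < w → cval z A h a b ≤ τ.R 7
  let V : Store → ℕ := fun τ => 45 * (n - τ.I 12) + 45 * (n - τ.I 13)
  have hloop := Ok.loop (L := L) (c := .int 12 0) (p := candBody D oo rA rh rw) Inv V (by
    rintro τ ⟨hf, hM, ha, hb, hprev, h7, h7', hall⟩ hc
    have hcτ : Ctx n k Z mem o τ := hσ.of_frame hf (by decide) (by decide) (fun a _ => by rw [hM])
    have han : τ.I 12 < n := by simpa [Test.Holds, hcτ.reg0] using hc
    refine ⟨29, Ok.of_wp (p := candBody D oo rA rh rw) ?_⟩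
    have hDv : τ.I D = n ^ (e + 1) := by
      rcases hDo with ⟨rfl, rfl, rfl⟩ | ⟨rfl, rfl, rfl⟩
      · exact hcτ.reg8
      · exact hcτ.reg9
    have hov : τ.I oo = e := by
      rcases hDo with ⟨rfl, rfl, rfl⟩ | ⟨rfl, rfl, rfl⟩
      · exact hcτ.reg6
      · exact hcτ.reg7
    have hAv : τ.R rA = A := hf.2.1 _ (by simpa using hrA)
    have hhv : τ.R rh = h := hf.2.1 _ (by simpa using hrh)
    have hwv : τ.R rw = w := hf.2.1 _ (by simpa using hrw)
    have hD5 : D ≠ 5 := by rcases hDo with h | h <;> omega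
    -- the potential decreases when one of the two positions advances
    unfold candBody
    rw [wp_ite_int]
    have hskip : ∀ τ' : Store, Frame [4, 5, 12, 13] [7, 12, 13, 14] τ τ' → τ'.M = τ.M →
        τ'.I 12 = τ.I 12 + 1 → τ'.I 13 = τ.I 13 → τ.R 7 ≤ τ'.R 7 →
        (τ'.R 7 = τ.R 7 ∨ ∃ a < n, ∃ b < n, cval z A h a b = τ'.R 7 ∧ τ'.R 7 < w) →
        (∀ b < n, cval z A h (τ.I 12) b < w → cval z A h (τ.I 12) b ≤ τ'.R 7) →
        Inv τ' ∧ 29 + 2 + V τ' ≤ V τ := by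
      intro τ' g1 g2 g3 g4 g5 g6 g7
      refine ⟨⟨hf.trans g1, g2.trans hM, by omega, by omega, ?_, h7.trans g5, ?_, ?_⟩, ?_⟩
      · intro hlt b hb
        rw [g3] at hlt ⊢
        rw [g4] at hb
        exact (hprev han b hb).trans (cval_mono_left hzm hh (Nat.le_succ _) hlt)
      · rcases g6 with g6 | g6
        · rw [g6]; exact h7'
        · exact Or.inr g6
      · intro a ha b hb hab
        rw [g3] at ha
        rcases Nat.lt_succ_iff_lt_or_eq.1 ha with ha | rfl
        · exact (hall a ha b hb hab).trans g5
        · exact g7 b hb hab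
      · simp only [V, g3, g4]; omega
    constructor
    · intro hbn
      rw [hcτ.reg0] at hbn
      rw [wp_block_cons]
      refine wp_ldS hL hD4 ho4 ho5 hcτ.reg0 hcτ.mem_eq hcτ.pts han he hDv
        hov fun v4 v5 => ?_
      rw [wp_block_cons]
      refine wp_ldS hL hD4 ho4 ho5 (e := e) ?_ ?_ ?_ ?_ he ?_ ?_
        fun v4' v5' => ?_
      · simpa [Function.update_apply] using hcτ.reg0
      · exact hcτ.mem_eq
      · rfl
      · simpa [Function.update_apply] using hbn
      · simpa [Function.update_apply, hD4, hD5] using hDv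
      · simpa [Function.update_apply, ho4, ho5] using hov
      simp only [wp_block_cons, wp_block_nil, wp_rsub, wp_rmul, wp_ite_real, wp_radd, wp_iadd,
        wp_skip, Function.update_apply, reduceIte, Nat.reduceEqDiff, hrA, hrh, hrw,
        hAv, hhv, hwv, hcτ.real9, hcτ.reg3, ← hz, add_zero]
      rw [show (A - (z (τ.I 13) - z (τ.I 12))) * h = cval z A h (τ.I 12) (τ.I 13) from rfl]
      refine ⟨fun hlt => ?_, fun hlt => ?_⟩
      · have hbelow : ∀ r, cval z A h (τ.I 12) (τ.I 13) ≤ r → ∀ b < n,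
            cval z A h (τ.I 12) b < w → cval z A h (τ.I 12) b ≤ r := by
          intro r hr b hbn' hbw
          rcases lt_or_ge b (τ.I 13) with hb' | hb'
          · exact absurd (hprev han b hb') (not_le.2 hbw)
          · exact (cval_anti_right hzm hh hb' hbn').trans hr
        refine ⟨fun hlt' => ⟨by omega, hskip _ ?_ rfl ?_ ?_ ?_ ?_ ?_⟩,
          fun hlt' => ⟨by omega, hskip _ ?_ rfl ?_ ?_ ?_ ?_ ?_⟩⟩
        · repeat refine Frame.updI ?_ (by decide)
          repeat refine Frame.updR ?_ (by decide)
          exact Frame.base hcτ.pts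
        · simp
        · simp
        · simpa using hlt'.le
        · exact Or.inr ⟨_, han, _, hbn, by simp, by simpa using hlt⟩
        · simpa using hbelow _ le_rfl
        · repeat refine Frame.updI ?_ (by decide)
          repeat refine Frame.updR ?_ (by decide)
          exact Frame.base hcτ.pts
        · simp
        · simp
        · simp
        · simp
        · simpa [Function.update_apply] using hbelow _ (not_lt.1 hlt')
      · refine ⟨by omega, ⟨hf.trans ?_, hM, ?_, ?_, ?_, ?_, ?_, ?_⟩, ?_⟩
        · repeat refine Frame.updI ?_ (by decide)
          repeat refine Frame.updR ?_ (by decide)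
          exact Frame.base hcτ.pts
        · simpa [Function.update_apply] using ha
        · simpa using hbn
        · simp only [Function.update_apply, reduceIte, Nat.reduceEqDiff]
          intro _ b hb
          rcases Nat.lt_succ_iff_lt_or_eq.1 hb with hb | rfl
          · exact hprev han b hb
          · exact not_lt.1 hlt
        · simpa [Function.update_apply] using h7
        · simpa [Function.update_apply] using h7'
        · simpa [Function.update_apply] using hall
        · simp only [V, Function.update_apply, reduceIte, Nat.reduceEqDiff]
          omega
    · intro hbn
      rw [hcτ.reg0] at hbn
      simp only [wp_iadd, hcτ.reg3]
      refine ⟨by omega, hskip _ ⟨?_, fun _ _ => rfl, rfl⟩ rfl (by simp) (by simp) le_rfl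
        (Or.inl rfl) ?_⟩
      · intro r hr
        simp only [List.mem_cons, List.not_mem_nil, or_false, not_or] at hr
        simp [hr]
      · intro b hb hlt
        exact absurd (hprev han b (by omega)) (not_le.2 hlt))
  unfold cand
  refine Ok.mono (t := 1 + (1 + (90 * n + 2 + 0))) (Ok.cons (Ok.ins ?_ (Ok.cons (Ok.ins ?_ (Ok.cons
    ((hloop _ ?_).mono ?_ fun τ hτ => Ok.nil ?_)))))) (by omega) (fun _ => id)
  · exact Nat.zero_le _
  · exact Nat.zero_le _
  · refine ⟨?_, rfl, ?_, ?_, ?_, le_rfl, Or.inl rfl, ?_⟩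
    · refine Frame.updI (Frame.updI (Frame.base rfl) (by decide)) (by decide)
    · simp [Store.exec]
    · simp [Store.exec]
    · simp [Store.exec]
    · simp [Store.exec]
  · simp only [V]
    omega
  · obtain ⟨⟨hf, hM, ha, hb, hprev, h7, h7', hall⟩, hc⟩ := hτ
    have han : n ≤ τ.I 12 := by
      have : ¬ τ.I 12 < τ.I 0 := hc
      rw [hf.1 0 (by decide), hσ.reg0] at this
      omega
    exact ⟨hf, hM, h7, h7', fun a ha' => hall a (by omega)⟩

end CSSA

namespace CSSA

/-! ## Deciding whether an annulus of a given width exists -/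

/-- Number of colors with a positive counter. -/
def nzc (n k : ℕ) (f : ℕ → ℕ) : ℕ := ((Finset.range k).filter (fun c => 0 < f (n + c))).card

theorem nzc_update {n k : ℕ} (f : ℕ → ℕ) {c : ℕ} (hc : c < k) (v : ℕ) :
    nzc n k (Function.update f (n + c) v) + (if 0 < f (n + c) then 1 else 0) =
      nzc n k f + (if 0 < v then 1 else 0) := by
  unfold nzc
  rw [Finset.card_filter, Finset.card_filter]
  have hc' := Finset.mem_range.2 hc
  rw [← Finset.add_sum_erase _ _ hc', ← Finset.add_sum_erase _ (fun c => if 0 < f (n + c) then 1 else 0) hc']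
  have : ∀ i ∈ (Finset.range k).erase c,
      (if 0 < Function.update f (n + c) v (n + i) then 1 else 0) = if 0 < f (n + i) then 1 else 0 := by
    intro i hi
    rw [Function.update_of_ne]
    have := (Finset.mem_erase.1 hi).1
    omega
  rw [Finset.sum_congr rfl this, Function.update_self]
  ring

/-- The point in the slab `[x₀, x₀ + s]`, and more than `w` away from its sides if `ns` holds. -/
def Counted (x₀ s w : ℝ) (ns : Bool) (x : ℝ) : Prop :=
  (x₀ ≤ x ∧ x ≤ x₀ + s) ∧ (ns = true → w < x - x₀ ∧ w < x₀ + s - x)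

open Classical in
/-- Contribution of a point to the counter of the color `c`. -/
noncomputable def ind (x₀ s w : ℝ) (x : ℕ → ℝ) (cl : ℕ → ℕ) (ns : Bool) (c a : ℕ) : ℕ :=
  if Counted x₀ s w ns (x a) ∧ cl a = c then 1 else 0

/-- Load the address of the counter of the color and the coordinates of the point at position
`I[p]`. -/
def ldPt (p : ℕ) : Com :=
  block [iload 4 p, idiv 4 4 9, idiv 5 4 0, imul 5 5 0, isub 4 4 5, iload 24 4, idiv 5 24 0,
    imul 5 5 0, isub 24 24 5, iadd 24 24 0, iadd 4 4 4, iadd 5 4 7, rload 17 5, iadd 5 4 6,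
    rload 18 5]

/-- The other coordinate of the point at position `a` in the order by the coordinate `1 - o`. -/
def oth (Z : ℕ → ℝ) (P : ℕ → ℕ → ℕ) (o a : ℕ) : ℝ := Z (2 * P (1 - o) a + o)

/-- The color of the point at position `a` in the order by the coordinate `1 - o`. -/
def clr (col : ℕ → ℕ) (P : ℕ → ℕ → ℕ) (o a : ℕ) : ℕ := col (P (1 - o) a)

variable {n k : ℕ} {L : Lim} {Z : ℕ → ℝ} {mem col : ℕ → ℕ} {P : ℕ → ℕ → ℕ} {o : ℕ}

theorem wp_ldPt (hL : Layout n k L Z mem col P) (ho : o < 2) {σ : Store}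
    (hσ : Ctx n k Z mem o σ) {p : ℕ} (hp : σ.I p < n) {Q : Store → Prop}
    (hQ : ∀ v4 v5, Q ⟨Function.update (Function.update (Function.update σ.I 4 v4) 5 v5) 24
        (n + clr col P o (σ.I p)),
      Function.update (Function.update σ.R 17 (srt Z P (1 - o) (σ.I p))) 18 (oth Z P o (σ.I p)),
      σ.M, Z⟩) : wp L (ldPt p) Q σ := by
  have ho' : 1 - o < 2 := by omega
  have h1 := hL.field _ hp (1 - o) ho'
  have h2 := hL.mem_le _ hp
  have h3 := hL.lt _ hp (1 - o) ho'
  have h4 := hL.int_cells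
  have h5 := hL.real_cells
  have h6 := hL.words
  have h7 := hL.color _ h3
  have h8 := hL.mem_le _ h3
  have h9 := hL.col_lt _ h3
  simp only [ldPt, wp_block_cons, wp_block_nil, wp_iload, wp_idiv, wp_imul, wp_isub, wp_iadd,
    wp_rload, Function.update_apply, reduceIte, Nat.reduceEqDiff, OfNat.zero_ne_ofNat]
  rw [hσ.reg0, hσ.mem_eq _ hp, hσ.reg9, hσ.reg6, hσ.reg7, hσ.pts]
  have h10 : mem (σ.I p) / n ^ (1 - o + 1) - mem (σ.I p) / n ^ (1 - o + 1) / n * n =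
      P (1 - o) (σ.I p) := by
    rw [← h1, Nat.mod_eq_sub, mul_comm]
  rw [h10, hσ.mem_eq _ h3]
  have h11 : mem (P (1 - o) (σ.I p)) - mem (P (1 - o) (σ.I p)) / n * n =
      col (P (1 - o) (σ.I p)) := by
    rw [← h7, Nat.mod_eq_sub, mul_comm]
  rw [h11]
  refine ⟨by omega, (Nat.div_mul_le_self _ _).trans ((Nat.div_le_self _ _).trans h2), by omega,
    (Nat.div_mul_le_self _ _).trans h8, by omega, by omega, by omega, by omega, by omega, by omega,
    ?_⟩
  have h12 := hQ (P (1 - o) (σ.I p) + P (1 - o) (σ.I p))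
    (P (1 - o) (σ.I p) + P (1 - o) (σ.I p) + o)
  convert h12 using 2
  · funext r
    simp only [Function.update_apply]
    split_ifs <;> simp_all [clr, add_comm]
  · simp only [srt, oth, two_mul]

/-- Set integer register `25` to `1` if the point is counted, and to `0` otherwise. -/
def mark (ns : Bool) : Com :=
  block [iset 25 0, .ite (.real 18 6) .skip (.ite (.real 25 18) .skip
    (match ns with
      | false => iset 25 1
      | true => block [rsub 14 18 6, .ite (.real 7 14)
          (block [rsub 14 25 18, .ite (.real 7 14) (iset 25 1) .skip]) .skip]))]

open Classical in
theorem wp_mark {σ : Store} {ns : Bool} {Q : Store → Prop} {x₀ s w : ℝ} (hW : 1 ≤ L.W)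
    (h6 : σ.R 6 = x₀) (h7 : σ.R 7 = w) (h25 : σ.R 25 = x₀ + s)
    (hQ : ∀ v, Q ⟨Function.update σ.I 25 (if Counted x₀ s w ns (σ.R 18) then 1 else 0),
      Function.update σ.R 14 v, σ.M, σ.Z⟩) : wp L (mark ns) Q σ := by
  have h0 : ¬ Counted x₀ s w ns (σ.R 18) → ∀ v, Q ⟨Function.update σ.I 25 0,
      Function.update σ.R 14 v, σ.M, σ.Z⟩ := by
    intro h v; have := hQ v; rwa [if_neg h] at this
  have h1 : Counted x₀ s w ns (σ.R 18) → ∀ v, Q ⟨Function.update σ.I 25 1,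
      Function.update σ.R 14 v, σ.M, σ.Z⟩ := by
    intro h v; have := hQ v; rwa [if_pos h] at this
  have hR : Function.update σ.R 14 (σ.R 14) = σ.R := Function.update_eq_self _ _
  cases ns
  · simp only [mark, wp_block_cons, wp_block_nil, wp_iset, wp_ite_real, wp_skip,
      Function.update_idem, h6, h25]
    refine ⟨Nat.zero_le _, fun h => ?_, fun h => ⟨fun h' => ?_, fun h' => ⟨hW, ?_⟩⟩⟩
    · have := h0 (fun hc => by linarith [hc.1.1]) (σ.R 14); rwa [hR] at this
    · have := h0 (fun hc => by linarith [hc.1.2]) (σ.R 14); rwa [hR] at this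
    · have := h1 ⟨⟨not_lt.1 h, not_lt.1 h'⟩, by simp⟩ (σ.R 14); rwa [hR] at this
  · simp only [mark, wp_block_cons, wp_block_nil, wp_iset, wp_ite_real, wp_skip, wp_rsub,
      Function.update_idem, Function.update_apply, reduceIte, Nat.reduceEqDiff, h6, h7, h25]
    refine ⟨Nat.zero_le _, fun h => ?_, fun h => ⟨fun h' => ?_, fun h' => ⟨fun h2 =>
      ⟨fun h3 => ⟨hW, ?_⟩, fun h3 => ?_⟩, fun h2 => ?_⟩⟩⟩
    · have := h0 (fun hc => by linarith [hc.1.1]) (σ.R 14); rwa [hR] at this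
    · have := h0 (fun hc => by linarith [hc.1.2]) (σ.R 14); rwa [hR] at this
    · exact h1 ⟨⟨not_lt.1 h, not_lt.1 h'⟩, fun _ => ⟨h2, h3⟩⟩ _
    · exact h0 (fun hc => h3 (hc.2 rfl).2) _
    · exact h0 (fun hc => h2 (hc.2 rfl).1) _

/-- Increment or decrement the counter at address `I[24]` if `I[25]` is positive. -/
def bump (up : Bool) : Com :=
  .ite (.int 2 25)
    (match up with
      | true => block [iload 5 24, .ite (.int 5 3) (iadd 19 19 3) .skip, iadd 5 5 3, istore 24 5]
      | false => block [iload 5 24, isub 5 5 3, istore 24 5,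
          .ite (.int 5 3) (isub 19 19 3) .skip])
    .skip

theorem wp_bump {σ : Store} {up : Bool} {Q : Store → Prop} {c : ℕ} (hc : c < k)
    (hI : n + k ≤ L.sI) (hW : ∀ c < k, up = true → σ.M (n + c) + k < L.W)
    (h2 : σ.I 2 = 0) (h3 : σ.I 3 = 1) (h24 : σ.I 24 = n + c) (h25 : σ.I 25 ≤ 1)
    (hnz : σ.I 19 = nzc n k σ.M) (hpos : up = false → σ.I 25 ≤ σ.M (n + c))
    (hQ : ∀ τ : Store, Frame [5, 19] [] σ τ → (∀ a < n, τ.M a = σ.M a) → τ.I 19 = nzc n k τ.M →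
      (up = true → ∀ d < k, τ.M (n + d) = σ.M (n + d) + if d = c then σ.I 25 else 0) →
      (up = false → ∀ d < k, τ.M (n + d) + (if d = c then σ.I 25 else 0) = σ.M (n + d)) → Q τ) :
    wp L (bump up) Q σ := by
  have hle : nzc n k σ.M ≤ k := (Finset.card_filter_le _ _).trans (by simp)
  unfold bump
  rw [wp_ite_int, h2]
  constructor
  · intro hlt
    have h25' : σ.I 25 = 1 := by omega
    cases up
    · simp only [wp_block_cons, wp_block_nil, wp_iload, wp_isub, wp_istore, wp_ite_int, wp_skip,
        Function.update_apply, reduceIte, Nat.reduceEqDiff, h24, h3]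
      have hp := hpos rfl
      rw [h25'] at hp
      have hu := nzc_update (n := n) σ.M hc (σ.M (n + c) - 1)
      rw [if_pos (by omega : 0 < σ.M (n + c))] at hu
      have hcnt : ∀ d < k, Function.update σ.M (n + c) (σ.M (n + c) - 1) (n + d) +
          (if d = c then σ.I 25 else 0) = σ.M (n + d) := by
        intro d hd
        rw [Function.update_apply]
        split_ifs with h1 h2' h2' <;> first | omega | (subst h2'; omega)
      refine ⟨by omega, by omega, fun h => ?_, fun h => ?_⟩
      · refine hQ _ ?_ ?_ ?_ (fun h => by simp at h) (fun _ => hcnt)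
        · repeat refine Frame.updI ?_ (by decide)
          exact Frame.base rfl
        · intro a ha; exact Function.update_of_ne (by omega) _ _
        · simp only [Function.update_self, hnz]
          rw [if_neg (show ¬ 0 < σ.M (n + c) - 1 by omega)] at hu
          omega
      · refine hQ _ ?_ ?_ ?_ (fun h => by simp at h) (fun _ => hcnt)
        · repeat refine Frame.updI ?_ (by decide)
          exact Frame.base rfl
        · intro a ha; exact Function.update_of_ne (by omega) _ _
        · simp only [Function.update_apply, reduceIte, Nat.reduceEqDiff, hnz]
          rw [if_pos (show 0 < σ.M (n + c) - 1 by omega)] at hu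
          omega
    · simp only [wp_block_cons, wp_block_nil, wp_iload, wp_iadd, wp_istore, wp_ite_int, wp_skip,
        Function.update_apply, reduceIte, Nat.reduceEqDiff, h24, h3]
      have hw := hW c hc rfl
      have hu := nzc_update (n := n) σ.M hc (σ.M (n + c) + 1)
      rw [if_pos (by omega : 0 < σ.M (n + c) + 1)] at hu
      have hcnt : ∀ d < k, Function.update σ.M (n + c) (σ.M (n + c) + 1) (n + d) =
          σ.M (n + d) + if d = c then σ.I 25 else 0 := by
        intro d hd
        rw [Function.update_apply]
        split_ifs with h1 h2' h2' <;> first | omega | (subst h2'; omega)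
      refine ⟨by omega, fun h => ⟨by omega, by omega, by omega, ?_⟩,
        fun h => ⟨by omega, by omega, ?_⟩⟩
      · refine hQ _ ?_ ?_ ?_ (fun _ => hcnt) (fun h => by simp at h)
        · repeat refine Frame.updI ?_ (by decide)
          exact Frame.base rfl
        · intro a ha; exact Function.update_of_ne (by omega) _ _
        · simp only [Function.update_apply, reduceIte, Nat.reduceEqDiff, hnz]
          rw [if_neg (by omega)] at hu
          omega
      · refine hQ _ ?_ ?_ ?_ (fun _ => hcnt) (fun h => by simp at h)
        · repeat refine Frame.updI ?_ (by decide)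
          exact Frame.base rfl
        · intro a ha; exact Function.update_of_ne (by omega) _ _
        · simp only [Function.update_apply, reduceIte, Nat.reduceEqDiff, hnz]
          rw [if_pos (by omega)] at hu
          omega
  · intro hlt
    have h25' : σ.I 25 = 0 := by omega
    rw [wp_skip]
    refine hQ σ (Frame.refl _ _ _) (fun _ _ => rfl) hnz (fun _ d _ => ?_) (fun _ d _ => ?_) <;>
    simp [h25']

/-- Advance the position `I[p]` past the next point if it lies below the bound `R[t]` (or on it, if
`up` holds), and update the counter of its color. -/
def stage (p t : ℕ) (up ns : Bool) : Com :=
  .ite (.int 20 3)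
    (.ite (.int p 0)
      (block [ldPt p,
        (match up with
          | true => .ite (.real t 17) .skip
              (block [mark ns, bump true, iadd p p 3, iset 20 1])
          | false => .ite (.real 17 t)
              (block [mark ns, bump false, iadd p p 3, iset 20 1]) .skip)])
      .skip)
    .skip

/-- The condition for advancing. -/
def Passes (up : Bool) (y t : ℝ) : Prop := if up then y ≤ t else y < t

theorem wp_stage_idle {σ : Store} {p t : ℕ} {up ns : Bool} {Q : Store → Prop} (h3 : σ.I 3 = 1)
    (h20 : σ.I 20 = 1) (hQ : Q σ) : wp L (stage p t up ns) Q σ := by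
  unfold stage
  rw [wp_ite_int, h3, h20]
  exact ⟨fun h => absurd h (lt_irrefl _), fun _ => hQ⟩

theorem wp_stage (hL : Layout n k L Z mem col P) (ho : o < 2) {σ : Store}
    (hσ : Ctx n k Z mem o σ) {p t : ℕ} {up ns : Bool} {Q : Store → Prop} {x₀ s w : ℝ}
    (hp : p ∈ [14, 15, 16, 17]) (ht : t ∉ [14, 17, 18])
    (h6 : σ.R 6 = x₀) (h7 : σ.R 7 = w) (h25 : σ.R 25 = x₀ + s) (h20 : σ.I 20 = 0)
    (hW : ∀ c < k, up = true → σ.M (n + c) + k < L.W)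
    (hnz : σ.I 19 = nzc n k σ.M)
    (hpos : up = false → σ.I p < n → Passes up (srt Z P (1 - o) (σ.I p)) (σ.R t) →
      ∀ c < k, ind x₀ s w (oth Z P o) (clr col P o) ns c (σ.I p) ≤ σ.M (n + c))
    (hstay : ∀ τ, Frame [4, 5, 24] [17, 18] σ τ → τ.M = σ.M →
      (σ.I p < n → ¬ Passes up (srt Z P (1 - o) (σ.I p)) (σ.R t)) → Q τ)
    (hgo : ∀ τ, Frame [4, 5, 19, 20, 24, 25, p] [14, 17, 18] σ τ → (∀ a < n, τ.M a = σ.M a) →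
      σ.I p < n → Passes up (srt Z P (1 - o) (σ.I p)) (σ.R t) → τ.I p = σ.I p + 1 →
      τ.I 20 = 1 → τ.I 19 = nzc n k τ.M →
      (up = true → ∀ c < k, τ.M (n + c) =
        σ.M (n + c) + ind x₀ s w (oth Z P o) (clr col P o) ns c (σ.I p)) →
      (up = false → ∀ c < k, τ.M (n + c) +
        ind x₀ s w (oth Z P o) (clr col P o) ns c (σ.I p) = σ.M (n + c)) → Q τ) :
    wp L (stage p t up ns) Q σ := by
  classical
  have hWs := hL.words
  simp only [List.mem_cons, List.not_mem_nil, or_false, not_or] at hp ht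
  unfold stage
  rw [wp_ite_int, h20, hσ.reg3, wp_ite_int, hσ.reg0]
  refine ⟨fun _ => ⟨fun hpn => ?_, fun hpn => ?_⟩, fun h => absurd zero_lt_one h⟩
  swap
  · exact hstay σ (Frame.refl _ _ _) rfl (fun h => absurd h hpn)
  rw [wp_block_cons]
  refine wp_ldPt hL ho hσ hpn fun v4 v5 => ?_
  set τ : Store := ⟨Function.update (Function.update (Function.update σ.I 4 v4) 5 v5) 24
        (n + clr col P o (σ.I p)),
      Function.update (Function.update σ.R 17 (srt Z P (1 - o) (σ.I p))) 18 (oth Z P o (σ.I p)),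
      σ.M, Z⟩ with hτ
  have hfτ : Frame [4, 5, 24] [17, 18] σ τ := by
    repeat refine Frame.updI ?_ (by decide)
    repeat refine Frame.updR ?_ (by decide)
    exact Frame.base hσ.pts
  have hstay' : ¬ Passes up (srt Z P (1 - o) (σ.I p)) (σ.R t) → Q τ :=
    fun h => hstay τ hfτ rfl fun _ => h
  have hcl : clr col P o (σ.I p) < k := hL.col_lt _ (hL.lt _ hpn _ (by omega))
  have hind : ∀ c, ind x₀ s w (oth Z P o) (clr col P o) ns c (σ.I p) =
      if c = clr col P o (σ.I p) then
        (if Counted x₀ s w ns (oth Z P o (σ.I p)) then 1 else 0) else 0 := by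
    intro c
    unfold ind
    by_cases h1 : Counted x₀ s w ns (oth Z P o (σ.I p)) <;>
    by_cases h2 : clr col P o (σ.I p) = c <;> simp [h1, h2, eq_comm (a := c)]
  have hact : Passes up (srt Z P (1 - o) (σ.I p)) (σ.R t) →
      wp L (block [mark ns, bump up, iadd p p 3, iset 20 1]) Q τ := by
    intro hpass
    rw [wp_block_cons]
    refine wp_mark (x₀ := x₀) (s := s) (w := w) (by omega) ?_ ?_ ?_ fun v => ?_
    · rw [hfτ.2.1 6 (by decide), h6]
    · rw [hfτ.2.1 7 (by decide), h7]
    · rw [hfτ.2.1 25 (by decide), h25]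
    have h18 : τ.R 18 = oth Z P o (σ.I p) := by simp [hτ]
    rw [h18]
    set τ' : Store := ⟨Function.update τ.I 25
        (if Counted x₀ s w ns (oth Z P o (σ.I p)) then 1 else 0),
      Function.update τ.R 14 v, τ.M, τ.Z⟩ with hτ'
    have hfτ' : Frame [4, 5, 24, 25] [14, 17, 18] σ τ' := by
      refine Frame.updI (Frame.updR ?_ (by decide)) (by decide)
      exact hfτ.weaken (by decide) (by decide)
    have h25' : τ'.I 25 = if Counted x₀ s w ns (oth Z P o (σ.I p)) then 1 else 0 := by
      simp [hτ']
    rw [wp_block_cons]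
    refine wp_bump (n := n) (k := k) hcl hL.int_cells hW ?_ ?_ ?_ ?_ ?_ ?_ fun τ'' hf hM hnz' hu hd => ?_
    · rw [hfτ'.1 2 (by decide), hσ.reg2]
    · rw [hfτ'.1 3 (by decide), hσ.reg3]
    · simp [hτ', hτ]
    · rw [h25']; split_ifs <;> simp
    · rw [hfτ'.1 19 (by decide), hnz]
    · intro hup
      rw [h25']
      have := hpos hup hpn hpass _ hcl
      rwa [hind, if_pos rfl] at this
    · have hf3 : Frame [4, 5, 19, 24, 25] [14, 17, 18] σ τ'' :=
        (hfτ'.weaken (by decide) (by decide)).trans (hf.weaken (by decide) (by decide))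
      have hp3 : τ''.I p = σ.I p := hf3.1 p (by
        simp only [List.mem_cons, List.not_mem_nil, or_false, not_or]; omega)
      simp only [wp_block_cons, wp_block_nil, wp_iadd, wp_iset]
      rw [hf3.1 3 (by decide), hσ.reg3, hp3]
      have hp20 : p ≠ 20 := by omega
      refine ⟨by omega, by omega, hgo _ ?_ hM hpn hpass ?_ ?_ ?_ ?_ ?_⟩
      · refine Frame.updI (Frame.updI ?_ (by simp)) (by simp)
        refine hf3.weaken ?_ (by decide)
        intro r hr
        simp only [List.mem_cons, List.not_mem_nil, or_false] at hr ⊢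
        omega
      · simp [hp20]
      · simp
      · simp only [Function.update_apply]
        rw [if_neg (by decide), if_neg (by omega)]
        exact hnz'
      · intro hup c hc
        rw [hind, hu hup c hc, h25']
      · intro hup c hc
        have := hd hup c hc
        rw [hind]
        rwa [h25'] at this
  cases up
  · rw [wp_block_cons]
    simp only [wp_ite_real]
    have ht' : τ.R t = σ.R t := hfτ.2.1 t (by simp [ht])
    have h17 : τ.R 17 = srt Z P (1 - o) (σ.I p) := by simp [hτ]
    rw [ht', h17]
    refine ⟨fun h => wp_mono (fun _ => id) (hact (by simpa [Passes] using h)), fun h => ?_⟩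
    exact hstay' (by simpa [Passes] using h)
  · rw [wp_block_cons]
    simp only [wp_ite_real]
    have ht' : τ.R t = σ.R t := hfτ.2.1 t (by simp [ht])
    have h17 : τ.R 17 = srt Z P (1 - o) (σ.I p) := by simp [hτ]
    rw [ht', h17]
    refine ⟨fun h => ?_, fun h => wp_mono (fun _ => id) (hact (by simpa [Passes] using h))⟩
    exact hstay' (by simpa [Passes] using h)

end CSSA

namespace CSSA

/-- Number of counted points of color `c` at the first `p` positions. -/
noncomputable def cnt (x₀ s w : ℝ) (x : ℕ → ℝ) (cl : ℕ → ℕ) (ns : Bool) (c p : ℕ) : ℕ :=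
  ∑ a ∈ Finset.range p, ind x₀ s w x cl ns c a

section Counting

variable {x₀ s w b : ℝ} {x y : ℕ → ℝ} {cl : ℕ → ℕ} {c : ℕ}

theorem ind_le_one (ns : Bool) (a : ℕ) : ind x₀ s w x cl ns c a ≤ 1 := by
  unfold ind; split_ifs <;> simp

theorem ind_true_le (a : ℕ) : ind x₀ s w x cl true c a ≤ ind x₀ s w x cl false c a := by
  unfold ind
  by_cases h : Counted x₀ s w true (x a) ∧ cl a = c
  · rw [if_pos h, if_pos ⟨⟨h.1.1, by simp⟩, h.2⟩]
  · rw [if_neg h]; exact Nat.zero_le _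

theorem cnt_succ (ns : Bool) (p : ℕ) :
    cnt x₀ s w x cl ns c (p + 1) = cnt x₀ s w x cl ns c p + ind x₀ s w x cl ns c p :=
  Finset.sum_range_succ _ _

theorem cnt_mono (ns : Bool) {p q : ℕ} (h : p ≤ q) :
    cnt x₀ s w x cl ns c p ≤ cnt x₀ s w x cl ns c q :=
  Finset.sum_le_sum_of_subset (Finset.range_mono h)

theorem cnt_le (ns : Bool) (p : ℕ) : cnt x₀ s w x cl ns c p ≤ p := by
  calc cnt x₀ s w x cl ns c p ≤ ∑ _a ∈ Finset.range p, 1 :=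
        Finset.sum_le_sum fun a _ => ind_le_one ns a
    _ = p := by simp

theorem cnt_dom {p q : ℕ} (h : p ≤ q) : cnt x₀ s w x cl true c q + cnt x₀ s w x cl false c p ≤
    cnt x₀ s w x cl false c q + cnt x₀ s w x cl true c p := by
  induction q, h using Nat.le_induction with
  | base => omega
  | succ q _ ih =>
    rw [cnt_succ, cnt_succ]
    have := ind_true_le (x₀ := x₀) (s := s) (w := w) (x := x) (cl := cl) (c := c) q
    omega

theorem cnt_eq (ns : Bool) {n p : ℕ} (h : p ≤ n) : cnt x₀ s w x cl ns c p =
    ∑ a ∈ Finset.range n, if a < p then ind x₀ s w x cl ns c a else 0 := by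
  rw [← Finset.sum_filter]
  apply Finset.sum_congr _ fun _ _ => rfl
  ext a; simp; omega

/-- The point at position `a` has color `c` and lies in the annulus. -/
def Good (x₀ s w b : ℝ) (x y : ℕ → ℝ) (cl : ℕ → ℕ) (c a : ℕ) : Prop :=
  cl a = c ∧ (x₀ ≤ x a ∧ x a ≤ x₀ + s) ∧ (b ≤ y a ∧ y a ≤ b + s) ∧
    ((x a - x₀ ≤ w ∨ x₀ + s - x a ≤ w) ∨ (y a - b ≤ w ∨ b + s - y a ≤ w))

theorem counter_term (hw : 0 ≤ w) (hws : w ≤ s) {p₁ p₂ p₃ p₄ a : ℕ}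
    (h₁ : a < p₁ ↔ y a ≤ b + s) (h₂ : a < p₂ ↔ y a < b + s - w) (h₃ : a < p₃ ↔ y a ≤ b + w)
    (h₄ : a < p₄ ↔ y a < b) :
    let U := (if a < p₂ then ind x₀ s w x cl true c a else 0) +
      (if a < p₄ then ind x₀ s w x cl false c a else 0)
    let T := (if a < p₁ then ind x₀ s w x cl false c a else 0) +
      (if a < p₃ then ind x₀ s w x cl true c a else 0)
    U ≤ T ∧ (U < T ↔ Good x₀ s w b x y cl c a) := by
  intro U T
  have e1 : ind x₀ s w x cl false c a = if (x₀ ≤ x a ∧ x a ≤ x₀ + s) ∧ cl a = c then 1 else 0 := by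
    unfold ind Counted; simp
  by_cases hsl : (x₀ ≤ x a ∧ x a ≤ x₀ + s) ∧ cl a = c
  swap
  · have e2 : ind x₀ s w x cl true c a = 0 := by
      unfold ind
      rw [if_neg fun h => hsl ⟨h.1.1, h.2⟩]
    rw [if_neg hsl] at e1
    have hng : ¬ Good x₀ s w b x y cl c a := fun h => hsl ⟨h.2.1, h.1⟩
    simp [U, T, e1, e2, hng]
  rw [if_pos hsl] at e1
  obtain ⟨hsl, hcl⟩ := hsl
  have hg : Good x₀ s w b x y cl c a ↔ (b ≤ y a ∧ y a ≤ b + s) ∧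
      ((x a - x₀ ≤ w ∨ x₀ + s - x a ≤ w) ∨ (y a - b ≤ w ∨ b + s - y a ≤ w)) := by
    simp [Good, hcl, hsl]
  by_cases hin : w < x a - x₀ ∧ w < x₀ + s - x a
  · have e2 : ind x₀ s w x cl true c a = 1 := by
      unfold ind
      rw [if_pos ⟨⟨hsl, fun _ => hin⟩, hcl⟩]
    have hg' : Good x₀ s w b x y cl c a ↔ (b ≤ y a ∧ y a ≤ b + s) ∧
        (y a - b ≤ w ∨ b + s - y a ≤ w) := by
      rw [hg]; simp [not_le.2 hin.1, not_le.2 hin.2]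
    rw [hg']
    simp only [U, T, e1, e2, h₁, h₂, h₃, h₄]
    rcases lt_or_ge (y a) b with g4 | g4
    · have g1 : y a ≤ b + s := by linarith
      have g2 : y a < b + s - w := by linarith
      have g3 : y a ≤ b + w := by linarith
      simp [g1, g2, g3, g4]
    rcases le_or_gt (y a) (b + s) with g1 | g1
    · rcases lt_or_ge (y a) (b + s - w) with g2 | g2 <;>
      rcases le_or_gt (y a) (b + w) with g3 | g3
      · simp [g1, g2, g3, g4, not_lt.2 g4]
        exact Or.inl (by linarith)
      · simp [g1, g2, not_le.2 g3, not_lt.2 g4, g4]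
        exact ⟨by linarith, by linarith⟩
      · have : b + s - y a ≤ w := by linarith
        simp [g1, not_lt.2 g2, g3, g4, not_lt.2 g4, this]
      · have : b + s - y a ≤ w := by linarith
        simp [g1, not_lt.2 g2, not_le.2 g3, g4, not_lt.2 g4, this]
    · have g2 : ¬ y a < b + s - w := by linarith
      have g3 : ¬ y a ≤ b + w := by linarith
      simp [not_le.2 g1, g2, g3, not_lt.2 g4]
  · have e2 : ind x₀ s w x cl true c a = 0 := by
      unfold ind
      rw [if_neg fun h => hin (h.1.2 rfl)]
    have hside : x a - x₀ ≤ w ∨ x₀ + s - x a ≤ w := by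
      by_contra hcon
      push Not at hcon
      exact hin hcon
    have hg' : Good x₀ s w b x y cl c a ↔ (b ≤ y a ∧ y a ≤ b + s) := by
      rw [hg]; exact ⟨fun h => h.1, fun h => ⟨h, Or.inl hside⟩⟩
    rw [hg']
    simp only [U, T, e1, e2, h₁, h₄]
    rcases lt_or_ge (y a) b with g4 | g4
    · have g1 : y a ≤ b + s := by linarith
      simp [g1, g4]
    · by_cases g1 : y a ≤ b + s <;> simp [g1, g4, not_lt.2 g4]

theorem counter_pos (hw : 0 ≤ w) (hws : w ≤ s) {n p₁ p₂ p₃ p₄ m : ℕ} (l₁ : p₁ ≤ n) (l₂ : p₂ ≤ n)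
    (l₃ : p₃ ≤ n) (l₄ : p₄ ≤ n)
    (h₁ : ∀ a < n, a < p₁ ↔ y a ≤ b + s) (h₂ : ∀ a < n, a < p₂ ↔ y a < b + s - w)
    (h₃ : ∀ a < n, a < p₃ ↔ y a ≤ b + w) (h₄ : ∀ a < n, a < p₄ ↔ y a < b)
    (hm : m + cnt x₀ s w x cl true c p₂ + cnt x₀ s w x cl false c p₄ =
      cnt x₀ s w x cl false c p₁ + cnt x₀ s w x cl true c p₃) :
    0 < m ↔ ∃ a < n, Good x₀ s w b x y cl c a := by
  rw [cnt_eq _ l₁, cnt_eq _ l₂, cnt_eq _ l₃, cnt_eq _ l₄, add_assoc, ← Finset.sum_add_distrib,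
    ← Finset.sum_add_distrib] at hm
  have key := fun a (ha : a < n) => counter_term (x₀ := x₀) (x := x) (cl := cl) (c := c) hw hws
    (h₁ a ha) (h₂ a ha) (h₃ a ha) (h₄ a ha)
  constructor
  · intro h
    by_contra hcon
    push Not at hcon
    have := Finset.sum_le_sum (s := Finset.range n) fun a ha =>
      not_lt.1 (mt (key a (Finset.mem_range.1 ha)).2.1 (hcon a (Finset.mem_range.1 ha)))
    omega
  · rintro ⟨a, ha, hga⟩
    have := Finset.sum_lt_sum (s := Finset.range n)
      (fun a ha => (key a (Finset.mem_range.1 ha)).1) ⟨a, Finset.mem_range.2 ha, (key a ha).2.2 hga⟩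
    omega

end Counting

variable {n k : ℕ} {L : Lim} {Z : ℕ → ℝ} {mem col : ℕ → ℕ} {P : ℕ → ℕ → ℕ} {o : ℕ}

theorem feasAt_iff_good (hL : Layout n k L Z mem col P) {x₀ s w b : ℝ} :
    FeasAt n k col (fun p => Z (2 * p + o)) (fun p => Z (2 * p + (1 - o))) x₀ s w b ↔
      ∀ c < k, ∃ a < n, Good x₀ s w b (oth Z P o) (srt Z P (1 - o)) (clr col P o) c a := by
  have ho : 1 - o < 2 := by omega
  constructor
  · intro h c hc
    obtain ⟨p, hp, h1, h2⟩ := h c hc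
    obtain ⟨a, ha, rfl⟩ := hL.surj p hp (1 - o) ho
    exact ⟨a, ha, h1, h2⟩
  · intro h c hc
    obtain ⟨a, ha, h1, h2⟩ := h c hc
    exact ⟨P (1 - o) a, hL.lt a ha _ ho, h1, h2⟩

/-! ### The sweep -/

/-- One step of the sweep: advance one of the positions, or test the current square. -/
def sweepBody (ro : ℕ) : Com :=
  block [iset 20 0, ldS 18 9 7 17, rsub 15 17 ro, radd 19 15 5, radd 26 15 7, rsub 27 19 7,
    stage 14 19 true false, stage 16 26 true true, stage 15 27 false true,
    stage 17 15 false false,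
    .ite (.int 20 3)
      (block [.ite (.int 19 1) .skip (block [iset 21 1, radd 20 15 9]), iadd 18 18 3]) .skip]

/-- Test all outer squares whose lower side is `R[ro]` below a point. -/
def sweep (ro : ℕ) : Com :=
  block [iset 12 0, .loop (.int 12 1) (block [iadd 4 0 12, istore 4 2, iadd 12 12 3]),
    radd 25 6 5, iset 14 0, iset 15 0, iset 16 0, iset 17 0, iset 18 0, iset 19 0,
    .loop (.int 18 0) (sweepBody ro)]

/-- The counters belong to the four positions in registers `14` to `17`. -/
structure Counts (n k : ℕ) (Z : ℕ → ℝ) (col : ℕ → ℕ) (P : ℕ → ℕ → ℕ) (o : ℕ) (x₀ s w : ℝ)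
    (τ : Store) : Prop where
  nz : τ.I 19 = nzc n k τ.M
  le14 : τ.I 14 ≤ n
  le15 : τ.I 15 ≤ n
  le16 : τ.I 16 ≤ n
  le17 : τ.I 17 ≤ n
  count : ∀ c < k, τ.M (n + c) + cnt x₀ s w (oth Z P o) (clr col P o) true c (τ.I 15) +
      cnt x₀ s w (oth Z P o) (clr col P o) false c (τ.I 17) =
    cnt x₀ s w (oth Z P o) (clr col P o) false c (τ.I 14) +
      cnt x₀ s w (oth Z P o) (clr col P o) true c (τ.I 16)

/-- The four positions are not too large for the outer square with lower side `b`. -/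
structure Below (Z : ℕ → ℝ) (P : ℕ → ℕ → ℕ) (o : ℕ) (s w b : ℝ) (τ : Store) : Prop where
  b14 : ∀ a < τ.I 14, srt Z P (1 - o) a ≤ b + s
  b15 : ∀ a < τ.I 15, srt Z P (1 - o) a < b + s - w
  b16 : ∀ a < τ.I 16, srt Z P (1 - o) a ≤ b + w
  b17 : ∀ a < τ.I 17, srt Z P (1 - o) a < b

/-- Remaining advances of the positions. -/
def rest (n : ℕ) (τ : Store) : ℕ :=
  (n - τ.I 14) + (n - τ.I 15) + (n - τ.I 16) + (n - τ.I 17) + (n - τ.I 18)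

/-- State within a step of the sweep, after `m` of its four stages. -/
structure Mid (n k : ℕ) (Z : ℕ → ℝ) (col : ℕ → ℕ) (P : ℕ → ℕ → ℕ) (o : ℕ) (x₀ s w b : ℝ)
    (σ τ : Store) (m : ℕ) : Prop where
  frame : Frame [4, 5, 14, 15, 16, 17, 19, 20, 24, 25] [14, 17, 18] σ τ
  mem : ∀ a < n, τ.M a = σ.M a
  counts : Counts n k Z col P o x₀ s w τ
  below : Below Z P o s w b τ
  moved : (τ.I 20 = 1 ∧ rest n τ < rest n σ) ∨ (τ.I 20 = 0 ∧ rest n τ = rest n σ ∧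
    (1 ≤ m → τ.I 14 < n → b + s < srt Z P (1 - o) (τ.I 14)) ∧
    (2 ≤ m → τ.I 16 < n → b + w < srt Z P (1 - o) (τ.I 16)) ∧
    (3 ≤ m → τ.I 15 < n → b + s - w ≤ srt Z P (1 - o) (τ.I 15)) ∧
    (4 ≤ m → τ.I 17 < n → b ≤ srt Z P (1 - o) (τ.I 17)))

/-- The registers that stay fixed within a step of the sweep. -/
structure Fixed (x₀ s w b : ℝ) (σ : Store) : Prop where
  r6 : σ.R 6 = x₀
  r7 : σ.R 7 = w
  r15 : σ.R 15 = b
  r19 : σ.R 19 = b + s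
  r25 : σ.R 25 = x₀ + s
  r26 : σ.R 26 = b + w
  r27 : σ.R 27 = b + s - w

section Stages

variable {x₀ s w b : ℝ} {σ τ : Store} {Q : Store → Prop}

theorem Counts.counter_le (h : Counts n k Z col P o x₀ s w τ) {c : ℕ} (hc : c < k) :
    τ.M (n + c) ≤ 2 * n := by
  have h1 := h.count c hc
  have h2 := cnt_le (x₀ := x₀) (s := s) (w := w) (x := oth Z P o) (cl := clr col P o) (c := c)
    false (τ.I 14)
  have h3 := cnt_le (x₀ := x₀) (s := s) (w := w) (x := oth Z P o) (cl := clr col P o) (c := c)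
    true (τ.I 16)
  have h4 := h.le14
  have h5 := h.le16
  omega

theorem Mid.ctx {m : ℕ} (h : Mid n k Z col P o x₀ s w b σ τ m) (hσ : Ctx n k Z mem o σ) :
    Ctx n k Z mem o τ :=
  hσ.of_frame h.frame (by decide) (by decide) h.mem

theorem wp_stage14 (hL : Layout n k L Z mem col P) (ho : o < 2) (hσ : Ctx n k Z mem o σ)
    (hF : Fixed x₀ s w b σ) (h : Mid n k Z col P o x₀ s w b σ τ 0)
    (hQ : ∀ τ', Mid n k Z col P o x₀ s w b σ τ' 1 → Q τ') :
    wp L (stage 14 19 true false) Q τ := by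
  have hτ := h.ctx hσ
  have hWs := hL.words
  rcases h.moved with ⟨h20, hlt⟩ | ⟨h20, heq, -, -, -, -⟩
  · exact wp_stage_idle hτ.reg3 h20
      (hQ τ ⟨h.frame, h.mem, h.counts, h.below, Or.inl ⟨h20, hlt⟩⟩)
  have hC := h.counts
  have h19 : τ.R 19 = b + s := (h.frame.2.1 19 (by decide)).trans hF.r19
  refine wp_stage hL ho hτ (x₀ := x₀) (s := s) (w := w) (by simp) (by decide)
    ((h.frame.2.1 6 (by decide)).trans hF.r6) ((h.frame.2.1 7 (by decide)).trans hF.r7)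
    ((h.frame.2.1 25 (by decide)).trans hF.r25) h20 ?_ hC.nz ?_ ?_ ?_
  · intro c hc _
    have := hC.counter_le hc
    omega
  · intro hup; simp at hup
  · intro τ' hf hM hno
    rw [h19] at hno
    have hI : ∀ r ∈ [14, 15, 16, 17, 18, 19, 20], τ'.I r = τ.I r := by
      intro r hr
      exact hf.1 r (by simp at hr ⊢; omega)
    simp only [List.mem_cons, List.not_mem_nil, or_false, forall_eq_or_imp, forall_eq] at hI
    obtain ⟨i14, i15, i16, i17, i18, i19, i20⟩ := hI
    refine hQ τ' ⟨h.frame.trans (hf.weaken (by decide) (by decide)), by rw [hM]; exact h.mem,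
      ⟨by rw [i19, hM]; exact hC.nz, by rw [i14]; exact hC.le14, by rw [i15]; exact hC.le15,
        by rw [i16]; exact hC.le16, by rw [i17]; exact hC.le17,
        by rw [i14, i15, i16, i17, hM]; exact hC.count⟩,
      ⟨by rw [i14]; exact h.below.b14, by rw [i15]; exact h.below.b15,
        by rw [i16]; exact h.below.b16, by rw [i17]; exact h.below.b17⟩,
      Or.inr ⟨i20.trans h20, by simp only [rest, i14, i15, i16, i17, i18] at heq ⊢; exact heq,
        fun _ => ?_, by omega, by omega, by omega⟩⟩
    rw [i14]
    intro hn
    simpa [Passes] using hno hn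
  · intro τ' hf hM hpn hpass hp h20' hnz hup _
    rw [h19] at hpass
    have hI : ∀ r ∈ [15, 16, 17, 18], τ'.I r = τ.I r := by
      intro r hr
      exact hf.1 r (by simp at hr ⊢; omega)
    simp only [List.mem_cons, List.not_mem_nil, or_false, forall_eq_or_imp, forall_eq] at hI
    obtain ⟨i15, i16, i17, i18⟩ := hI
    refine hQ τ' ⟨h.frame.trans (hf.weaken (by decide) (by decide)),
      fun a ha => (hM a ha).trans (h.mem a ha),
      ⟨hnz, by omega, by rw [i15]; exact hC.le15,
        by rw [i16]; exact hC.le16, by rw [i17]; exact hC.le17, ?_⟩,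
      ⟨?_, by rw [i15]; exact h.below.b15,
        by rw [i16]; exact h.below.b16, by rw [i17]; exact h.below.b17⟩,
      Or.inl ⟨h20', ?_⟩⟩
    · intro c hc
      have h1 := hup rfl c hc
      have h2 := hC.count c hc
      rw [i15, i16, i17, hp, h1, cnt_succ]
      omega
    · intro a ha
      rw [hp] at ha
      rcases Nat.lt_succ_iff_lt_or_eq.1 ha with ha | rfl
      · exact h.below.b14 a ha
      · simpa [Passes] using hpass
    · rw [← heq]; simp only [rest, i15, i16, i17, i18, hp]; omega

theorem wp_stage16 (hL : Layout n k L Z mem col P) (ho : o < 2) (hσ : Ctx n k Z mem o σ)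
    (hF : Fixed x₀ s w b σ) (h : Mid n k Z col P o x₀ s w b σ τ 1)
    (hQ : ∀ τ', Mid n k Z col P o x₀ s w b σ τ' 2 → Q τ') :
    wp L (stage 16 26 true true) Q τ := by
  have hτ := h.ctx hσ
  have hWs := hL.words
  rcases h.moved with ⟨h20, hlt⟩ | ⟨h20, heq, m14, -, -, -⟩
  · exact wp_stage_idle hτ.reg3 h20
      (hQ τ ⟨h.frame, h.mem, h.counts, h.below, Or.inl ⟨h20, hlt⟩⟩)
  have hC := h.counts
  have h26 : τ.R 26 = b + w := (h.frame.2.1 26 (by decide)).trans hF.r26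
  refine wp_stage hL ho hτ (x₀ := x₀) (s := s) (w := w) (by simp) (by decide)
    ((h.frame.2.1 6 (by decide)).trans hF.r6) ((h.frame.2.1 7 (by decide)).trans hF.r7)
    ((h.frame.2.1 25 (by decide)).trans hF.r25) h20 ?_ hC.nz ?_ ?_ ?_
  · intro c hc _
    have := hC.counter_le hc
    omega
  · intro hup; simp at hup
  · intro τ' hf hM hno
    rw [h26] at hno
    have hI : ∀ r ∈ [14, 15, 16, 17, 18, 19, 20], τ'.I r = τ.I r := by
      intro r hr
      exact hf.1 r (by simp at hr ⊢; omega)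
    simp only [List.mem_cons, List.not_mem_nil, or_false, forall_eq_or_imp, forall_eq] at hI
    obtain ⟨i14, i15, i16, i17, i18, i19, i20⟩ := hI
    refine hQ τ' ⟨h.frame.trans (hf.weaken (by decide) (by decide)), by rw [hM]; exact h.mem,
      ⟨by rw [i19, hM]; exact hC.nz, by rw [i14]; exact hC.le14, by rw [i15]; exact hC.le15,
        by rw [i16]; exact hC.le16, by rw [i17]; exact hC.le17,
        by rw [i14, i15, i16, i17, hM]; exact hC.count⟩,
      ⟨by rw [i14]; exact h.below.b14, by rw [i15]; exact h.below.b15,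
        by rw [i16]; exact h.below.b16, by rw [i17]; exact h.below.b17⟩,
      Or.inr ⟨i20.trans h20, by simp only [rest, i14, i15, i16, i17, i18] at heq ⊢; exact heq,
        fun _ => by rw [i14]; exact m14 le_rfl, fun _ => ?_, by omega, by omega⟩⟩
    rw [i16]
    intro hn
    simpa [Passes] using hno hn
  · intro τ' hf hM hpn hpass hp h20' hnz hup _
    rw [h26] at hpass
    have hI : ∀ r ∈ [14, 15, 17, 18], τ'.I r = τ.I r := by
      intro r hr
      exact hf.1 r (by simp at hr ⊢; omega)
    simp only [List.mem_cons, List.not_mem_nil, or_false, forall_eq_or_imp, forall_eq] at hI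
    obtain ⟨i14, i15, i17, i18⟩ := hI
    refine hQ τ' ⟨h.frame.trans (hf.weaken (by decide) (by decide)),
      fun a ha => (hM a ha).trans (h.mem a ha),
      ⟨hnz, by rw [i14]; exact hC.le14, by rw [i15]; exact hC.le15,
        by omega, by rw [i17]; exact hC.le17, ?_⟩,
      ⟨by rw [i14]; exact h.below.b14, by rw [i15]; exact h.below.b15,
        ?_, by rw [i17]; exact h.below.b17⟩,
      Or.inl ⟨h20', ?_⟩⟩
    · intro c hc
      have h1 := hup rfl c hc
      have h2 := hC.count c hc
      rw [i14, i15, i17, hp, h1, cnt_succ]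
      omega
    · intro a ha
      rw [hp] at ha
      rcases Nat.lt_succ_iff_lt_or_eq.1 ha with ha | rfl
      · exact h.below.b16 a ha
      · simpa [Passes] using hpass
    · rw [← heq]; simp only [rest, i14, i15, i17, i18, hp]; omega

theorem wp_stage15 (hL : Layout n k L Z mem col P) (ho : o < 2) (hσ : Ctx n k Z mem o σ)
    (hF : Fixed x₀ s w b σ) (hw : 0 ≤ w) (hws : w ≤ s) (h : Mid n k Z col P o x₀ s w b σ τ 2)
    (hQ : ∀ τ', Mid n k Z col P o x₀ s w b σ τ' 3 → Q τ') :
    wp L (stage 15 27 false true) Q τ := by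
  have hτ := h.ctx hσ
  have hWs := hL.words
  rcases h.moved with ⟨h20, hlt⟩ | ⟨h20, heq, m14, m16, -, -⟩
  · exact wp_stage_idle hτ.reg3 h20
      (hQ τ ⟨h.frame, h.mem, h.counts, h.below, Or.inl ⟨h20, hlt⟩⟩)
  have hC := h.counts
  have h27 : τ.R 27 = b + s - w := (h.frame.2.1 27 (by decide)).trans hF.r27
  have hsrt := hL.sorted (1 - o) (by omega)
  refine wp_stage hL ho hτ (x₀ := x₀) (s := s) (w := w) (by simp) (by decide)
    ((h.frame.2.1 6 (by decide)).trans hF.r6) ((h.frame.2.1 7 (by decide)).trans hF.r7)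
    ((h.frame.2.1 25 (by decide)).trans hF.r25) h20 ?_ hC.nz ?_ ?_ ?_
  · intro c hc hup; simp at hup
  · intro _ hpn hpass c hc
    rw [h27] at hpass
    have hpass' : srt Z P (1 - o) (τ.I 15) < b + s - w := by simpa [Passes] using hpass
    have h1 : τ.I 15 + 1 ≤ τ.I 14 := by
      by_contra hcon
      have := m14 (by omega) (by omega)
      have := hsrt (τ.I 14) (τ.I 15) (by omega) hpn
      simp only [srt] at *
      linarith
    have h2 : τ.I 17 ≤ τ.I 14 := by
      by_contra hcon
      have h17 := h.below.b17 (τ.I 14) (by omega)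
      have := hC.le17
      have := m14 (by omega) (by omega)
      linarith
    have h3 : τ.I 17 ≤ τ.I 16 := by
      by_contra hcon
      have h17 := h.below.b17 (τ.I 16) (by omega)
      have := hC.le17
      have := m16 (by omega) (by omega)
      linarith
    have h4 := cnt_mono (x₀ := x₀) (s := s) (w := w) (x := oth Z P o) (cl := clr col P o)
      (c := c) true h1
    have h5 := cnt_dom (x₀ := x₀) (s := s) (w := w) (x := oth Z P o) (cl := clr col P o)
      (c := c) h2
    have h6 := cnt_mono (x₀ := x₀) (s := s) (w := w) (x := oth Z P o) (cl := clr col P o)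
      (c := c) true h3
    have h7 := hC.count c hc
    rw [cnt_succ] at h4
    omega
  · intro τ' hf hM hno
    rw [h27] at hno
    have hI : ∀ r ∈ [14, 15, 16, 17, 18, 19, 20], τ'.I r = τ.I r := by
      intro r hr
      exact hf.1 r (by simp at hr ⊢; omega)
    simp only [List.mem_cons, List.not_mem_nil, or_false, forall_eq_or_imp, forall_eq] at hI
    obtain ⟨i14, i15, i16, i17, i18, i19, i20⟩ := hI
    refine hQ τ' ⟨h.frame.trans (hf.weaken (by decide) (by decide)), by rw [hM]; exact h.mem,
      ⟨by rw [i19, hM]; exact hC.nz, by rw [i14]; exact hC.le14, by rw [i15]; exact hC.le15,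
        by rw [i16]; exact hC.le16, by rw [i17]; exact hC.le17,
        by rw [i14, i15, i16, i17, hM]; exact hC.count⟩,
      ⟨by rw [i14]; exact h.below.b14, by rw [i15]; exact h.below.b15,
        by rw [i16]; exact h.below.b16, by rw [i17]; exact h.below.b17⟩,
      Or.inr ⟨i20.trans h20, by simp only [rest, i14, i15, i16, i17, i18] at heq ⊢; exact heq,
        fun _ => by rw [i14]; exact m14 (by omega), fun _ => by rw [i16]; exact m16 le_rfl,
        fun _ => ?_, by omega⟩⟩
    rw [i15]
    intro hn
    simpa [Passes] using hno hn
  · intro τ' hf hM hpn hpass hp h20' hnz _ hdn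
    rw [h27] at hpass
    have hI : ∀ r ∈ [14, 16, 17, 18], τ'.I r = τ.I r := by
      intro r hr
      exact hf.1 r (by simp at hr ⊢; omega)
    simp only [List.mem_cons, List.not_mem_nil, or_false, forall_eq_or_imp, forall_eq] at hI
    obtain ⟨i14, i16, i17, i18⟩ := hI
    refine hQ τ' ⟨h.frame.trans (hf.weaken (by decide) (by decide)),
      fun a ha => (hM a ha).trans (h.mem a ha),
      ⟨hnz, by rw [i14]; exact hC.le14, by omega,
        by rw [i16]; exact hC.le16, by rw [i17]; exact hC.le17, ?_⟩,
      ⟨by rw [i14]; exact h.below.b14, ?_, by rw [i16]; exact h.below.b16,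
        by rw [i17]; exact h.below.b17⟩,
      Or.inl ⟨h20', ?_⟩⟩
    · intro c hc
      have h1 := hdn rfl c hc
      have h2 := hC.count c hc
      rw [i14, i16, i17, hp, cnt_succ]
      omega
    · intro a ha
      rw [hp] at ha
      rcases Nat.lt_succ_iff_lt_or_eq.1 ha with ha | rfl
      · exact h.below.b15 a ha
      · simpa [Passes] using hpass
    · rw [← heq]; simp only [rest, i14, i16, i17, i18, hp]; omega

theorem wp_stage17 (hL : Layout n k L Z mem col P) (ho : o < 2) (hσ : Ctx n k Z mem o σ)
    (hF : Fixed x₀ s w b σ) (hw : 0 ≤ w) (hws : w ≤ s) (h : Mid n k Z col P o x₀ s w b σ τ 3)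
    (hQ : ∀ τ', Mid n k Z col P o x₀ s w b σ τ' 4 → Q τ') :
    wp L (stage 17 15 false false) Q τ := by
  have hτ := h.ctx hσ
  have hWs := hL.words
  rcases h.moved with ⟨h20, hlt⟩ | ⟨h20, heq, m14, m16, m15, -⟩
  · exact wp_stage_idle hτ.reg3 h20
      (hQ τ ⟨h.frame, h.mem, h.counts, h.below, Or.inl ⟨h20, hlt⟩⟩)
  have hC := h.counts
  have h15 : τ.R 15 = b := (h.frame.2.1 15 (by decide)).trans hF.r15
  have hsrt := hL.sorted (1 - o) (by omega)
  refine wp_stage hL ho hτ (x₀ := x₀) (s := s) (w := w) (by simp) (by decide)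
    ((h.frame.2.1 6 (by decide)).trans hF.r6) ((h.frame.2.1 7 (by decide)).trans hF.r7)
    ((h.frame.2.1 25 (by decide)).trans hF.r25) h20 ?_ hC.nz ?_ ?_ ?_
  · intro c hc hup; simp at hup
  · intro _ hpn hpass c hc
    rw [h15] at hpass
    have hpass' : srt Z P (1 - o) (τ.I 17) < b := by simpa [Passes] using hpass
    have h1 : τ.I 17 + 1 ≤ τ.I 14 := by
      by_contra hcon
      have := m14 (by omega) (by omega)
      have := hsrt (τ.I 14) (τ.I 17) (by omega) hpn
      simp only [srt] at *
      linarith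
    have h2 : τ.I 17 + 1 ≤ τ.I 16 := by
      by_contra hcon
      have := m16 (by omega) (by omega)
      have := hsrt (τ.I 16) (τ.I 17) (by omega) hpn
      simp only [srt] at *
      linarith
    have h3 : τ.I 15 ≤ τ.I 14 := by
      by_contra hcon
      have h17 := h.below.b15 (τ.I 14) (by omega)
      have := hC.le15
      have := m14 (by omega) (by omega)
      linarith
    have h4 := cnt_mono (x₀ := x₀) (s := s) (w := w) (x := oth Z P o) (cl := clr col P o)
      (c := c) true h3
    have h5 := cnt_dom (x₀ := x₀) (s := s) (w := w) (x := oth Z P o) (cl := clr col P o)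
      (c := c) h1
    have h6 := cnt_mono (x₀ := x₀) (s := s) (w := w) (x := oth Z P o) (cl := clr col P o)
      (c := c) true h2
    have h7 := hC.count c hc
    rw [cnt_succ (ns := false)] at h5
    omega
  · intro τ' hf hM hno
    rw [h15] at hno
    have hI : ∀ r ∈ [14, 15, 16, 17, 18, 19, 20], τ'.I r = τ.I r := by
      intro r hr
      exact hf.1 r (by simp at hr ⊢; omega)
    simp only [List.mem_cons, List.not_mem_nil, or_false, forall_eq_or_imp, forall_eq] at hI
    obtain ⟨i14, i15, i16, i17, i18, i19, i20⟩ := hI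
    refine hQ τ' ⟨h.frame.trans (hf.weaken (by decide) (by decide)), by rw [hM]; exact h.mem,
      ⟨by rw [i19, hM]; exact hC.nz, by rw [i14]; exact hC.le14, by rw [i15]; exact hC.le15,
        by rw [i16]; exact hC.le16, by rw [i17]; exact hC.le17,
        by rw [i14, i15, i16, i17, hM]; exact hC.count⟩,
      ⟨by rw [i14]; exact h.below.b14, by rw [i15]; exact h.below.b15,
        by rw [i16]; exact h.below.b16, by rw [i17]; exact h.below.b17⟩,
      Or.inr ⟨i20.trans h20, by simp only [rest, i14, i15, i16, i17, i18] at heq ⊢; exact heq,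
        fun _ => by rw [i14]; exact m14 (by omega), fun _ => by rw [i16]; exact m16 (by omega),
        fun _ => by rw [i15]; exact m15 le_rfl, fun _ => ?_⟩⟩
    rw [i17]
    intro hn
    simpa [Passes] using hno hn
  · intro τ' hf hM hpn hpass hp h20' hnz _ hdn
    rw [h15] at hpass
    have hI : ∀ r ∈ [14, 15, 16, 18], τ'.I r = τ.I r := by
      intro r hr
      exact hf.1 r (by simp at hr ⊢; omega)
    simp only [List.mem_cons, List.not_mem_nil, or_false, forall_eq_or_imp, forall_eq] at hI
    obtain ⟨i14, i15, i16, i18⟩ := hI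
    refine hQ τ' ⟨h.frame.trans (hf.weaken (by decide) (by decide)),
      fun a ha => (hM a ha).trans (h.mem a ha),
      ⟨hnz, by rw [i14]; exact hC.le14, by rw [i15]; exact hC.le15,
        by rw [i16]; exact hC.le16, by omega, ?_⟩,
      ⟨by rw [i14]; exact h.below.b14, by rw [i15]; exact h.below.b15,
        by rw [i16]; exact h.below.b16, ?_⟩,
      Or.inl ⟨h20', ?_⟩⟩
    · intro c hc
      have h1 := hdn rfl c hc
      have h2 := hC.count c hc
      rw [i14, i15, i16, hp, cnt_succ]
      omega
    · intro a ha
      rw [hp] at ha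
      rcases Nat.lt_succ_iff_lt_or_eq.1 ha with ha | rfl
      · exact h.below.b17 a ha
      · simpa [Passes] using hpass
    · rw [← heq]; simp only [rest, i14, i15, i16, i18, hp]; omega

/-- After a step in which no position was advanced, the number of positive counters tells whether
the annulus contains all colors. -/
theorem Mid.feasAt_iff (hL : Layout n k L Z mem col P) (hw : 0 ≤ w) (hws : w ≤ s)
    (h : Mid n k Z col P o x₀ s w b σ τ 4) (h20 : τ.I 20 = 0) :
    k ≤ τ.I 19 ↔
      FeasAt n k col (fun p => Z (2 * p + o)) (fun p => Z (2 * p + (1 - o))) x₀ s w b := by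
  rcases h.moved with ⟨h20', -⟩ | ⟨-, -, m14, m16, m15, m17⟩
  · omega
  have hC := h.counts
  have hsrt := hL.sorted (1 - o) (by omega)
  rw [feasAt_iff_good hL, hC.nz]
  have hkey : ∀ c < k, (0 < τ.M (n + c) ↔
      ∃ a < n, Good x₀ s w b (oth Z P o) (srt Z P (1 - o)) (clr col P o) c a) := by
    intro c hc
    refine counter_pos hw hws hC.le14 hC.le15 hC.le16 hC.le17 ?_ ?_ ?_ ?_ (hC.count c hc)
    · intro a ha
      refine ⟨h.below.b14 a, fun h' => ?_⟩
      by_contra hcon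
      have h1 := m14 (by omega) (by omega)
      have h2 := hsrt (τ.I 14) a (by omega) ha
      simp only [srt] at *
      linarith
    · intro a ha
      refine ⟨h.below.b15 a, fun h' => ?_⟩
      by_contra hcon
      have h1 := m15 (by omega) (by omega)
      have h2 := hsrt (τ.I 15) a (by omega) ha
      simp only [srt] at *
      linarith
    · intro a ha
      refine ⟨h.below.b16 a, fun h' => ?_⟩
      by_contra hcon
      have h1 := m16 (by omega) (by omega)
      have h2 := hsrt (τ.I 16) a (by omega) ha
      simp only [srt] at *
      linarith
    · intro a ha
      refine ⟨h.below.b17 a, fun h' => ?_⟩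
      by_contra hcon
      have h1 := m17 (by omega) (by omega)
      have h2 := hsrt (τ.I 17) a (by omega) ha
      simp only [srt] at *
      linarith
  have hcard : k ≤ nzc n k τ.M ↔ ∀ c < k, 0 < τ.M (n + c) := by
    unfold nzc
    constructor
    · intro hle c hc
      have : (Finset.range k).filter (fun c => 0 < τ.M (n + c)) = Finset.range k :=
        Finset.eq_of_subset_of_card_le (Finset.filter_subset _ _) (by simpa using hle)
      have h' := Finset.mem_range.2 hc
      rw [← this] at h'
      exact (Finset.mem_filter.1 h').2
    · intro hall
      rw [Finset.filter_true_of_mem fun c hc => hall c (Finset.mem_range.1 hc)]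
      simp
  rw [hcard]
  exact forall_congr' fun c => forall_congr' fun hc => hkey c hc

end Stages

end CSSA

namespace CSSA

variable {n k : ℕ} {L : Lim} {Z : ℕ → ℝ} {mem col : ℕ → ℕ} {P : ℕ → ℕ → ℕ} {o : ℕ}

/-- Feasibility in the orientation `o`. -/
def Feas (n k : ℕ) (Z : ℕ → ℝ) (col : ℕ → ℕ) (o : ℕ) (x₀ s w b : ℝ) : Prop :=
  FeasAt n k col (fun p => Z (2 * p + o)) (fun p => Z (2 * p + (1 - o))) x₀ s w b

theorem Counts.of_eq {x₀ s w : ℝ} {σ τ : Store} (h : Counts n k Z col P o x₀ s w σ)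
    (hI : ∀ r ∈ [14, 15, 16, 17, 19], τ.I r = σ.I r) (hM : τ.M = σ.M) :
    Counts n k Z col P o x₀ s w τ := by
  simp only [List.mem_cons, List.not_mem_nil, or_false, forall_eq_or_imp, forall_eq] at hI
  obtain ⟨i14, i15, i16, i17, i19⟩ := hI
  exact ⟨by rw [i19, hM]; exact h.nz, by rw [i14]; exact h.le14, by rw [i15]; exact h.le15,
    by rw [i16]; exact h.le16, by rw [i17]; exact h.le17,
    by rw [i14, i15, i16, i17, hM]; exact h.count⟩

theorem Below.of_eq {s w b b' : ℝ} {σ τ : Store} (h : Below Z P o s w b σ)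
    (hI : ∀ r ∈ [14, 15, 16, 17], τ.I r = σ.I r) (hb : b ≤ b') : Below Z P o s w b' τ := by
  simp only [List.mem_cons, List.not_mem_nil, or_false, forall_eq_or_imp, forall_eq] at hI
  obtain ⟨i14, i15, i16, i17⟩ := hI
  refine ⟨fun a ha => ?_, fun a ha => ?_, fun a ha => ?_, fun a ha => ?_⟩
  · linarith [h.b14 a (i14 ▸ ha)]
  · linarith [h.b15 a (i15 ▸ ha)]
  · linarith [h.b16 a (i16 ▸ ha)]
  · linarith [h.b17 a (i17 ▸ ha)]

theorem wp_sweepBody (hL : Layout n k L Z mem col P) (ho : o < 2) {ro : ℕ} (hro : ro = 5 ∨ ro = 7)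
    {x₀ s w b : ℝ} (hw : 0 ≤ w) (hws : w ≤ s) {σ : Store} {Q : Store → Prop}
    (hσ : Ctx n k Z mem o σ) (h5 : σ.R 5 = s) (h6 : σ.R 6 = x₀) (h7 : σ.R 7 = w)
    (h25 : σ.R 25 = x₀ + s) (h18 : σ.I 18 < n) (hb : b = srt Z P (1 - o) (σ.I 18) - σ.R ro)
    (hC : Counts n k Z col P o x₀ s w σ) (hB : Below Z P o s w b σ)
    (hQ : ∀ τ, Frame [4, 5, 14, 15, 16, 17, 18, 19, 20, 21, 24, 25] [14, 15, 17, 18, 19, 20, 26, 27]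
        σ τ → (∀ a < n, τ.M a = σ.M a) → Counts n k Z col P o x₀ s w τ → Below Z P o s w b τ →
        rest n τ < rest n σ →
        (τ.I 21 = 1 ∧ Feas n k Z col o x₀ s w (τ.R 20) ∨
          τ.I 21 = σ.I 21 ∧ τ.R 20 = σ.R 20 ∧
            (τ.I 18 = σ.I 18 ∨ τ.I 18 = σ.I 18 + 1 ∧ ¬ Feas n k Z col o x₀ s w b)) →
        (τ.I 18 = σ.I 18 ∨ τ.I 18 = σ.I 18 + 1) → Q τ) :
    wp L (sweepBody ro) Q σ := by
  have hWs := hL.words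
  have ro14 : ro ≠ 15 := by omega
  have ro17 : ro ≠ 17 := by omega
  unfold sweepBody
  simp only [wp_block_cons, wp_iset]
  refine ⟨Nat.zero_le _, wp_ldS hL (by decide) (by decide) (by decide) (e := 1 - o)
    ?_ hσ.mem_eq hσ.pts ?_ (by omega) ?_ ?_ fun v4 v5 => ?_⟩
  · simpa [Function.update_apply] using hσ.reg0
  · simpa [Function.update_apply] using h18
  · simpa [Function.update_apply] using hσ.reg9
  · simpa [Function.update_apply] using hσ.reg7
  simp only [wp_block_cons, wp_rsub, wp_radd, Function.update_apply, reduceIte, Nat.reduceEqDiff,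
    ro17, ← hb, h5, h7]
  set σ₁ : Store := ⟨_, _, _, _⟩
  have hf₁ : Frame [4, 5, 20] [15, 17, 19, 26, 27] σ σ₁ := by
    repeat refine Frame.updI ?_ (by decide)
    repeat refine Frame.updR ?_ (by decide)
    exact Frame.base hσ.pts
  have hσ₁ : Ctx n k Z mem o σ₁ := hσ.of_frame hf₁ (by decide) (by decide) (fun _ _ => rfl)
  have hI₁ : ∀ r ∈ [14, 15, 16, 17, 18, 19, 21], σ₁.I r = σ.I r := by
    intro r hr
    exact hf₁.1 r (by simp at hr ⊢; omega)
  have hC₁ : Counts n k Z col P o x₀ s w σ₁ :=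
    hC.of_eq (fun r hr => hI₁ r (by simp at hr ⊢; omega)) rfl
  have hB₁ : Below Z P o s w b σ₁ :=
    hB.of_eq (fun r hr => hI₁ r (by simp at hr ⊢; omega)) le_rfl
  have hF : Fixed x₀ s w b σ₁ := by
    refine ⟨(hf₁.2.1 6 (by decide)).trans h6, (hf₁.2.1 7 (by decide)).trans h7, ?_, ?_,
      (hf₁.2.1 25 (by decide)).trans h25, ?_, ?_⟩ <;>
    simp [σ₁]
  have hrest : rest n σ₁ = rest n σ := by
    simp only [List.mem_cons, List.not_mem_nil, or_false, forall_eq_or_imp, forall_eq] at hI₁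
    obtain ⟨i14, i15, i16, i17, i18, i19, i21⟩ := hI₁
    simp only [rest, i14, i15, i16, i17, i18]
  have hm0 : Mid n k Z col P o x₀ s w b σ₁ σ₁ 0 :=
    ⟨Frame.refl _ _ _, fun _ _ => rfl, hC₁, hB₁, Or.inr ⟨by simp [σ₁], rfl,
      by omega, by omega, by omega, by omega⟩⟩
  clear_value σ₁
  refine wp_stage14 hL ho hσ₁ hF hm0 fun τ₁ hm1 => ?_
  rw [wp_block_cons]
  refine wp_stage16 hL ho hσ₁ hF hm1 fun τ₂ hm2 => ?_
  rw [wp_block_cons]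
  refine wp_stage15 hL ho hσ₁ hF hw hws hm2 fun τ₃ hm3 => ?_
  rw [wp_block_cons]
  refine wp_stage17 hL ho hσ₁ hF hw hws hm3 fun τ hm => ?_
  have hτ := hm.ctx hσ₁
  have hf : Frame [4, 5, 14, 15, 16, 17, 18, 19, 20, 21, 24, 25] [14, 15, 17, 18, 19, 20, 26, 27]
      σ τ :=
    (hf₁.weaken (by decide) (by decide)).trans (hm.frame.weaken (by decide) (by decide))
  have hM : ∀ a < n, τ.M a = σ.M a := fun a ha => (hτ.mem_eq a ha).trans (hσ.mem_eq a ha).symm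
  have h18' : τ.I 18 = σ.I 18 := (hm.frame.1 18 (by decide)).trans (hI₁ 18 (by simp))
  have h21' : τ.I 21 = σ.I 21 := (hm.frame.1 21 (by decide)).trans (hI₁ 21 (by simp))
  have h20' : τ.R 20 = σ.R 20 := (hm.frame.2.1 20 (by decide)).trans (hf₁.2.1 20 (by decide))
  have h15' : τ.R 15 = b := (hm.frame.2.1 15 (by decide)).trans hF.r15
  simp only [wp_ite_int, wp_block_cons, wp_block_nil, wp_iset, wp_iadd, wp_radd, wp_skip,
    hτ.reg3, hτ.reg1, hτ.real9, h15', h18', add_zero, Function.update_apply, reduceIte,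
    Nat.reduceEqDiff]
  constructor
  · intro hlt
    have h20 : τ.I 20 = 0 := by omega
    have hiff := hm.feasAt_iff hL hw hws h20
    have hrest' : ∀ τ' : Store, (∀ r ∈ [14, 15, 16, 17], τ'.I r = τ.I r) →
        τ'.I 18 = σ.I 18 + 1 → rest n τ' < rest n σ := by
      intro τ' hI i18
      simp only [List.mem_cons, List.not_mem_nil, or_false, forall_eq_or_imp, forall_eq] at hI
      obtain ⟨i14, i15, i16, i17⟩ := hI
      have hr : rest n τ = rest n σ := by
        rcases hm.moved with ⟨h, -⟩ | ⟨-, h, -⟩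
        · omega
        · rw [h, hrest]
      rw [← hr]
      simp only [rest, i14, i15, i16, i17, i18, h18']
      omega
    refine ⟨fun hk => ⟨by omega, hQ _ ?_ hM ?_ ?_ ?_ ?_ ?_⟩,
      fun hk => ⟨by omega, by omega, hQ _ ?_ hM ?_ ?_ ?_ ?_ ?_⟩⟩
    · exact hf.trans (Frame.updI (Frame.base rfl) (by decide))
    · exact hm.counts.of_eq (by simp) rfl
    · exact hm.below.of_eq (by simp) le_rfl
    · exact hrest' _ (by simp) (by simp)
    · refine Or.inr ⟨by simp [h21'], h20', Or.inr ⟨by simp, fun h => ?_⟩⟩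
      have := hiff.2 h
      omega
    · exact Or.inr (by simp)
    · exact hf.trans (Frame.updI (Frame.updI (Frame.updR (Frame.base rfl) (by decide)) (by decide))
        (by decide))
    · exact hm.counts.of_eq (by simp) rfl
    · exact hm.below.of_eq (by simp) le_rfl
    · exact hrest' _ (by simp) (by simp)
    · refine Or.inl ⟨by simp, ?_⟩
      simpa [Feas] using hiff.1 (by omega)
    · exact Or.inr (by simp)
  · intro hlt
    refine hQ τ hf hM hm.counts hm.below ?_ (Or.inr ⟨h21', h20', Or.inl h18'⟩) (Or.inl h18')
    rcases hm.moved with ⟨-, h⟩ | ⟨h, -⟩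
    · omega
    · omega

theorem sweep_ok (hL : Layout n k L Z mem col P) (ho : o < 2) {ro : ℕ} (hro : ro = 5 ∨ ro = 7)
    {x₀ s w : ℝ} (hw : 0 ≤ w) (hws : w ≤ s) {σ : Store}
    (hσ : Ctx n k Z mem o σ) (h5 : σ.R 5 = s) (h6 : σ.R 6 = x₀) (h7 : σ.R 7 = w) :
    Ok L (sweep ro) σ (2000 * n + 10 * k + 100) (fun τ =>
      Frame [4, 5, 12, 14, 15, 16, 17, 18, 19, 20, 21, 24, 25]
        [14, 15, 17, 18, 19, 20, 25, 26, 27] σ τ ∧ (∀ a < n, τ.M a = σ.M a) ∧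
      (τ.I 21 = 1 ∧ Feas n k Z col o x₀ s w (τ.R 20) ∨
        τ.I 21 = σ.I 21 ∧ τ.R 20 = σ.R 20 ∧
          ∀ t < n, ¬ Feas n k Z col o x₀ s w (srt Z P (1 - o) t - σ.R ro))) := by
  have hWs := hL.words
  have hsI := hL.int_cells
  -- clearing the counters
  let InvC : Store → Prop := fun τ => Frame [4, 12] [] σ τ ∧ (∀ a < n, τ.M a = σ.M a) ∧
    τ.I 12 ≤ k ∧ ∀ c < τ.I 12, τ.M (n + c) = 0
  have hclear := Ok.loop (L := L) (c := .int 12 1)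
    (p := block [iadd 4 0 12, istore 4 2, iadd 12 12 3]) InvC (fun τ => 5 * (k - τ.I 12)) (by
    rintro τ ⟨hf, hM, hle, hz⟩ hc
    have hτ : Ctx n k Z mem o τ := hσ.of_frame hf (by decide) (by decide) hM
    have hc' : τ.I 12 < k := by simpa [Test.Holds, hτ.reg1] using hc
    refine ⟨3, Ok.of_wp (p := block [iadd 4 0 12, istore 4 2, iadd 12 12 3]) ?_⟩
    simp only [wp_block_cons, wp_block_nil, wp_iadd, wp_istore, hτ.reg0, hτ.reg2, hτ.reg3,
      Function.update_apply, reduceIte, Nat.reduceEqDiff]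
    refine ⟨by omega, by omega, by omega, ⟨hf.trans ?_, ?_, ?_, ?_⟩, ?_⟩
    · exact Frame.updI (Frame.updI (Frame.base rfl) (by decide)) (by decide)
    · intro a ha
      exact (Function.update_of_ne (by omega) _ _).trans (hM a ha)
    · simp; omega
    · intro c hc2
      simp at hc2
      simp only [Function.update_apply, Nat.add_right_inj]
      split_ifs with h
      · rfl
      · exact hz c (by omega)
    · simp; omega)
  -- the sweep
  let T : List ℕ := [4, 5, 12, 14, 15, 16, 17, 18, 19, 20, 21, 24, 25]
  let S : List ℕ := [14, 15, 17, 18, 19, 20, 25, 26, 27]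
  let InvS : Store → Prop := fun τ => Frame T S σ τ ∧ (∀ a < n, τ.M a = σ.M a) ∧
    τ.R 25 = x₀ + s ∧ Counts n k Z col P o x₀ s w τ ∧
    (τ.I 18 < n → Below Z P o s w (srt Z P (1 - o) (τ.I 18) - σ.R ro) τ) ∧
    (τ.I 21 = 1 ∧ Feas n k Z col o x₀ s w (τ.R 20) ∨ τ.I 21 = σ.I 21 ∧ τ.R 20 = σ.R 20 ∧
      ∀ t < τ.I 18, ¬ Feas n k Z col o x₀ s w (srt Z P (1 - o) t - σ.R ro))
  have hcost : (sweepBody ro).cost ≤ 300 := by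
    show _ ≤ _
    simp [sweepBody, block, Com.cost, stage, ldPt, mark, bump, ldS, iset, iadd, isub, imul, idiv,
      iload, istore, radd, rsub, rload]
  have hsweep := Ok.loop (L := L) (c := .int 18 0) (p := sweepBody ro) InvS
    (fun τ => 302 * rest n τ) (by
    rintro τ ⟨hf, hM, h25, hC, hB, hst⟩ hc
    have hτ : Ctx n k Z mem o τ := hσ.of_frame hf (by decide) (by decide) hM
    have hc' : τ.I 18 < n := by simpa [Test.Holds, hτ.reg0] using hc
    have hro' : τ.R ro = σ.R ro := hf.2.1 ro (by rcases hro with rfl | rfl <;> decide)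
    refine ⟨_, Ok.of_wp (wp_sweepBody hL ho hro hw hws hτ ((hf.2.1 5 (by decide)).trans h5)
      ((hf.2.1 6 (by decide)).trans h6) ((hf.2.1 7 (by decide)).trans h7) h25 hc' rfl hC
      (by rw [hro']; exact hB hc') ?_)⟩
    intro τ' hf' hM' hC' hB' hr hst' h18
    rw [hro'] at hB' hst'
    refine ⟨⟨hf.trans (hf'.weaken (by decide) (by decide)), fun a ha => (hM' a ha).trans (hM a ha),
      (hf'.2.1 25 (by decide)).trans h25, hC', fun hlt => ?_, ?_⟩, ?_⟩
    · refine hB'.of_eq (fun _ _ => rfl) ?_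
      have := hL.sorted (1 - o) (by omega) (τ.I 18) (τ'.I 18) (by omega) hlt
      simp only [srt]
      linarith
    · rcases hst' with h | ⟨h1, h2, h3⟩
      · exact Or.inl h
      · rw [h1, h2]
        rcases hst with h | ⟨h4, h5, h6⟩
        · exact Or.inl h
        · refine Or.inr ⟨h4, h5, ?_⟩
          rcases h3 with h3 | ⟨h3, h7⟩
          · rwa [h3]
          · rw [h3]
            intro t ht
            rcases Nat.lt_succ_iff_lt_or_eq.1 ht with ht | rfl
            · exact h6 t ht
            · exact h7
    · have : 302 * rest n τ' + 302 ≤ 302 * rest n τ := by omega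
      omega)
  unfold sweep
  refine Ok.mono (t := 1 + ((5 * k + 2) + (1 + (1 + (1 + (1 + (1 + (1 + (1 + ((302 * (5 * n) + 2) + 0))))))))))
    (Ok.cons (Ok.ins ?_ (Ok.cons ((hclear _ ?_).mono ?_ fun τ hτ => ?_)))) (by omega)
    (fun _ => id)
  · exact Nat.zero_le _
  · refine ⟨Frame.updI (Frame.base rfl) (by decide), fun _ _ => rfl, ?_, ?_⟩ <;> simp [Store.exec]
  · simp [Store.exec]
  · obtain ⟨⟨hf, hM, hle, hz⟩, hc⟩ := hτ
    have hcτ : Ctx n k Z mem o τ := hσ.of_frame hf (by decide) (by decide) hM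
    have hk : τ.I 12 = k := by
      have : ¬ τ.I 12 < τ.I 1 := hc
      rw [hcτ.reg1] at this
      omega
    rw [hk] at hz
    refine Ok.cons (Ok.ins trivial (Ok.cons (Ok.ins (Nat.zero_le _) (Ok.cons
      (Ok.ins (Nat.zero_le _) (Ok.cons (Ok.ins (Nat.zero_le _) (Ok.cons (Ok.ins (Nat.zero_le _)
      (Ok.cons (Ok.ins (Nat.zero_le _) (Ok.cons (Ok.ins (Nat.zero_le _)
      (Ok.cons ((hsweep _ ?_).mono ?_ fun τ' hτ' => Ok.nil ?_)))))))))))))))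
    · simp only [Store.exec]
      refine ⟨hf.weaken (by decide) (by decide) |>.trans ?_, hM, ?_, ⟨?_, ?_, ?_, ?_, ?_, ?_⟩,
        fun _ => ⟨?_, ?_, ?_, ?_⟩, Or.inr ⟨?_, ?_, ?_⟩⟩
      · repeat refine Frame.updI ?_ (by decide)
        exact Frame.updR (Frame.base rfl) (by decide)
      · simp [RealOp.eval, hf.2.1, h5, h6]
      · simp only [Function.update_self, nzc]
        rw [eq_comm, Finset.card_eq_zero, Finset.filter_eq_empty_iff]
        intro c hc
        rw [hz c (Finset.mem_range.1 hc)]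
        simp
      · simp
      · simp
      · simp
      · simp
      · intro c hc
        simp [cnt, hz c hc]
      · simp
      · simp
      · simp
      · simp
      · simp [hf.1]
      · simp [hf.2.1]
      · simp
    · simp only [rest, Store.exec]
      simp
      omega
    · obtain ⟨⟨hf', hM', _, _, _, hst⟩, hc'⟩ := hτ'
      have hcτ' : Ctx n k Z mem o τ' := hσ.of_frame hf' (by decide) (by decide) hM'
      refine ⟨hf', hM', hst.imp_right fun h => ⟨h.1, h.2.1, fun t ht => h.2.2 t ?_⟩⟩
      have : ¬ τ'.I 18 < τ'.I 0 := hc'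
      rw [hcτ'.reg0] at this
      omega

/-- Decide whether there is an annulus of width `R[7]` with outer square
`[R[6], R[6] + R[5]] × [b, b + R[5]]`. -/
def decision : Com := block [iset 21 0, sweep 5, sweep 7]

theorem decision_ok (hL : Layout n k L Z mem col P) (ho : o < 2)
    {x₀ s w : ℝ} (hw : 0 ≤ w) (hws : w ≤ s) {σ : Store}
    (hσ : Ctx n k Z mem o σ) (h5 : σ.R 5 = s) (h6 : σ.R 6 = x₀) (h7 : σ.R 7 = w) :
    Ok L decision σ (4000 * n + 20 * k + 201) (fun τ =>
      Frame [4, 5, 12, 14, 15, 16, 17, 18, 19, 20, 21, 24, 25]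
        [14, 15, 17, 18, 19, 20, 25, 26, 27] σ τ ∧ (∀ a < n, τ.M a = σ.M a) ∧
      (τ.I 21 = 1 ∧ Feas n k Z col o x₀ s w (τ.R 20) ∨
        τ.I 21 = 0 ∧ ∀ b, ¬ Feas n k Z col o x₀ s w b)) := by
  unfold decision
  refine Ok.mono (t := 1 + ((2000 * n + 10 * k + 100) + ((2000 * n + 10 * k + 100) + 0)))
    (Ok.cons (Ok.ins (Nat.zero_le _) (Ok.cons ((sweep_ok hL ho (Or.inl rfl) hw hws
      (σ := σ.exec (.intConst 21 0)) ?_ h5 h6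
      h7).mono le_rfl fun τ hτ => Ok.cons ?_)))) (by omega) (fun _ => id)
  · exact hσ.of_frame (li := [21]) (lr := []) (Frame.updI (Frame.base rfl) (by decide)) (by decide)
      (by decide) (fun _ _ => rfl)
  obtain ⟨hf, hM, hst⟩ := hτ
  have hf0 : Frame [4, 5, 12, 14, 15, 16, 17, 18, 19, 20, 21, 24, 25]
        [14, 15, 17, 18, 19, 20, 25, 26, 27] σ τ :=
    Frame.trans (σ' := σ.exec (.intConst 21 0)) (Frame.updI (Frame.base rfl) (by decide)) hf
  have hτ : Ctx n k Z mem o τ := hσ.of_frame hf0 (by decide) (by decide) hM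
  refine (sweep_ok hL ho (Or.inr rfl) hw hws hτ ((hf0.2.1 5 (by decide)).trans h5)
    ((hf0.2.1 6 (by decide)).trans h6) ((hf0.2.1 7 (by decide)).trans h7)).mono le_rfl
    fun τ' hτ' => Ok.nil ?_
  obtain ⟨hf', hM', hst'⟩ := hτ'
  refine ⟨hf0.trans hf', fun a ha => (hM' a ha).trans (hM a ha), ?_⟩
  rcases hst' with h | ⟨h1, h2, h3⟩
  · exact Or.inl h
  rw [h1, h2]
  rcases hst with h | ⟨h4, h5', h6'⟩
  · exact Or.inl h
  refine Or.inr ⟨by simpa [Store.exec] using h4, fun b hb => ?_⟩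
  obtain ⟨q, hq, hq'⟩ := FeasAt.exists_start hb hL.one_le_k hws
  obtain ⟨t, ht, rfl⟩ := hL.surj q hq (1 - o) (by omega)
  rcases hq' with hq' | hq'
  · refine h6' t ht ?_
    rw [show (σ.exec (.intConst 21 0)).R 5 = s from h5]
    exact hq'
  · refine h3 t ht ?_
    rw [show τ.R 7 = w from (hf0.2.1 7 (by decide)).trans h7]
    exact hq'

end CSSA

namespace CSSA

variable {n k : ℕ} {L : Lim} {Z : ℕ → ℝ} {mem col : ℕ → ℕ} {P : ℕ → ℕ → ℕ} {o : ℕ}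

/-! ## The search over all side lengths -/

open Classical in
/-- Number of pairs of positions with a given property. -/
noncomputable def pairs (n : ℕ) (p : ℕ → ℕ → Prop) : ℕ :=
  ((Finset.range n ×ˢ Finset.range n).filter fun q : ℕ × ℕ => p q.1 q.2).card

theorem pairs_le (p : ℕ → ℕ → Prop) : pairs n p ≤ n * n := by
  classical
  unfold pairs
  exact (Finset.card_filter_le _ _).trans (by simp)

theorem pairs_mono {p q : ℕ → ℕ → Prop} (h : ∀ a < n, ∀ b < n, p a b → q a b) :
    pairs n p ≤ pairs n q := by
  classical
  unfold pairs
  refine Finset.card_le_card fun x hx => ?_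
  simp only [Finset.mem_filter, Finset.mem_product, Finset.mem_range] at hx ⊢
  exact ⟨hx.1, h _ hx.1.1 _ hx.1.2 hx.2⟩

theorem pairs_lt {p q : ℕ → ℕ → Prop} (h : ∀ a < n, ∀ b < n, p a b → q a b) {a b : ℕ} (ha : a < n)
    (hb : b < n) (hq : q a b) (hp : ¬ p a b) : pairs n p < pairs n q := by
  classical
  unfold pairs
  refine Finset.card_lt_card (Finset.ssubset_iff_of_subset ?_ |>.2 ⟨(a, b), ?_, ?_⟩)
  · intro x hx
    simp only [Finset.mem_filter, Finset.mem_product, Finset.mem_range] at hx ⊢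
    exact ⟨hx.1, h _ hx.1.1 _ hx.1.2 hx.2⟩
  · simp [ha, hb, hq]
  · simp [hp]

/-- The number of candidates below `w`. -/
noncomputable def below (n : ℕ) (x y : ℕ → ℝ) (s w : ℝ) : ℕ :=
  pairs n (fun a b => cval x 0 1 a b < w) + pairs n (fun a b => cval y 0 1 a b < w) +
    pairs n (fun a b => cval y s (1 / 2) a b < w)

theorem below_le (x y : ℕ → ℝ) (s w : ℝ) : below n x y s w ≤ 3 * (n * n) := by
  unfold below
  have h1 := pairs_le (n := n) (fun a b => cval x 0 1 a b < w)
  have h2 := pairs_le (n := n) (fun a b => cval y 0 1 a b < w)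
  have h3 := pairs_le (n := n) (fun a b => cval y s (1 / 2) a b < w)
  omega

theorem below_mono_left {x y : ℕ → ℝ} {s s' w : ℝ} (h : s ≤ s') :
    below n x y s' w ≤ below n x y s w := by
  unfold below
  refine Nat.add_le_add_left (pairs_mono fun a _ b _ hlt => lt_of_le_of_lt ?_ hlt) _
  simp only [cval]
  linarith

theorem below_lt {x y : ℕ → ℝ} {s w w' m : ℝ} (hw' : w' ≤ m) (hm : m < w)
    (h : (∃ a < n, ∃ b < n, cval x 0 1 a b = m) ∨ (∃ a < n, ∃ b < n, cval y 0 1 a b = m) ∨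
      ∃ a < n, ∃ b < n, cval y s (1 / 2) a b = m) : below n x y s w' < below n x y s w := by
  have hmono : ∀ (z : ℕ → ℝ) (A h : ℝ), pairs n (fun a b => cval z A h a b < w') ≤
      pairs n (fun a b => cval z A h a b < w) := fun z A h =>
    pairs_mono fun a _ b _ hlt => hlt.trans_le (hw'.trans hm.le)
  have hlt : ∀ (z : ℕ → ℝ) (A h : ℝ), (∃ a < n, ∃ b < n, cval z A h a b = m) →
      pairs n (fun a b => cval z A h a b < w') < pairs n (fun a b => cval z A h a b < w) := by
    rintro z A h ⟨a, ha, b, hb, hab⟩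
    refine pairs_lt (fun a _ b _ hlt => hlt.trans_le (hw'.trans hm.le)) ha hb ?_ ?_
    · simpa [hab] using hm
    · simpa [hab] using hw'
  unfold below
  have h1 := hmono x 0 1
  have h2 := hmono y 0 1
  have h3 := hmono y s (1 / 2)
  rcases h with h | h | h
  · have := hlt _ _ _ h; omega
  · have := hlt _ _ _ h; omega
  · have := hlt _ _ _ h; omega

/-- The stored annulus has width `R[4]`, unless this is still the initial bound `w₀`. -/
def Record (n k : ℕ) (Z : ℕ → ℝ) (col : ℕ → ℕ) (w₀ : ℝ) (τ : Store) : Prop :=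
  τ.R 4 = w₀ ∨ τ.I 23 < 2 ∧ 0 ≤ τ.R 4 ∧ τ.R 4 ≤ τ.R 22 / 2 ∧
    Feas n k Z col (τ.I 23) (τ.R 21) (τ.R 22) (τ.R 4) (τ.R 23)

/-- Look for a better annulus whose outer square is `[R[6], R[6] + R[5]] × [b, b + R[5]]`. -/
def trial : Com :=
  block [radd 7 8 9, cand 8 6 9 10 4, cand 9 7 9 10 4, cand 9 7 5 11 4,
    rmul 14 5 11, .ite (.real 14 7) (radd 7 14 9) .skip,
    .ite (.real 7 9) (iadd 10 10 3)
      (block [decision, .ite (.int 2 21)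
        (block [radd 4 7 9, iadd 23 6 2, radd 21 6 9, radd 22 5 9, radd 23 20 9])
        (iadd 10 10 3)])]

theorem IsMaxBelow.trans_le {z : ℕ → ℝ} {A h w m₀ m m' : ℝ} (hm : IsMaxBelow n z A h w m₀ m)
    (hle : m ≤ m') {a b : ℕ} (ha : a < n) (hb : b < n) (hlt : cval z A h a b < w) :
    cval z A h a b ≤ m' :=
  (hm.2.2 a ha b hb hlt).trans hle

theorem trial_ok (hL : Layout n k L Z mem col P) (ho : o < 2) (hkn : k ≤ n) {w₀ : ℝ} (hw₀ : 0 < w₀)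
    {σ : Store} (hσ : Ctx n k Z mem o σ) (h8 : σ.R 8 = -w₀) {i j : ℕ} (hi : i < n) (hj : j < n)
    (h6 : σ.R 6 = srt Z P o i) (h5 : σ.R 5 = srt Z P o j - srt Z P o i) (h10 : σ.I 10 < n) :
    Ok L trial σ (5000 * n) (fun τ => Ctx n k Z mem o τ ∧ τ.R 8 = -w₀ ∧ τ.R 5 = σ.R 5 ∧
      τ.I 11 = σ.I 11 ∧ τ.I 22 = σ.I 22 ∧
      ((τ.I 10 = σ.I 10 + 1 ∧ τ.R 4 = σ.R 4 ∧ (Record n k Z col w₀ σ → Record n k Z col w₀ τ) ∧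
          ∀ w b, w ≤ σ.R 5 / 2 → Feas n k Z col o (σ.R 6) (σ.R 5) w b → σ.R 4 ≤ w) ∨
        (τ.I 10 = σ.I 10 ∧ τ.R 4 ≤ σ.R 4 ∧ Record n k Z col w₀ τ ∧
          below n (srt Z P o) (srt Z P (1 - o)) (σ.R 5) (τ.R 4) <
            below n (srt Z P o) (srt Z P (1 - o)) (σ.R 5) (σ.R 4)))) := by
  have hn := hL.one_le_n
  have hWs := hL.words
  set x := srt Z P o with hx
  set y := srt Z P (1 - o) with hy
  set s := σ.R 5 with hs
  set w := σ.R 4 with hw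
  unfold trial
  refine Ok.mono (t := 1 + ((100 * n + 10) + ((100 * n + 10) + ((100 * n + 10) + (1 + ((2 + 1) +
    ((2 + ((4000 * n + 20 * k + 201) + (9 + 0))) + 0))))))) ?_ (by omega) (fun _ => id)
  refine Ok.cons (Ok.ins trivial ?_)
  set σ₁ := σ.exec (.realArith .add 7 8 9)
  have hf₁ : Frame [4, 5, 12, 13] [7, 12, 13, 14] σ σ₁ := Frame.updR (Frame.base rfl) (by decide)
  have hc₁ : Ctx n k Z mem o σ₁ := hσ.of_frame hf₁ (by decide) (by decide) (fun _ _ => rfl)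
  have h7₁ : σ₁.R 7 = -w₀ := by simp [σ₁, Store.exec, RealOp.eval, h8, hσ.real9]
  clear_value σ₁
  refine Ok.cons ((cand_ok hL hc₁ (e := o) ho (Or.inl ⟨rfl, rfl, rfl⟩) (by decide) (by decide)
    (by decide) (by rw [hc₁.real10]; norm_num)).mono le_rfl ?_)
  rintro σ₂ ⟨hf₂', hM₂, hm₁⟩
  have hf₂ := hf₁.trans hf₂'
  have hc₂ : Ctx n k Z mem o σ₂ := hc₁.of_frame hf₂' (by decide) (by decide) (fun a _ => by rw [hM₂])
  refine Ok.cons ((cand_ok hL hc₂ (e := 1 - o) (by omega) (Or.inr ⟨rfl, rfl, rfl⟩) (by decide)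
    (by decide) (by decide) (by rw [hc₂.real10]; norm_num)).mono le_rfl ?_)
  rintro σ₃ ⟨hf₃', hM₃, hm₂⟩
  have hf₃ := hf₂.trans hf₃'
  have hc₃ : Ctx n k Z mem o σ₃ := hc₂.of_frame hf₃' (by decide) (by decide) (fun a _ => by rw [hM₃])
  refine Ok.cons ((cand_ok hL hc₃ (e := 1 - o) (by omega) (Or.inr ⟨rfl, rfl, rfl⟩) (by decide)
    (by decide) (by decide) (by rw [hc₃.real11]; norm_num)).mono le_rfl ?_)
  rintro σ₄ ⟨hf₄', hM₄, hm₃⟩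
  have hf₄ := hf₃.trans hf₄'
  have hc₄ : Ctx n k Z mem o σ₄ := hc₃.of_frame hf₄' (by decide) (by decide) (fun a _ => by rw [hM₄])
  rw [hc₁.real9, hc₁.real10, hf₁.2.1 4 (by decide), h7₁, ← hx, ← hw] at hm₁
  rw [hc₂.real9, hc₂.real10, hf₂.2.1 4 (by decide), ← hy, ← hw] at hm₂
  rw [hc₃.real11, hf₃.2.1 4 (by decide), hf₃.2.1 5 (by decide), ← hy, ← hw, ← hs] at hm₃
  generalize σ₂.R 7 = m₁ at *
  generalize σ₃.R 7 = m₂ at *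
  obtain ⟨m, hm⟩ : ∃ m, σ₄.R 7 = m := ⟨_, rfl⟩
  rw [hm] at hm₃
  -- every candidate is at most `m`
  have hall : ∀ v, IsCand n (fun p => Z (2 * p + o)) (fun p => Z (2 * p + (1 - o))) s v → v < w →
      v ≤ m := by
    rintro v ⟨p, hp, q, hq, hv⟩ hvw
    obtain ⟨a, ha, rfl⟩ := hL.surj p hp o ho
    obtain ⟨b, hb, rfl⟩ := hL.surj q hq o ho
    obtain ⟨a', ha', haa⟩ := hL.surj (P o a) hp (1 - o) (by omega)
    obtain ⟨b', hb', hbb⟩ := hL.surj (P o b) hq (1 - o) (by omega)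
    rcases hv with hv | hv | hv
    · have hv' : v = cval x 0 1 b a := by rw [hv, cval, hx]; simp only [srt]; ring
      rw [hv'] at hvw ⊢
      exact hm₁.trans_le (hm₂.1.trans hm₃.1) hb ha hvw
    · have hv' : v = cval y 0 1 b' a' := by
        rw [hv, cval, hy]; simp only [srt, haa, hbb]; ring
      rw [hv'] at hvw ⊢
      exact hm₂.trans_le hm₃.1 hb' ha' hvw
    · have hv' : v = cval y s (1 / 2) a' b' := by
        rw [hv, cval, hy]; simp only [srt, haa, hbb]; ring
      rw [hv'] at hvw ⊢
      exact hm₃.trans_le le_rfl ha' hb' hvw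
  have hmin : m = -w₀ ∨ m < w ∧ ((∃ a < n, ∃ b < n, cval x 0 1 a b = m) ∨
      (∃ a < n, ∃ b < n, cval y 0 1 a b = m) ∨ ∃ a < n, ∃ b < n, cval y s (1 / 2) a b = m) := by
    rcases hm₃.2.1 with h | ⟨a, ha, b, hb, hab, hlt⟩
    · rw [h]
      rcases hm₂.2.1 with h | ⟨a, ha, b, hb, hab, hlt⟩
      · rw [h]
        rcases hm₁.2.1 with h | ⟨a, ha, b, hb, hab, hlt⟩
        · exact Or.inl h
        · exact Or.inr ⟨hlt, Or.inl ⟨a, ha, b, hb, hab⟩⟩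
      · exact Or.inr ⟨hlt, Or.inr (Or.inl ⟨a, ha, b, hb, hab⟩)⟩
    · exact Or.inr ⟨hlt, Or.inr (Or.inr ⟨a, ha, b, hb, hab⟩)⟩
  -- an infeasible clamped candidate excludes everything below `w`
  have hexcl : (∀ b, ¬ (0 ≤ min m (s / 2) ∧ Feas n k Z col o (σ.R 6) s (min m (s / 2)) b)) →
      ∀ v b, v ≤ s / 2 → Feas n k Z col o (σ.R 6) s v b → w ≤ v := by
    intro hno v b hv hfe
    by_contra hcon
    push Not at hcon
    obtain ⟨u, huv, hu, b', hb'⟩ := FeasAt.exists_cand hfe hL.one_le_k (hL.lt i hi o ho)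
      (hL.lt j hj o ho) (by rw [h6, hx]; rfl) (by rw [h6, h5, hx]; simp [srt])
    have hum := hall u hu (lt_of_le_of_lt huv hcon)
    have hu2 : u ≤ min m (s / 2) := le_min hum (huv.trans hv)
    have hfe' := FeasAt.mono hb' hu2
    exact hno b' ⟨FeasAt.nonneg hfe' hL.one_le_k, hfe'⟩
  have r5 : σ₄.R 5 = s := hf₄.2.1 5 (by decide)
  refine Ok.cons (Ok.ins trivial ?_)
  set σ₅ := σ₄.exec (.realArith .mul 14 5 11)
  have hf₅ : Frame [4, 5, 12, 13] [7, 12, 13, 14] σ σ₅ :=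
    hf₄.trans (Frame.updR (Frame.base rfl) (by decide))
  have hc₅ : Ctx n k Z mem o σ₅ := hσ.of_frame hf₅ (by decide) (by decide) (fun a ha =>
    (hc₄.mem_eq a ha).trans (hσ.mem_eq a ha).symm)
  have h14 : σ₅.R 14 = s / 2 := by
    simp [σ₅, Store.exec, RealOp.eval, r5, hc₄.real11]; ring
  have h7₅ : σ₅.R 7 = m := by simp [σ₅, Store.exec, hm]
  clear_value σ₅
  refine Ok.cons ((Ok.of_wp (Q := fun τ => Frame [4, 5, 12, 13] [7, 12, 13, 14] σ τ ∧
    τ.M = σ₅.M ∧ τ.R 7 = min m (s / 2)) ?_).mono (by decide) ?_)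
  · simp only [wp_ite_real, wp_radd, wp_skip, h14, h7₅, hc₅.real9, add_zero]
    refine ⟨fun h => ⟨hf₅.trans (Frame.updR (Frame.base rfl) (by decide)), trivial, ?_⟩, fun h => ⟨hf₅, trivial, ?_⟩⟩
    · simp [min_eq_right h.le]
    · rw [min_eq_left (not_lt.1 h)]
  rintro σ₆ ⟨hf₆, hM₆, h7₆⟩
  have hc₆ : Ctx n k Z mem o σ₆ := hσ.of_frame hf₆ (by decide) (by decide) (fun a ha => by
    rw [hM₆]; exact (hc₅.mem_eq a ha).trans (hσ.mem_eq a ha).symm)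
  have hfail : ∀ τ : Store, Frame [4, 5, 10, 12, 13, 14, 15, 16, 17, 18, 19, 20, 21, 24, 25]
      [7, 12, 13, 14, 15, 17, 18, 19, 20, 25, 26, 27] σ τ → (∀ a < n, τ.M a = σ.M a) →
      τ.I 10 = σ.I 10 + 1 →
      (∀ b, ¬ (0 ≤ min m (s / 2) ∧ Feas n k Z col o (σ.R 6) s (min m (s / 2)) b)) →
      (Ctx n k Z mem o τ ∧ τ.R 8 = -w₀ ∧ τ.R 5 = s ∧ τ.I 11 = σ.I 11 ∧ τ.I 22 = σ.I 22 ∧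
      ((τ.I 10 = σ.I 10 + 1 ∧ τ.R 4 = w ∧ (Record n k Z col w₀ σ → Record n k Z col w₀ τ) ∧
          ∀ v b, v ≤ s / 2 → Feas n k Z col o (σ.R 6) s v b → w ≤ v) ∨
        (τ.I 10 = σ.I 10 ∧ τ.R 4 ≤ w ∧ Record n k Z col w₀ τ ∧
          below n x y s (τ.R 4) < below n x y s w))) := by
    intro τ hf hM h10 hno
    refine ⟨hσ.of_frame hf (by decide) (by decide) hM, (hf.2.1 8 (by decide)).trans h8,
      hf.2.1 5 (by decide), hf.1 11 (by decide), hf.1 22 (by decide),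
      Or.inl ⟨h10, hf.2.1 4 (by decide), fun hr => ?_, hexcl hno⟩⟩
    unfold Record
    rw [hf.2.1 4 (by decide), hf.2.1 21 (by decide), hf.2.1 22 (by decide), hf.2.1 23 (by decide),
      hf.1 23 (by decide)]
    exact hr
  have hM₆' : ∀ a < n, σ₆.M a = σ.M a := fun a ha => (hc₆.mem_eq a ha).trans (hσ.mem_eq a ha).symm
  refine Ok.cons ((Ok.ite (t := (4000 * n + 20 * k + 201) + (9 + 0)) (fun h => ?_)
    (fun h => ?_)).mono le_rfl fun _ => Ok.nil)
  · have h' : min m (s / 2) < 0 := by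
      rw [← h7₆, ← hc₆.real9]; exact h
    refine (Ok.ins (Q := _) ?_ ?_).mono (by omega) (fun _ => id)
    · simp only [Store.Guard, hc₆.reg3, hf₆.1 10 (by decide)]; omega
    · refine hfail _ ?_ hM₆' ?_ fun b hb => by linarith [hb.1]
      · exact (hf₆.weaken (by decide) (by decide)).trans (Frame.updI (Frame.base rfl) (by decide))
      · simp [Store.exec, IntOp.eval, hc₆.reg3, hf₆.1 10]
  · have h' : 0 ≤ min m (s / 2) := by
      rw [← h7₆, ← hc₆.real9]; exact not_lt.1 h
    have hs0 : 0 ≤ s := by linarith [h'.trans (min_le_right m (s / 2))]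
    have hle : min m (s / 2) ≤ s := (min_le_right m (s / 2)).trans (by linarith)
    refine Ok.cons ((decision_ok hL ho h' hle hc₆ (hf₆.2.1 5 (by decide))
      (hf₆.2.1 6 (by decide)) h7₆).mono le_rfl ?_)
    rintro σ₇ ⟨hf₇', hM₇, hst⟩
    have hf₇ : Frame [4, 5, 12, 13, 14, 15, 16, 17, 18, 19, 20, 21, 24, 25]
        [7, 12, 13, 14, 15, 17, 18, 19, 20, 25, 26, 27] σ σ₇ :=
      (hf₆.weaken (by decide) (by decide)).trans (hf₇'.weaken (by decide) (by decide))
    have hM₇' : ∀ a < n, σ₇.M a = σ.M a := fun a ha => (hM₇ a ha).trans (hM₆' a ha)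
    have hc₇ : Ctx n k Z mem o σ₇ := hσ.of_frame hf₇ (by decide) (by decide) hM₇'
    have h7₇ : σ₇.R 7 = min m (s / 2) := (hf₇'.2.1 7 (by decide)).trans h7₆
    refine Ok.cons ((Ok.of_wp ?_).mono (by decide) fun τ hτ => Ok.nil hτ)
    simp only [wp_ite_int, wp_block_cons, wp_block_nil, wp_radd, wp_iadd, hc₇.reg2, hc₇.reg3,
      hc₇.reg6, hc₇.real9, Function.update_apply, reduceIte, Nat.reduceEqDiff, h7₇, add_zero]
    refine ⟨fun hfo => ⟨by omega, ?_⟩, fun hfo => ⟨?_, ?_⟩⟩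
    · rcases hst with ⟨-, hfe⟩ | ⟨h0, -⟩
      swap
      · omega
      rw [← h7₇]
      set τ : Store := ⟨_, _, _, _⟩
      have hfτ : Frame [4, 5, 12, 13, 14, 15, 16, 17, 18, 19, 20, 21, 23, 24, 25]
          [4, 7, 12, 13, 14, 15, 17, 18, 19, 20, 21, 22, 23, 25, 26, 27] σ τ := by
        refine (hf₇.weaken (by decide) (by decide)).trans ?_
        repeat refine Frame.updI ?_ (by decide)
        repeat refine Frame.updR ?_ (by decide)
        exact Frame.base rfl
      have e4 : τ.R 4 = min m (s / 2) := by simp [τ, h7₇]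
      have e23 : τ.I 23 = o := by simp [τ]
      have e21 : τ.R 21 = σ.R 6 := by simp [τ, hf₇.2.1]
      have e22 : τ.R 22 = s := by simp [τ, hf₇.2.1, hs]
      have e24 : τ.R 23 = σ₇.R 20 := by simp [τ]
      refine ⟨hσ.of_frame hfτ (by decide) (by decide) hM₇', (hfτ.2.1 8 (by decide)).trans h8,
        hfτ.2.1 5 (by decide), hfτ.1 11 (by decide), hfτ.1 22 (by decide),
        Or.inr ⟨hfτ.1 10 (by decide), ?_, ?_, ?_⟩⟩
      · rw [h7₇]
        rcases hmin with h1 | ⟨h1, -⟩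
        · linarith [h'.trans (min_le_left m (s / 2))]
        · exact (min_le_left _ _).trans h1.le
      · refine Or.inr ⟨by omega, by rw [e4]; exact h', by rw [e4, e22]; exact min_le_right _ _, ?_⟩
        rw [e4, e23, e21, e22, e24]
        exact hfe
      · rw [h7₇]
        rcases hmin with h1 | ⟨h1, h2⟩
        · linarith [h'.trans (min_le_left m (s / 2))]
        · exact below_lt (min_le_left _ _) h1 h2
    · rw [hf₇.1 10 (by decide)]; omega
    · have hgoal := hfail ⟨Function.update σ₇.I 10 (σ₇.I 10 + 1), σ₇.R, σ₇.M, σ₇.Z⟩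
        ?_ hM₇' ?_ fun b hb => ?_
      · simpa only [Function.update_apply, reduceIte, Nat.reduceEqDiff] using hgoal
      · exact (hf₇.weaken (by decide) (by decide)).trans (Frame.updI (Frame.base rfl) (by decide))
      · simp [hf₇.1 10]
      · rcases hst with ⟨h1, -⟩ | ⟨-, hfe⟩
        · omega
        · exact hfe b hb.2

end CSSA

namespace CSSA

variable {n k : ℕ} {L : Lim} {Z : ℕ → ℝ} {mem col : ℕ → ℕ} {P : ℕ → ℕ → ℕ} {o : ℕ}

/-- One step of the search: move one of the two positions, try a pair of points, or go to the next
side length. -/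
def passBody : Com :=
  .ite (.int 10 0)
    (block [ldS 10 8 6 6, .ite (.int 11 0)
      (block [ldS 11 8 6 14, rsub 14 14 6, .ite (.real 14 5) (iadd 11 11 3)
        (.ite (.real 5 14) (iadd 10 10 3) trial)])
      (iadd 10 10 3)])
    (block [rsub 24 9 5, radd 7 8 9, cand 8 6 9 10 24,
      .ite (.real 8 7) (block [rsub 5 9 7, iset 10 0, iset 11 0]) (iset 22 1)])

/-- Search all outer squares with points on both sides in the current orientation. -/
def pass : Com :=
  block [rset 5 (-1), iadd 10 0 2, iset 11 0, iset 22 0, .loop (.int 22 3) passBody]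

/-- No annulus whose outer square is bounded by the points at positions `a` and `b` has a width
below `w`. -/
def PairDone (n k : ℕ) (Z : ℕ → ℝ) (col : ℕ → ℕ) (P : ℕ → ℕ → ℕ) (o : ℕ) (w : ℝ) (a b : ℕ) : Prop :=
  ∀ v β, v ≤ (srt Z P o b - srt Z P o a) / 2 →
    Feas n k Z col o (srt Z P o a) (srt Z P o b - srt Z P o a) v β → w ≤ v

theorem PairDone.mono {w w' : ℝ} {a b : ℕ} (h : PairDone n k Z col P o w a b) (hw : w' ≤ w) :
    PairDone n k Z col P o w' a b :=
  fun v β hv hf => hw.trans (h v β hv hf)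

theorem pairDone_of_neg (hk : 1 ≤ k) {w : ℝ} {a b : ℕ} (h : srt Z P o b - srt Z P o a < 0) :
    PairDone n k Z col P o w a b := by
  intro v β hv hf
  have := FeasAt.nonneg hf hk
  linarith

/-- The invariant of the search. -/
structure PassInv (n k : ℕ) (Z : ℕ → ℝ) (mem col : ℕ → ℕ) (P : ℕ → ℕ → ℕ) (o : ℕ) (w₀ w : ℝ)
    (τ : Store) : Prop where
  ctx : Ctx n k Z mem o τ
  bound : τ.R 8 = -w₀
  record : Record n k Z col w₀ τ
  le : τ.R 4 ≤ w
  le10 : τ.I 10 ≤ n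
  le11 : τ.I 11 ≤ n
  le22 : τ.I 22 ≤ 1
  before : τ.I 10 < n → ∀ a < τ.I 11, srt Z P o a - srt Z P o (τ.I 10) < τ.R 5
  smaller : ∀ a < n, ∀ b < n, srt Z P o b - srt Z P o a < τ.R 5 → PairDone n k Z col P o (τ.R 4) a b
  equal : ∀ a < τ.I 10, a < n → ∀ b < n, srt Z P o b - srt Z P o a = τ.R 5 →
    PairDone n k Z col P o (τ.R 4) a b
  all : τ.I 22 = 1 → ∀ a < n, ∀ b < n, PairDone n k Z col P o (τ.R 4) a b

/-- The pairs that still have to be considered, with weights. -/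
noncomputable def work (n : ℕ) (x y : ℕ → ℝ) (s w : ℝ) (i : ℕ) : ℕ :=
  pairs n (fun a b => s < x b - x a ∨ x b - x a = s ∧ i ≤ a) +
    pairs n (fun a b => s < x b - x a) + below n x y s w

/-- The potential of the search. -/
noncomputable def passPot (n : ℕ) (x y : ℕ → ℝ) (τ : Store) : ℕ :=
  6000 * n * (work n x y (τ.R 5) (τ.R 4) (τ.I 10) + (1 - τ.I 22)) +
    80 * ((n - τ.I 10) + (n - τ.I 11))

theorem work_le (x y : ℕ → ℝ) (s w : ℝ) (i : ℕ) : work n x y s w i ≤ 5 * (n * n) := by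
  unfold work
  have h1 := pairs_le (n := n) (fun a b => s < x b - x a ∨ x b - x a = s ∧ i ≤ a)
  have h2 := pairs_le (n := n) (fun a b => s < x b - x a)
  have h3 := below_le (n := n) x y s w
  omega

theorem work_anti {x y : ℕ → ℝ} {s w : ℝ} {i j : ℕ} (h : i ≤ j) :
    work n x y s w j ≤ work n x y s w i := by
  unfold work
  have := pairs_mono (n := n) (p := fun a b => s < x b - x a ∨ x b - x a = s ∧ j ≤ a)
    (q := fun a b => s < x b - x a ∨ x b - x a = s ∧ i ≤ a)
    fun a _ b _ h' => h'.imp_right fun h' => ⟨h'.1, h.trans h'.2⟩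
  omega

theorem work_succ_lt {x y : ℕ → ℝ} {s w : ℝ} {i j : ℕ} (hi : i < n) (hj : j < n)
    (h : x j - x i = s) : work n x y s w (i + 1) < work n x y s w i := by
  unfold work
  have := pairs_lt (n := n) (p := fun a b => s < x b - x a ∨ x b - x a = s ∧ i + 1 ≤ a)
    (q := fun a b => s < x b - x a ∨ x b - x a = s ∧ i ≤ a)
    (fun a _ b _ h' => h'.imp_right fun h' => ⟨h'.1, by omega⟩) hi hj (Or.inr ⟨h, le_rfl⟩)
    (by simp [h])
  omega

theorem work_next_lt {x y : ℕ → ℝ} {s s' w : ℝ} {i a b : ℕ} (ha : a < n) (hb : b < n)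
    (hab : x b - x a = s') (h : s < s') : work n x y s' w 0 < work n x y s w i := by
  unfold work
  have h1 := pairs_mono (n := n) (p := fun a b => s' < x b - x a ∨ x b - x a = s' ∧ 0 ≤ a)
    (q := fun a b => s < x b - x a ∨ x b - x a = s ∧ i ≤ a)
    fun a _ b _ h' => Or.inl (by rcases h' with h' | h' <;> linarith)
  have h2 := pairs_lt (n := n) (p := fun a b => s' < x b - x a) (q := fun a b => s < x b - x a)
    (fun a _ b _ h' => by linarith) ha hb (by linarith) (by simp [hab])
  have h3 := below_mono_left (n := n) (x := x) (y := y) (w := w) h.le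
  omega

theorem potential_drop {N A B p q t : ℕ} (hA : B + 1 ≤ A) (h : t + 2 + 80 * q ≤ N + 80 * p) :
    t + 2 + (N * B + 80 * q) ≤ N * A + 80 * p := by
  have : N * (B + 1) ≤ N * A := Nat.mul_le_mul_left _ hA
  rw [Nat.mul_succ] at this
  omega

theorem Record.of_frame {w₀ : ℝ} {σ τ : Store} {li lr : List ℕ} (h : Record n k Z col w₀ σ)
    (hf : Frame li lr σ τ) (hi : 23 ∉ li) (hr : ∀ r ∈ [4, 21, 22, 23], r ∉ lr) :
    Record n k Z col w₀ τ := by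
  unfold Record
  rw [hf.2.1 4 (hr 4 (by simp)), hf.2.1 21 (hr 21 (by simp)), hf.2.1 22 (hr 22 (by simp)),
    hf.2.1 23 (hr 23 (by simp)), hf.1 23 hi]
  exact h

theorem PassInv.move {w₀ w : ℝ} {σ τ : Store} (h : PassInv n k Z mem col P o w₀ w σ)
    (h22 : σ.I 22 = 0) (hf : Frame [4, 5, 10, 11] [6, 14] σ τ) (hM : ∀ a < n, τ.M a = σ.M a)
    (l10 : τ.I 10 ≤ n) (l11 : τ.I 11 ≤ n)
    (hb : τ.I 10 < n → ∀ a < τ.I 11, srt Z P o a - srt Z P o (τ.I 10) < σ.R 5)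
    (he : ∀ a < τ.I 10, a < n → ∀ b < n, srt Z P o b - srt Z P o a = σ.R 5 →
      PairDone n k Z col P o (σ.R 4) a b) : PassInv n k Z mem col P o w₀ w τ := by
  have e4 := hf.2.1 4 (by decide)
  have e5 := hf.2.1 5 (by decide)
  have e22 := hf.1 22 (by decide)
  exact ⟨h.ctx.of_frame hf (by decide) (by decide) hM, (hf.2.1 8 (by decide)).trans h.bound,
    h.record.of_frame hf (by decide) (by decide), by rw [e4]; exact h.le, l10, l11, by omega,
    by rw [e5]; exact hb, by rw [e4, e5]; exact h.smaller, by rw [e4, e5]; exact he, by omega⟩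

theorem passPot_move {x y : ℕ → ℝ} {σ τ : Store} {t : ℕ} (hf : Frame [4, 5, 10, 11] [6, 14] σ τ)
    (h10 : σ.I 10 ≤ τ.I 10)
    (ht : t + 2 + 80 * ((n - τ.I 10) + (n - τ.I 11)) ≤ 80 * ((n - σ.I 10) + (n - σ.I 11))) :
    t + 2 + passPot n x y τ ≤ passPot n x y σ := by
  unfold passPot
  rw [hf.2.1 4 (by decide), hf.2.1 5 (by decide), hf.1 22 (by decide)]
  have := Nat.mul_le_mul_left (6000 * n) (Nat.add_le_add_right
    (work_anti (n := n) (x := x) (y := y) (s := σ.R 5) (w := σ.R 4) h10) (1 - σ.I 22))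
  omega

theorem passBody_ok (hL : Layout n k L Z mem col P) (ho : o < 2) (hkn : k ≤ n) {w₀ w : ℝ}
    (hw₀ : 0 < w₀) (hx : ∀ a < n, ∀ b < n, srt Z P o b - srt Z P o a < w₀) {σ : Store}
    (h : PassInv n k Z mem col P o w₀ w σ) (h22 : σ.I 22 = 0) :
    ∃ t, Ok L passBody σ t (fun τ => PassInv n k Z mem col P o w₀ w τ ∧
      t + 2 + passPot n (srt Z P o) (srt Z P (1 - o)) τ ≤
        passPot n (srt Z P o) (srt Z P (1 - o)) σ) := by
  have hn := hL.one_le_n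
  have hWs := hL.words
  have hsrt : ∀ a b, a ≤ b → b < n → srt Z P o a ≤ srt Z P o b := hL.sorted o ho
  have hσ := h.ctx
  unfold passBody
  set x := srt Z P o with hxdef
  set y := srt Z P (1 - o) with hydef
  by_cases hin : σ.I 10 < n
  swap
  · -- the next side length
    have hi : σ.I 10 = n := le_antisymm h.le10 (not_lt.1 hin)
    refine ⟨2 + (1 + (1 + ((100 * n + 10) + (6 + 0)))), Ok.ite (fun hc => ?_) (fun _ => ?_)⟩
    · exact absurd (by simpa [Test.Holds, hσ.reg0] using hc) hin
    refine Ok.cons (Ok.ins trivial (Ok.cons (Ok.ins trivial ?_)))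
    set σ₁ := (σ.exec (.realArith .sub 24 9 5)).exec (.realArith .add 7 8 9)
    have hf₁ : Frame [4, 5, 12, 13] [7, 12, 13, 14, 24] σ σ₁ :=
      Frame.updR (Frame.updR (Frame.base rfl) (by decide)) (by decide)
    have hc₁ : Ctx n k Z mem o σ₁ := hσ.of_frame hf₁ (by decide) (by decide) (fun _ _ => rfl)
    have h7₁ : σ₁.R 7 = -w₀ := by simp [σ₁, Store.exec, RealOp.eval, h.bound, hσ.real9]
    have h24₁ : σ₁.R 24 = -σ.R 5 := by simp [σ₁, Store.exec, RealOp.eval, hσ.real9]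
    clear_value σ₁
    refine Ok.cons ((cand_ok hL hc₁ (e := o) ho (Or.inl ⟨rfl, rfl, rfl⟩) (by decide) (by decide)
      (by decide) (by rw [hc₁.real10]; norm_num)).mono le_rfl ?_)
    rintro σ₂ ⟨hf₂', hM₂, hm⟩
    have hf₂ := hf₁.trans (hf₂'.weaken (by decide) (by decide))
    have hc₂ : Ctx n k Z mem o σ₂ :=
      hc₁.of_frame hf₂' (by decide) (by decide) (fun a _ => by rw [hM₂])
    rw [hc₁.real9, hc₁.real10, h24₁, h7₁, ← hxdef] at hm
    have hval : ∀ a b, cval x 0 1 a b = -(x b - x a) := fun a b => by simp [cval]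
    simp only [IsMaxBelow, hval] at hm
    obtain ⟨hm1, hm2, hm3⟩ := hm
    refine Ok.cons ((Ok.of_wp ?_).mono (by decide) fun τ hτ => Ok.nil hτ)
    simp only [wp_ite_real, wp_block_cons, wp_block_nil, wp_rsub, wp_iset, hc₂.real9,
      hf₂.2.1 8 (by decide), h.bound]
    have e4 := hf₂.2.1 4 (by decide)
    refine ⟨fun hlt => ⟨Nat.zero_le _, Nat.zero_le _, ?_⟩, fun hlt => ⟨by omega, ?_⟩⟩
    · set τ : Store := ⟨_, _, _, _⟩
      have hfτ : Frame [4, 5, 10, 11, 12, 13] [5, 7, 12, 13, 14, 24] σ τ := by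
        refine (hf₂.weaken (by decide) (by decide)).trans ?_
        repeat refine Frame.updI ?_ (by decide)
        exact Frame.updR (Frame.base rfl) (by decide)
      have hcτ : Ctx n k Z mem o τ := hσ.of_frame hfτ (by decide) (by decide) (fun a ha =>
        (hc₂.mem_eq a ha).trans (hσ.mem_eq a ha).symm)
      have e4 := hfτ.2.1 4 (by decide)
      have e22 := hfτ.1 22 (by decide)
      have e5 : τ.R 5 = -σ₂.R 7 := by simp [τ]
      have e10 : τ.I 10 = 0 := by simp [τ]
      have e11 : τ.I 11 = 0 := by simp [τ]
      obtain ⟨a, ha, b, hb, hab, hlt'⟩ := hm2.resolve_left (ne_of_gt hlt)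
      have hs : x b - x a = -σ₂.R 7 := by linarith
      refine ⟨⟨hcτ, (hfτ.2.1 8 (by decide)).trans h.bound, h.record.of_frame hfτ (by decide)
        (by decide), by rw [e4]; exact h.le, by omega, by omega, by omega, fun _ c hc => by omega,
        fun c hc d hd hcd => ?_, fun c hc => by omega, by omega⟩, ?_⟩
      · rw [e5] at hcd
        rw [e4]
        rcases lt_trichotomy (x d - x c) (σ.R 5) with h' | h' | h'
        · exact h.smaller c hc d hd h'
        · exact h.equal c (by omega) hc d hd h'
        · have := hm3 c hc d hd (by linarith)
          linarith
      · unfold passPot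
        rw [e4, e5, e10, e11, e22]
        refine potential_drop ?_ (by omega)
        have := work_next_lt (n := n) (y := y) (w := σ.R 4) (s := σ.R 5) (i := σ.I 10) ha hb hs
          (by linarith)
        omega
    · set τ : Store := ⟨_, _, _, _⟩
      have hfτ : Frame [4, 5, 12, 13, 22] [7, 12, 13, 14, 24] σ τ := by
        refine (hf₂.weaken (by decide) (by decide)).trans ?_
        exact Frame.updI (Frame.base rfl) (by decide)
      have hcτ : Ctx n k Z mem o τ := hσ.of_frame hfτ (by decide) (by decide) (fun a ha =>
        (hc₂.mem_eq a ha).trans (hσ.mem_eq a ha).symm)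
      have e4 := hfτ.2.1 4 (by decide)
      have e5 := hfτ.2.1 5 (by decide)
      have e10 := hfτ.1 10 (by decide)
      have e11 := hfτ.1 11 (by decide)
      have e22 : τ.I 22 = 1 := by simp [τ]
      refine ⟨⟨hcτ, (hfτ.2.1 8 (by decide)).trans h.bound, h.record.of_frame hfτ (by decide)
        (by decide), by rw [e4]; exact h.le, by rw [e10]; exact h.le10, by rw [e11]; exact h.le11,
        by omega, by rw [e10, e11, e5]; exact h.before, by rw [e4, e5]; exact h.smaller,
        by rw [e4, e5, e10]; exact h.equal, fun _ c hc d hd => ?_⟩, ?_⟩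
      · rw [e4]
        rcases lt_trichotomy (x d - x c) (σ.R 5) with h' | h' | h'
        · exact h.smaller c hc d hd h'
        · exact h.equal c (by omega) hc d hd h'
        · have := hm3 c hc d hd (by linarith)
          have := hx c hc d hd
          linarith
      · unfold passPot
        rw [e4, e5, e10, e11, e22, h22]
        exact potential_drop (by omega) (by omega)
  -- a pair of positions
  have hholds : (Test.int 10 0).Holds σ := by simpa [Test.Holds, hσ.reg0] using hin
  -- load the first coordinate
  have hload : ∀ {q : Com} {t : ℕ} {Q : Store → Prop}, (∀ σ₁ : Store,
      Frame [4, 5, 10, 11] [6, 14] σ σ₁ → (∀ r ∈ [10, 11], σ₁.I r = σ.I r) → σ₁.M = σ.M →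
      σ₁.R 6 = x (σ.I 10) → Ok L (block [q]) σ₁ t Q) →
      Ok L (block [ldS 10 8 6 6, q]) σ (8 + t) Q := by
    intro q t Q hq
    refine Ok.cons ((Ok.of_wp ?_).mono (by decide) (fun _ => id))
    refine wp_ldS hL (by decide) (by decide) (by decide) hσ.reg0 hσ.mem_eq hσ.pts hin ho hσ.reg8
      hσ.reg6 fun v4 v5 => hq _ ?_ (by simp) rfl (by simp [hxdef])
    exact Frame.updI (Frame.updI (Frame.updR (Frame.base hσ.pts) (by decide)) (by decide))
      (by decide)
  -- the first position is advanced
  have hnext : ∀ τ : Store, Frame [4, 5, 10, 11] [6, 14] σ τ → τ.M = σ.M →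
      τ.I 10 = σ.I 10 + 1 → τ.I 11 = σ.I 11 →
      (∀ b < n, x b - x (σ.I 10) = σ.R 5 → PairDone n k Z col P o (σ.R 4) (σ.I 10) b) →
      PassInv n k Z mem col P o w₀ w τ ∧ 60 + 2 + passPot n x y τ ≤ passPot n x y σ := by
    intro τ hf hM e10 e11 hd
    refine ⟨h.move h22 hf (fun a _ => by rw [hM]) (by omega) (by rw [e11]; exact h.le11) ?_ ?_,
      passPot_move hf (by omega) (by omega)⟩
    · rw [e10, e11]
      intro hlt a ha
      have := h.before hin a ha
      have := hsrt (σ.I 10) (σ.I 10 + 1) (by omega) hlt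
      linarith
    · rw [e10]
      intro a ha ha' b hb hab
      rcases Nat.lt_succ_iff_lt_or_eq.1 ha with ha | rfl
      · exact h.equal a ha ha' b hb hab
      · exact hd b hb hab
  by_cases hjn : σ.I 11 < n
  swap
  · have hj : σ.I 11 = n := le_antisymm h.le11 (not_lt.1 hjn)
    refine ⟨60, (Ok.ite (t := 8 + ((2 + 1) + 0)) (fun _ => hload ?_)
      (fun hc => absurd hholds hc)).mono (by omega) (fun _ => id)⟩
    intro σ₁ hf hI hM h6
    have i10 := hI 10 (by simp)
    have i11 := hI 11 (by simp)
    have hc₁ : Ctx n k Z mem o σ₁ := hσ.of_frame hf (by decide) (by decide) (fun _ _ => by rw [hM])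
    refine Ok.cons ((Ok.ite (t := 1) (fun hc => ?_) (fun _ => Ok.ins ?_ ?_)).mono le_rfl
      fun τ hτ => Ok.nil hτ)
    · have : σ₁.I 11 < σ₁.I 0 := hc
      rw [i11, hc₁.reg0] at this
      omega
    · simp only [Store.Guard, hc₁.reg3, i10]; omega
    · refine hnext _ (hf.trans (Frame.updI (Frame.base rfl) (by decide))) hM ?_ ?_ ?_
      · simp [Store.exec, IntOp.eval, hc₁.reg3, i10]
      · simp [Store.exec, i11]
      · intro b hb hab
        have := h.before hin b (by omega)
        linarith
  -- load the second coordinate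
  have hload₂ : ∀ {q : Com} {t : ℕ} {Q : Store → Prop}, (∀ σ₁ : Store, Ctx n k Z mem o σ₁ →
      Frame [4, 5, 10, 11] [6, 14] σ σ₁ → (∀ r ∈ [10, 11], σ₁.I r = σ.I r) → σ₁.M = σ.M →
      σ₁.R 6 = x (σ.I 10) → σ₁.R 14 = x (σ.I 11) - x (σ.I 10) → Ok L q σ₁ t Q) →
      Ok L (.ite (.int 10 0) (block [ldS 10 8 6 6, .ite (.int 11 0)
        (block [ldS 11 8 6 14, rsub 14 14 6, q]) (iadd 10 10 3)])
        (block [rsub 24 9 5, radd 7 8 9, cand 8 6 9 10 24,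
          .ite (.real 8 7) (block [rsub 5 9 7, iset 10 0, iset 11 0]) (iset 22 1)]))
        σ (21 + t) Q := by
    intro q t Q hq
    refine (Ok.ite (t := 8 + ((2 + (8 + (1 + (t + 0)))) + 0)) (fun _ => hload ?_)
      (fun hc => absurd hholds hc)).mono (by omega) (fun _ => id)
    intro σ₁ hf hI hM h6
    have i10 := hI 10 (by simp)
    have i11 := hI 11 (by simp)
    have hc₁ : Ctx n k Z mem o σ₁ := hσ.of_frame hf (by decide) (by decide) (fun _ _ => by rw [hM])
    refine Ok.cons ((Ok.ite (fun _ => ?_) (fun hc => ?_)).mono le_rfl fun τ hτ => Ok.nil hτ)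
    · refine Ok.cons ((Ok.of_wp (p := ldS 11 8 6 14) ?_).mono (by decide) (fun _ => id))
      refine wp_ldS hL (by decide) (by decide) (by decide) hc₁.reg0 hc₁.mem_eq hc₁.pts
        (by rw [i11]; exact hjn) ho hc₁.reg8 hc₁.reg6 fun v4 v5 => ?_
      refine Ok.cons (Ok.ins trivial (Ok.cons ((hq _ ?_ ?_ ?_ ?_ ?_ ?_).mono le_rfl
        fun τ hτ => Ok.nil hτ)))
      · refine hc₁.of_frame (li := [4, 5]) (lr := [14]) ?_ (by decide) (by decide) (fun _ _ => rfl)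
        exact Frame.updI (Frame.updI (Frame.updR (Frame.updR (Frame.base hc₁.pts) (by decide))
          (by decide)) (by decide)) (by decide)
      · refine hf.trans ?_
        exact Frame.updI (Frame.updI (Frame.updR (Frame.updR (Frame.base hc₁.pts) (by decide))
          (by decide)) (by decide)) (by decide)
      · simp [Store.exec, i10, i11]
      · exact hM
      · simp [Store.exec, h6]
      · simp [Store.exec, RealOp.eval, h6, i11, hxdef]
    · exact absurd (show σ₁.I 11 < σ₁.I 0 by rw [i11, hc₁.reg0]; exact hjn) hc
  rcases lt_trichotomy (x (σ.I 11) - x (σ.I 10)) (σ.R 5) with hd | hd | hd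
  · refine ⟨60, (hload₂ (t := 3) ?_).mono (by omega) (fun _ => id)⟩
    intro σ₁ hc₁ hf hI hM h6 h14
    have i10 := hI 10 (by simp)
    have i11 := hI 11 (by simp)
    have e5 := hf.2.1 5 (by decide)
    refine Ok.ite (fun _ => Ok.ins ?_ ?_) (fun hc => ?_)
    · simp only [Store.Guard, hc₁.reg3, i11]; omega
    · set τ := Store.exec _ _
      have hfτ : Frame [4, 5, 10, 11] [6, 14] σ τ :=
        hf.trans (Frame.updI (Frame.base rfl) (by decide))
      have e10 : τ.I 10 = σ.I 10 := by simp [τ, Store.exec, i10]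
      have e11 : τ.I 11 = σ.I 11 + 1 := by simp [τ, Store.exec, IntOp.eval, hc₁.reg3, i11]
      refine ⟨h.move h22 hfτ (fun a _ => by rw [← hM]; rfl) (by omega) (by omega) ?_ ?_,
        passPot_move hfτ (by omega) (by omega)⟩
      · rw [e10, e11]
        intro _ a ha
        rcases Nat.lt_succ_iff_lt_or_eq.1 ha with ha | rfl
        · exact h.before hin a ha
        · exact hd
      · rw [e10]
        exact h.equal
    · exact absurd (show σ₁.R 14 < σ₁.R 5 by rw [h14, e5]; exact hd) hc
  · refine ⟨21 + (2 + (2 + 5000 * n)), hload₂ ?_⟩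
    intro σ₁ hc₁ hf hI hM h6 h14
    have i10 := hI 10 (by simp)
    have i11 := hI 11 (by simp)
    have e4 := hf.2.1 4 (by decide)
    have e5 := hf.2.1 5 (by decide)
    refine Ok.ite (fun hc => ?_) (fun _ => Ok.ite (fun hc => ?_) (fun _ => ?_))
    · have : σ₁.R 14 < σ₁.R 5 := hc
      rw [h14, e5] at this
      linarith
    · have : σ₁.R 5 < σ₁.R 14 := hc
      rw [h14, e5] at this
      linarith
    refine (trial_ok hL ho hkn hw₀ hc₁ ((hf.2.1 8 (by decide)).trans h.bound) hin hjn h6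
      (by rw [e5]; exact hd.symm) (by rw [i10]; exact hin)).mono le_rfl ?_
    rintro τ ⟨hcτ, t8, t5, t11, t22, ht⟩
    have hr₁ : Record n k Z col w₀ σ₁ := h.record.of_frame hf (by decide) (by decide)
    have e22 := hf.1 22 (by decide)
    rw [h6, e5, e4, i10] at ht
    rw [e5] at t5
    rcases ht with ⟨t10, t4, hr, hdone⟩ | ⟨t10, t4, hr, hbelow⟩
    · refine ⟨⟨hcτ, t8, hr hr₁, by rw [t4]; exact h.le, by omega, by omega, by omega, ?_,
        by rw [t4, t5]; exact h.smaller, ?_, by omega⟩, ?_⟩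
      · rw [t10, t11, i11, t5]
        intro hlt a ha
        have := h.before hin a ha
        have := hsrt (σ.I 10) (σ.I 10 + 1) (by omega) hlt
        simp only [← hxdef]
        linarith
      · rw [t10, t4, t5]
        intro a ha ha' b hb hab
        rcases Nat.lt_succ_iff_lt_or_eq.1 ha with ha | rfl
        · exact h.equal a ha ha' b hb hab
        · intro v β hv hfe
          rw [hab] at hv hfe
          exact hdone v β hv hfe
      · unfold passPot
        rw [t4, t5, t10, t11, t22, e22, i11]
        have := work_succ_lt (n := n) (y := y) (w := σ.R 4) hin hjn hd
        exact potential_drop (by omega) (by omega)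
    · refine ⟨⟨hcτ, t8, hr, t4.trans h.le, by omega, by omega, by omega, ?_, ?_, ?_, by omega⟩, ?_⟩
      · rw [t10, t11, i11, t5]
        exact h.before
      · rw [t5]
        exact fun a ha b hb hab => (h.smaller a ha b hb hab).mono t4
      · rw [t5, t10]
        exact fun a ha ha' b hb hab => (h.equal a ha ha' b hb hab).mono t4
      · unfold passPot
        rw [t5, t10, t11, t22, e22, i11]
        have : work n x y (σ.R 5) (τ.R 4) (σ.I 10) + 1 ≤ work n x y (σ.R 5) (σ.R 4) (σ.I 10) := by
          simp only [← hxdef, ← hydef] at hbelow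
          unfold work; omega
        exact potential_drop (by omega) (by omega)
  · refine ⟨60, (hload₂ (t := 2 + (2 + 1)) ?_).mono (by omega) (fun _ => id)⟩
    intro σ₁ hc₁ hf hI hM h6 h14
    have i10 := hI 10 (by simp)
    have i11 := hI 11 (by simp)
    have e5 := hf.2.1 5 (by decide)
    refine Ok.ite (fun hc => ?_) (fun _ => Ok.ite (fun _ => Ok.ins ?_ ?_) (fun hc => ?_))
    · have : σ₁.R 14 < σ₁.R 5 := hc
      rw [h14, e5] at this
      linarith
    · simp only [Store.Guard, hc₁.reg3, i10]; omega
    · refine hnext _ (hf.trans (Frame.updI (Frame.base rfl) (by decide))) hM ?_ ?_ ?_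
      · simp [Store.exec, IntOp.eval, hc₁.reg3, i10]
      · simp [Store.exec, i11]
      · intro b hb hab
        rcases lt_or_ge b (σ.I 11) with hb' | hb'
        · have := h.before hin b hb'
          linarith
        · have := hsrt (σ.I 11) b hb' hb
          linarith
    · exact absurd (show σ₁.R 5 < σ₁.R 14 by rw [h14, e5]; exact hd) hc

theorem pass_ok (hL : Layout n k L Z mem col P) (ho : o < 2) (hkn : k ≤ n) {w₀ : ℝ}
    (hw₀ : 0 < w₀) (hx : ∀ a < n, ∀ b < n, srt Z P o b - srt Z P o a < w₀) {σ : Store}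
    (hσ : Ctx n k Z mem o σ) (h8 : σ.R 8 = -w₀) (hr : Record n k Z col w₀ σ) :
    Ok L pass σ (40000 * (n * n * n)) (fun τ => Ctx n k Z mem o τ ∧ τ.R 8 = -w₀ ∧
      Record n k Z col w₀ τ ∧ τ.R 4 ≤ σ.R 4 ∧
      ∀ a < n, ∀ b < n, PairDone n k Z col P o (τ.R 4) a b) := by
  have hn := hL.one_le_n
  have hWs := hL.words
  set x := srt Z P o with hxdef
  set y := srt Z P (1 - o) with hydef
  have hloop := Ok.loop (L := L) (c := .int 22 3) (p := passBody)
    (PassInv n k Z mem col P o w₀ (σ.R 4)) (passPot n x y) (by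
      intro τ hτ hc
      refine passBody_ok hL ho hkn hw₀ hx hτ ?_
      have : τ.I 22 < τ.I 3 := hc
      rw [hτ.ctx.reg3] at this
      omega)
  have hn3 : n ≤ n * n * n := by
    calc n = n * 1 * 1 := by ring
      _ ≤ n * n * n := by gcongr
  unfold pass
  refine Ok.mono (t := 1 + (1 + (1 + (1 + ((6000 * n * (5 * (n * n) + 1) + 80 * n + 2) + 0))))) ?_
    ?_ (fun _ => id)
  swap
  · have : 6000 * n * (5 * (n * n) + 1) = 30000 * (n * n * n) + 6000 * n := by ring
    omega
  refine Ok.cons (Ok.ins trivial (Ok.cons (Ok.ins ?_ (Ok.cons (Ok.ins (Nat.zero_le _) (Ok.cons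
    (Ok.ins (Nat.zero_le _) ?_)))))))
  · simp only [Store.Guard, Store.exec, hσ.reg0, hσ.reg2]; omega
  set τ := Store.exec _ _
  have hf : Frame [10, 11, 22] [5] σ τ := by
    repeat refine Frame.updI ?_ (by decide)
    exact Frame.updR (Frame.base rfl) (by decide)
  have hcτ : Ctx n k Z mem o τ := hσ.of_frame hf (by decide) (by decide) (fun _ _ => rfl)
  have e5 : τ.R 5 = -1 := by simp [τ, Store.exec]
  have e10 : τ.I 10 = n := by simp [τ, Store.exec, IntOp.eval, hσ.reg0, hσ.reg2]
  have e11 : τ.I 11 = 0 := by simp [τ, Store.exec]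
  have e22 : τ.I 22 = 0 := by simp [τ, Store.exec]
  have e4 : τ.R 4 = σ.R 4 := hf.2.1 4 (by decide)
  clear_value τ
  refine Ok.cons ((hloop τ ⟨hcτ, (hf.2.1 8 (by decide)).trans h8, ?_, e4.le, e10.le, by omega,
    by omega, by omega, ?_, ?_, by omega⟩).mono ?_ fun τ' hτ' => Ok.nil ?_)
  · unfold Record
    rw [hf.2.1 4 (by decide), hf.2.1 21 (by decide), hf.2.1 22 (by decide), hf.2.1 23 (by decide),
      hf.1 23 (by decide)]
    exact hr
  · intro a _ b _ hlt
    exact pairDone_of_neg hL.one_le_k (by rw [e5] at hlt; linarith)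
  · intro a _ _ b _ heq
    exact pairDone_of_neg hL.one_le_k (by rw [e5] at heq; linarith)
  · unfold passPot
    rw [e22, e10, e11]
    have h1 := work_le (n := n) x y (τ.R 5) (τ.R 4) n
    have h2 : 6000 * n * (work n x y (τ.R 5) (τ.R 4) n + (1 - 0)) ≤
        6000 * n * (5 * (n * n) + 1) := Nat.mul_le_mul_left _ (by omega)
    omega
  · obtain ⟨h, hc⟩ := hτ'
    have : ¬ τ'.I 22 < τ'.I 3 := hc
    rw [h.ctx.reg3] at this
    have h22 := h.le22
    exact ⟨h.ctx, h.bound, h.record, h.le, h.all (by omega)⟩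

end CSSA

namespace CSSA

/-! ## Sorting by counting -/

/-- The order by values, with ties broken by index. -/
def Precedes (z : ℕ → ℝ) (b a : ℕ) : Prop := z b < z a ∨ z b = z a ∧ b < a

open Classical in
/-- Number of indices below `m` that precede `a`. -/
noncomputable def preceding (z : ℕ → ℝ) (m a : ℕ) : ℕ :=
  ((Finset.range m).filter fun b => Precedes z b a).card

open Classical in
/-- The index at position `p` of the order. -/
noncomputable def atRank (z : ℕ → ℝ) (n p : ℕ) : ℕ :=
  if h : ∃ a, a < n ∧ preceding z n a = p then h.choose else 0

section
variable {z : ℕ → ℝ} {n : ℕ}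

theorem Precedes.trans {a b c : ℕ} (h : Precedes z a b) (h' : Precedes z b c) : Precedes z a c := by
  rcases h with h | ⟨h, g⟩ <;> rcases h' with h' | ⟨h', g'⟩
  · exact Or.inl (h.trans h')
  · exact Or.inl (h' ▸ h)
  · exact Or.inl (h ▸ h')
  · exact Or.inr ⟨h.trans h', g.trans g'⟩

theorem not_precedes_self (a : ℕ) : ¬ Precedes z a a := by
  rintro (h | ⟨-, h⟩)
  · exact lt_irrefl _ h
  · exact lt_irrefl _ h

theorem precedes_total {a b : ℕ} (h : a ≠ b) : Precedes z a b ∨ Precedes z b a := by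
  rcases lt_trichotomy (z a) (z b) with g | g | g
  · exact Or.inl (Or.inl g)
  · rcases lt_or_gt_of_ne h with h | h
    · exact Or.inl (Or.inr ⟨g, h⟩)
    · exact Or.inr (Or.inr ⟨g.symm, h⟩)
  · exact Or.inr (Or.inl g)

theorem preceding_lt_preceding {a b : ℕ} (ha : a < n) (h : Precedes z a b) :
    preceding z n a < preceding z n b := by
  classical
  unfold preceding
  refine Finset.card_lt_card (Finset.ssubset_iff_of_subset ?_ |>.2 ⟨a, ?_, ?_⟩)
  · intro c hc
    simp only [Finset.mem_filter] at hc ⊢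
    exact ⟨hc.1, hc.2.trans h⟩
  · simp [ha, h]
  · simp [not_precedes_self]

theorem preceding_inj {a b : ℕ} (ha : a < n) (hb : b < n)
    (h : preceding z n a = preceding z n b) : a = b := by
  by_contra hne
  rcases precedes_total (z := z) hne with h' | h'
  · exact absurd h (preceding_lt_preceding ha h').ne
  · exact absurd h (preceding_lt_preceding hb h').ne'

theorem preceding_lt {a : ℕ} (ha : a < n) : preceding z n a < n := by
  classical
  unfold preceding
  calc _ < (Finset.range n).card := Finset.card_lt_card (Finset.ssubset_iff_of_subset
        (Finset.filter_subset _ _) |>.2 ⟨a, by simpa using ha, by simp [not_precedes_self]⟩)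
    _ = n := Finset.card_range n

theorem preceding_succ_of {m a : ℕ} (h : Precedes z m a) :
    preceding z (m + 1) a = preceding z m a + 1 := by
  classical
  unfold preceding
  rw [Finset.range_add_one, Finset.filter_insert, if_pos h, Finset.card_insert_of_notMem (by simp)]

theorem preceding_succ_of_not {m a : ℕ} (h : ¬ Precedes z m a) :
    preceding z (m + 1) a = preceding z m a := by
  classical
  unfold preceding
  rw [Finset.range_add_one, Finset.filter_insert, if_neg h]

theorem preceding_le (m a : ℕ) : preceding z m a ≤ m := by
  classical
  unfold preceding
  exact (Finset.card_filter_le _ _).trans (by simp)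

theorem preceding_zero (a : ℕ) : preceding z 0 a = 0 := Nat.le_zero.1 (preceding_le 0 a)

theorem exists_preceding {p : ℕ} (hp : p < n) : ∃ a, a < n ∧ preceding z n a = p := by
  have hinj : Function.Injective (fun a : Fin n => (⟨preceding z n a, preceding_lt a.2⟩ : Fin n)) :=
    fun a b h => Fin.ext (preceding_inj a.2 b.2 (by simpa using h))
  obtain ⟨a, ha⟩ := (Finite.injective_iff_surjective.1 hinj) ⟨p, hp⟩
  exact ⟨a, a.2, by simpa using ha⟩

theorem atRank_spec {p : ℕ} (hp : p < n) : atRank z n p < n ∧ preceding z n (atRank z n p) = p := by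
  unfold atRank
  rw [dif_pos (exists_preceding hp)]
  exact (exists_preceding hp).choose_spec

theorem atRank_preceding {a : ℕ} (ha : a < n) : atRank z n (preceding z n a) = a :=
  preceding_inj (atRank_spec (preceding_lt ha)).1 ha (atRank_spec (preceding_lt ha)).2

theorem atRank_mono {a b : ℕ} (hab : a ≤ b) (hb : b < n) : z (atRank z n a) ≤ z (atRank z n b) := by
  by_contra hcon
  have := preceding_lt_preceding (atRank_spec (z := z) hb).1 (Or.inl (not_le.1 hcon))
  rw [(atRank_spec hb).2, (atRank_spec (hab.trans_lt hb)).2] at this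
  omega

end

/-- One step of the ranking: compare two points, or store the rank of a point. -/
def rankBody : Com :=
  .ite (.int 13 0)
    (block [iadd 4 13 13, iadd 4 4 6, rload 12 4, iadd 4 12 12, iadd 4 4 6, rload 13 4,
      .ite (.real 12 13) (iadd 26 26 3)
        (.ite (.real 13 12) .skip (.ite (.int 13 12) (iadd 26 26 3) .skip)),
      iadd 13 13 3])
    (block [iload 4 26, imul 5 8 12, iadd 4 4 5, istore 26 4, iadd 12 12 3, iset 13 0, iset 26 0])

/-- Add `I[8]` times the index of the point at position `p` in the order by the coordinate `I[6]`
to each cell `p`. -/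
def ranking : Com := block [iset 12 0, iset 13 0, iset 26 0, .loop (.int 12 0) rankBody]

theorem ranking_ok {L : Lim} {n o D : ℕ} {σ : Store} (h0 : σ.I 0 = n) (h3 : σ.I 3 = 1)
    (h6 : σ.I 6 = o) (h8 : σ.I 8 = D) (ho : o < 2) (hW : 2 * n + 2 ≤ L.W)
    (hM : ∀ p < n, σ.M p + D * n ≤ L.W) (hI : n ≤ L.sI) (hR : 2 * n ≤ L.sR) :
    Ok L ranking σ (40 * (n * (n + 1)) + 10) (fun τ => Frame [4, 5, 12, 13, 26] [12, 13] σ τ ∧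
      (∀ p < n, τ.M p = σ.M p + D * atRank (fun q => σ.Z (2 * q + o)) n p) ∧
      ∀ p, n ≤ p → τ.M p = σ.M p) := by
  set z : ℕ → ℝ := fun q => σ.Z (2 * q + o) with hz
  let Inv : Store → Prop := fun τ => Frame [4, 5, 12, 13, 26] [12, 13] σ τ ∧ τ.I 12 ≤ n ∧
    τ.I 13 ≤ n ∧ (τ.I 12 = n → τ.I 13 = 0) ∧ τ.I 26 = preceding z (τ.I 13) (τ.I 12) ∧
    (∀ p, n ≤ p → τ.M p = σ.M p) ∧
    ∀ a < n, τ.M (preceding z n a) = σ.M (preceding z n a) + if a < τ.I 12 then D * a else 0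
  have hloop := Ok.loop (L := L) (c := .int 12 0) (p := rankBody) Inv
    (fun τ => 40 * ((n - τ.I 12) * (n + 1) - τ.I 13)) (by
    rintro τ ⟨hf, l12, l13, hend, h26, hout, hin⟩ hc
    have t0 := (hf.1 0 (by decide)).trans h0
    have t3 := (hf.1 3 (by decide)).trans h3
    have t6 := (hf.1 6 (by decide)).trans h6
    have t8 := (hf.1 8 (by decide)).trans h8
    have ha : τ.I 12 < n := by
      have : τ.I 12 < τ.I 0 := hc
      rwa [t0] at this
    obtain ⟨d, hd⟩ : ∃ d, n - τ.I 12 = d + 1 := ⟨n - τ.I 12 - 1, by omega⟩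
    have hmul : (n - τ.I 12) * (n + 1) = d * (n + 1) + (n + 1) := by rw [hd]; ring
    have hple := preceding_le (z := z) (τ.I 13) (τ.I 12)
    refine ⟨30, (Ok.of_wp (p := rankBody) ?_).mono (by decide) (fun _ => id)⟩
    unfold rankBody
    rw [wp_ite_int, t0]
    constructor
    · intro hb
      simp only [wp_block_cons, wp_block_nil, wp_iadd, wp_rload, wp_ite_real, wp_ite_int, wp_skip,
        Function.update_apply, reduceIte, Nat.reduceEqDiff, t3, t6, hf.2.2]
      have e1 : σ.Z (τ.I 13 + τ.I 13 + o) = z (τ.I 13) := by rw [hz]; simp only [two_mul]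
      have e2 : σ.Z (τ.I 12 + τ.I 12 + o) = z (τ.I 12) := by rw [hz]; simp only [two_mul]
      rw [e1, e2]
      have hfin : ∀ τ' : Store, Frame [4, 5, 12, 13, 26] [12, 13] τ τ' → τ'.M = τ.M →
          τ'.I 12 = τ.I 12 → τ'.I 13 = τ.I 13 + 1 →
          τ'.I 26 = preceding z (τ.I 13 + 1) (τ.I 12) → Inv τ' ∧
          30 + 2 + 40 * ((n - τ'.I 12) * (n + 1) - τ'.I 13) ≤
            40 * ((n - τ.I 12) * (n + 1) - τ.I 13) := by
        intro τ' hf' hM' e12 e13 e26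
        refine ⟨⟨hf.trans hf', by omega, by omega, by omega, by rw [e26, e12, e13],
          by rw [hM']; exact hout, by rw [hM', e12]; exact hin⟩, ?_⟩
        rw [e12, e13, hmul]
        omega
      refine ⟨by omega, by omega, by omega, by omega, by omega, by omega, fun hlt =>
        ⟨by omega, by omega, hfin _ ?_ rfl ?_ ?_ ?_⟩, fun hlt => ⟨fun hlt' =>
        ⟨by omega, hfin _ ?_ rfl ?_ ?_ ?_⟩, fun hlt' => ⟨fun hlt2 => ⟨by omega, by omega,
        hfin _ ?_ rfl ?_ ?_ ?_⟩, fun hlt2 => ⟨by omega, hfin _ ?_ rfl ?_ ?_ ?_⟩⟩⟩⟩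
      · repeat refine Frame.updI ?_ (by decide)
        repeat refine Frame.updR ?_ (by decide)
        exact Frame.base hf.2.2
      · simp
      · simp
      · simp [h26, preceding_succ_of (z := z) (m := τ.I 13) (a := τ.I 12) (Or.inl hlt)]
      · repeat refine Frame.updI ?_ (by decide)
        repeat refine Frame.updR ?_ (by decide)
        exact Frame.base hf.2.2
      · simp
      · simp
      · rw [preceding_succ_of_not]
        · simp [h26]
        · rintro (h | ⟨h, -⟩) <;> linarith
      · repeat refine Frame.updI ?_ (by decide)
        repeat refine Frame.updR ?_ (by decide)
        exact Frame.base hf.2.2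
      · simp
      · simp
      · rw [preceding_succ_of]
        · simp [h26]
        · exact Or.inr ⟨by linarith, hlt2⟩
      · repeat refine Frame.updI ?_ (by decide)
        repeat refine Frame.updR ?_ (by decide)
        exact Frame.base hf.2.2
      · simp
      · simp
      · rw [preceding_succ_of_not]
        · simp [h26]
        · rintro (h | ⟨-, h⟩)
          · linarith
          · omega
    · intro hb
      have hbn : τ.I 13 = n := le_antisymm l13 (not_lt.1 hb)
      rw [hbn] at h26
      have hpl := preceding_lt (z := z) ha
      have hMp := hin _ ha
      rw [if_neg (lt_irrefl _), add_zero] at hMp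
      have hMb := hM _ hpl
      have hDa : D * τ.I 12 ≤ D * n := Nat.mul_le_mul_left _ ha.le
      simp only [wp_block_cons, wp_block_nil, wp_iadd, wp_iload, wp_imul, wp_istore, wp_iset,
        Function.update_apply, reduceIte, Nat.reduceEqDiff, t3, t8, h26, hMp]
      refine ⟨by omega, by omega, by omega, by omega, by omega, by omega, by omega,
        ⟨hf.trans ?_, ?_, ?_, ?_, ?_, ?_, ?_⟩, ?_⟩
      · repeat refine Frame.updI ?_ (by decide)
        exact Frame.base rfl
      · simp; omega
      · simp
      · simp
      · simp [preceding_zero]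
      · intro p hp
        simp only
        rw [Function.update_of_ne (by omega)]
        exact hout p hp
      · intro a ha'
        simp only [Function.update_apply, reduceIte, Nat.reduceEqDiff]
        by_cases haa : a = τ.I 12
        · rw [if_pos (by rw [haa]), if_pos (by omega), haa]
        · rw [if_neg fun h => haa (preceding_inj ha' ha h), hin a ha']
          by_cases h1 : a < τ.I 12
          · rw [if_pos h1, if_pos (by omega)]
          · rw [if_neg h1, if_neg (by omega)]
      · have e : n - (τ.I 12 + 1) = d := by omega
        simp only [hmul, hbn, e]
        omega)
  unfold ranking
  refine Ok.mono (t := 1 + (1 + (1 + ((40 * (n * (n + 1)) + 2) + 0)))) (Ok.cons (Ok.ins (Nat.zero_le _)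
    (Ok.cons (Ok.ins (Nat.zero_le _) (Ok.cons (Ok.ins (Nat.zero_le _) (Ok.cons
    ((hloop _ ?_).mono ?_ fun τ hτ => Ok.nil ?_)))))))) (by omega) (fun _ => id)
  · refine ⟨?_, ?_, ?_, ?_, ?_, fun _ _ => rfl, ?_⟩
    · repeat refine Frame.updI ?_ (by decide)
      exact Frame.base rfl
    all_goals simp [Store.exec, preceding_zero]
  · simp [Store.exec]
  · obtain ⟨⟨hf, l12, -, -, -, hout, hin⟩, hc⟩ := hτ
    have : ¬ τ.I 12 < τ.I 0 := hc
    rw [hf.1 0 (by decide), h0] at this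
    refine ⟨hf, fun p hp => ?_, hout⟩
    obtain ⟨h1, h2⟩ := atRank_spec (z := z) hp
    have h3 := hin _ h1
    rw [h2, if_pos (by omega)] at h3
    exact h3

/-- The input data after both rankings. -/
theorem layout_of_ranking {L : Lim} {n k : ℕ} {Z : ℕ → ℝ} {mem col : ℕ → ℕ} (hn : 1 ≤ n)
    (hk : 1 ≤ k) (hkn : k ≤ n) (hcol : ∀ p < n, col p < k)
    (hmem : ∀ p < n, mem p = col p + n * atRank (fun q => Z (2 * q + 0)) n p +
      n ^ 2 * atRank (fun q => Z (2 * q + 1)) n p)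
    (hI : n + k ≤ L.sI) (hR : 2 * n ≤ L.sR) (hW : 2 * n + k + 10 ≤ L.W) (hW' : n ^ 3 ≤ L.W) :
    Layout n k L Z mem col (fun o p => atRank (fun q => Z (2 * q + o)) n p) := by
  have hfield : ∀ a < n, mem a % n = col a ∧ mem a / n = atRank (fun q => Z (2 * q + 0)) n a +
      n * atRank (fun q => Z (2 * q + 1)) n a := by
    intro a ha
    have hc : col a < n := (hcol a ha).trans_le hkn
    have h : mem a = col a + n * (atRank (fun q => Z (2 * q + 0)) n a +
        n * atRank (fun q => Z (2 * q + 1)) n a) := by rw [hmem a ha]; ring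
    constructor
    · rw [h, Nat.add_mul_mod_self_left, Nat.mod_eq_of_lt hc]
    · rw [h, Nat.add_mul_div_left _ _ (by omega), Nat.div_eq_of_lt hc, zero_add]
  refine ⟨hn, hk, ?_, ?_, fun a ha => (hfield a ha).1, ?_, ?_, ?_, hcol, hI, hR, hW⟩
  · intro a ha
    have h0 := (atRank_spec (z := fun q => Z (2 * q + 0)) ha).1
    have h1 := (atRank_spec (z := fun q => Z (2 * q + 1)) ha).1
    have hc : col a < n := (hcol a ha).trans_le hkn
    refine le_trans ?_ hW'
    rw [hmem a ha]
    have h2 : n * (atRank (fun q => Z (2 * q + 0)) n a + 1) ≤ n * n := Nat.mul_le_mul_left _ h0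
    have h3 : n ^ 2 * (atRank (fun q => Z (2 * q + 1)) n a + 1) ≤ n ^ 2 * n :=
      Nat.mul_le_mul_left _ h1
    have h4 : n ^ 3 = n ^ 2 * n := by ring
    have h5 : n ^ 2 = n * n := by ring
    rw [h4]
    nlinarith
  · intro a ha o ho
    have h0 := (atRank_spec (z := fun q => Z (2 * q + 0)) ha).1
    have h1 := (atRank_spec (z := fun q => Z (2 * q + 1)) ha).1
    obtain rfl | rfl : o = 0 ∨ o = 1 := by omega
    · simp only [zero_add, pow_one]
      rw [(hfield a ha).2, Nat.add_mul_mod_self_left, Nat.mod_eq_of_lt h0]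
    · rw [show n ^ (1 + 1) = n * n by ring, ← Nat.div_div_eq_div_mul, (hfield a ha).2,
        Nat.add_mul_div_left _ _ (by omega), Nat.div_eq_of_lt h0, zero_add, Nat.mod_eq_of_lt h1]
  · exact fun a ha o _ => (atRank_spec ha).1
  · exact fun p hp o _ => ⟨_, preceding_lt hp, atRank_preceding hp⟩
  · exact fun o _ a b hab hb => atRank_mono (z := fun q => Z (2 * q + o)) hab hb

end CSSA

namespace CSSA

variable {n k : ℕ} {L : Lim} {Z : ℕ → ℝ} {mem col : ℕ → ℕ} {P : ℕ → ℕ → ℕ} {o : ℕ}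

/-! ## The output -/

theorem wp_abs {Q : Store → Prop} {σ : Store} {d : ℕ} (h9 : σ.R 9 = 0)
    (hQ : Q ⟨σ.I, Function.update σ.R d |σ.R d|, σ.M, σ.Z⟩) :
    wp L (.ite (.real d 9) (rsub d 9 d) .skip) Q σ := by
  simp only [wp_ite_real, wp_rsub, wp_skip, h9]
  refine ⟨fun h => ?_, fun h => ?_⟩
  · rw [abs_of_neg h] at hQ
    rwa [zero_sub]
  · rwa [abs_of_nonneg (not_lt.1 h), Function.update_eq_self] at hQ

theorem wp_max {Q : Store → Prop} {σ : Store} {d e : ℕ} (h9 : σ.R 9 = 0)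
    (hQ : Q ⟨σ.I, Function.update σ.R d (max (σ.R d) (σ.R e)), σ.M, σ.Z⟩) :
    wp L (.ite (.real d e) (radd d e 9) .skip) Q σ := by
  simp only [wp_ite_real, wp_radd, wp_skip, h9, add_zero]
  refine ⟨fun h => ?_, fun h => ?_⟩
  · rwa [max_eq_right h.le] at hQ
  · rwa [max_eq_left (not_lt.1 h), Function.update_eq_self] at hQ

theorem wp_posMin {Q : Store → Prop} {σ : Store} {d e : ℕ} (h9 : σ.R 9 = 0) (hd : 0 < σ.R d)
    (hQ : ∀ v, 0 < v → v ≤ σ.R d → (0 < σ.R e → v ≤ σ.R e) →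
      Q ⟨σ.I, Function.update σ.R d v, σ.M, σ.Z⟩) :
    wp L (.ite (.real 9 e) (.ite (.real e d) (radd d e 9) .skip) .skip) Q σ := by
  simp only [wp_ite_real, wp_radd, wp_skip, h9, add_zero]
  have hsame : (0 < σ.R e → σ.R d ≤ σ.R e) → Q σ := fun h => by
    have := hQ _ hd le_rfl h
    rwa [Function.update_eq_self] at this
  refine ⟨fun h => ⟨fun h' => ?_, fun h' => ?_⟩, fun h => ?_⟩
  · exact hQ _ h h'.le fun _ => le_rfl
  · exact hsame fun _ => not_lt.1 h'
  · exact hsame fun h' => absurd h' h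

/-- Take the distance of a point from the center into account. -/
def distBody : Com :=
  block [rload 13 13, rsub 13 13 0, .ite (.real 13 9) (rsub 13 9 13) .skip, iadd 13 13 3,
    rload 14 13, rsub 14 14 1, .ite (.real 14 9) (rsub 14 9 14) .skip,
    .ite (.real 13 14) (radd 13 14 9) .skip,
    .ite (.real 9 13) (.ite (.real 13 12) (radd 12 13 9) .skip) .skip, iadd 13 13 3, iadd 12 12 3]

/-- Move the center of a square by less than the positive distances of the points from it, and turn
the square into an annulus with a hole of positive size. -/
def perturb : Com :=
  block [rset 12 2, iset 12 0, iset 13 0, .loop (.int 12 0) distBody, rmul 12 12 11, radd 0 0 12,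
    radd 2 12 9, radd 3 3 12]

/-- Compute the output from the stored annulus. -/
def finish : Com :=
  block [rmul 14 22 11, .ite (.int 2 23) (block [radd 0 23 14, radd 1 21 14])
    (block [radd 0 21 14, radd 1 23 14]), radd 3 14 9, rsub 2 14 4,
    .ite (.real 9 2) .skip perturb]

/-- Distance of the point `p` from `(cx, cy)`. -/
noncomputable def far (Z : ℕ → ℝ) (cx cy : ℝ) (p : ℕ) : ℝ := max |Z (2 * p) - cx| |Z (2 * p + 1) - cy|

theorem perturb_ok (hL : Layout n k L Z mem col P) {σ : Store} (hσ : Ctx n k Z mem o σ) :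
    Ok L perturb σ (50 * n + 20) (fun τ => ∃ ε > 0,
      (∀ p < n, 0 < far Z (σ.R 0) (σ.R 1) p → 2 * ε ≤ far Z (σ.R 0) (σ.R 1) p) ∧
      τ.R 0 = σ.R 0 + ε ∧ τ.R 1 = σ.R 1 ∧ τ.R 2 = ε ∧ τ.R 3 = σ.R 3 + ε) := by
  have hWs := hL.words
  have hsR := hL.real_cells
  let Inv : Store → Prop := fun τ => Frame [12, 13] [12, 13, 14] σ τ ∧ τ.M = σ.M ∧ τ.I 12 ≤ n ∧
    τ.I 13 = 2 * τ.I 12 ∧ 0 < τ.R 12 ∧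
    ∀ p < τ.I 12, 0 < far Z (σ.R 0) (σ.R 1) p → τ.R 12 ≤ far Z (σ.R 0) (σ.R 1) p
  have hloop := Ok.loop (L := L) (c := .int 12 0) (p := distBody) Inv
    (fun τ => 50 * (n - τ.I 12)) (by
    rintro τ ⟨hf, hM, l12, e13, hpos, hall⟩ hc
    have hcτ : Ctx n k Z mem o τ := hσ.of_frame hf (by decide) (by decide) (fun _ _ => by rw [hM])
    have hlt : τ.I 12 < n := by
      have : τ.I 12 < τ.I 0 := hc
      rwa [hcτ.reg0] at this
    refine ⟨30, (Ok.of_wp (p := distBody) ?_).mono (by decide) (fun _ => id)⟩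
    unfold distBody
    simp only [wp_block_cons, wp_rload, wp_rsub]
    refine ⟨by omega, wp_abs (by simp [hcτ.real9]) ?_⟩
    simp only [wp_block_cons, wp_rload, wp_rsub, wp_iadd, Function.update_apply, reduceIte,
      Nat.reduceEqDiff, hcτ.reg3]
    refine ⟨by omega, by omega, wp_abs (by simp [hcτ.real9]) ?_⟩
    rw [wp_block_cons]
    refine wp_max (by simp [hcτ.real9]) ?_
    rw [wp_block_cons]
    refine wp_posMin (by simp [hcτ.real9]) (by simpa using hpos) fun v hv hv1 hv2 => ?_
    have hfar : max |Z (2 * τ.I 12) - σ.R 0| |Z (2 * τ.I 12 + 1) - σ.R 1| =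
      far Z (σ.R 0) (σ.R 1) (τ.I 12) := rfl
    simp [hcτ.pts, hf.2.1, e13, hfar] at hv1 hv2
    simp only [wp_block_cons, wp_block_nil, wp_iadd, Function.update_apply, reduceIte,
      Nat.reduceEqDiff, hcτ.reg3]
    refine ⟨by omega, by omega, ⟨hf.trans ?_, hM, ?_, ?_, ?_, ?_⟩, ?_⟩
    · repeat refine Frame.updI ?_ (by decide)
      repeat refine Frame.updR ?_ (by decide)
      exact Frame.base rfl
    · simp; omega
    · simp; omega
    · simpa using hv
    · intro p hp hpp
      simp only [Function.update_self] at hp ⊢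
      rcases Nat.lt_succ_iff_lt_or_eq.1 hp with hp | rfl
      · exact hv1.trans (hall p hp hpp)
      · exact hv2 hpp
    · omega)
  unfold perturb
  refine Ok.mono (t := 1 + (1 + (1 + ((50 * n + 2) + (1 + (1 + (1 + (1 + 0)))))))) (Ok.cons
    (Ok.ins trivial (Ok.cons (Ok.ins (Nat.zero_le _) (Ok.cons (Ok.ins (Nat.zero_le _) (Ok.cons
    ((hloop _ ?_).mono ?_ fun τ hτ => ?_)))))))) (by omega) (fun _ => id)
  · refine ⟨?_, rfl, ?_, ?_, ?_, ?_⟩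
    · exact Frame.updI (Frame.updI (Frame.updR (Frame.base rfl) (by decide)) (by decide)) (by decide)
    all_goals simp [Store.exec]
  · simp [Store.exec]
  · obtain ⟨⟨hf, hM, l12, e13, hpos, hall⟩, hc⟩ := hτ
    have hcτ : Ctx n k Z mem o τ := hσ.of_frame hf (by decide) (by decide) (fun _ _ => by rw [hM])
    have hge : n ≤ τ.I 12 := by
      have : ¬ τ.I 12 < τ.I 0 := hc
      rw [hcτ.reg0] at this
      omega
    refine Ok.cons (Ok.ins trivial (Ok.cons (Ok.ins trivial (Ok.cons (Ok.ins trivial (Ok.cons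
      (Ok.ins trivial (Ok.nil ⟨τ.R 12 / 2, by linarith, fun p hp hpp => ?_, ?_, ?_, ?_, ?_⟩))))))))
    · have := hall p (by omega) hpp
      linarith
    all_goals
      simp [Store.exec, RealOp.eval, hf.2.1, hσ.real9, hσ.real11]
    all_goals ring

/-- The registers hold an annulus of width `w` that contains all colors. -/
def IsOutput (n k : ℕ) (Z : ℕ → ℝ) (col : ℕ → ℕ) (w : ℝ) (τ : Store) : Prop :=
  0 < τ.R 2 ∧ τ.R 3 - τ.R 2 = w ∧
    ∀ c < k, ∃ p < n, col p = c ∧ τ.R 2 ≤ far Z (τ.R 0) (τ.R 1) p ∧ far Z (τ.R 0) (τ.R 1) p ≤ τ.R 3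

theorem finish_ok (hL : Layout n k L Z mem col P) {σ : Store} (hσ : Ctx n k Z mem o σ)
    (ho : σ.I 23 < 2) (hws : σ.R 4 ≤ σ.R 22 / 2)
    (hfe : Feas n k Z col (σ.I 23) (σ.R 21) (σ.R 22) (σ.R 4) (σ.R 23)) :
    Ok L finish σ (50 * n + 40) (IsOutput n k Z col (σ.R 4)) := by
  unfold finish
  set s := σ.R 22 with hs
  set w := σ.R 4 with hwdef
  refine Ok.mono (t := 1 + (6 + (1 + (1 + ((2 + (50 * n + 20)) + 0))))) (Ok.cons (Ok.ins trivial ?_))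
    (by omega) (fun _ => id)
  set σ₁ := σ.exec (.realArith .mul 14 22 11)
  have e14 : σ₁.R 14 = s / 2 := by
    simp [σ₁, Store.exec, RealOp.eval, hσ.real11, ← hs]; ring
  have hf₁ : Frame [] [14] σ σ₁ := Frame.updR (Frame.base rfl) (by decide)
  have hM₁ : σ₁.M = σ.M := rfl
  clear_value σ₁
  have hc₁ : Ctx n k Z mem o σ₁ := hσ.of_frame hf₁ (by decide) (by decide) (fun _ _ => by rw [hM₁])
  refine Ok.cons ((Ok.of_wp (Q := fun τ => Frame [] [0, 1, 14] σ τ ∧ τ.M = σ.M ∧ τ.R 14 = s / 2 ∧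
    ∀ c < k, ∃ p < n, col p = c ∧ s / 2 - w ≤ far Z (τ.R 0) (τ.R 1) p ∧
      far Z (τ.R 0) (τ.R 1) p ≤ s / 2) ?_).mono (by decide) ?_)
  · simp only [wp_ite_int, wp_block_cons, wp_block_nil, wp_radd, hc₁.reg2, hf₁.1 23 (by decide),
      Function.update_apply, reduceIte, Nat.reduceEqDiff, e14, hf₁.2.1 21 (by decide),
      hf₁.2.1 23 (by decide), OfNat.ofNat_ne_zero, OfNat.ofNat_ne_one, zero_ne_one]
    refine ⟨fun h => ⟨hf₁.weaken (by decide) (by decide) |>.trans ?_, hM₁, trivial, fun c hc => ?_⟩,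
      fun h => ⟨hf₁.weaken (by decide) (by decide) |>.trans ?_, hM₁, trivial, fun c hc => ?_⟩⟩
    · exact Frame.updR (Frame.updR (Frame.base rfl) (by decide)) (by decide)
    · have h1 : σ.I 23 = 1 := by omega
      rw [h1] at hfe
      obtain ⟨p, hp, hcol, hx, hy, hxy⟩ := hfe c hc
      have := region_of_shape hx hy hxy
      refine ⟨p, hp, hcol, ?_⟩
      rw [far, max_comm]
      exact this
    · exact Frame.updR (Frame.updR (Frame.base rfl) (by decide)) (by decide)
    · have h1 : σ.I 23 = 0 := by omega
      rw [h1] at hfe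
      obtain ⟨p, hp, hcol, hx, hy, hxy⟩ := hfe c hc
      exact ⟨p, hp, hcol, region_of_shape hx hy hxy⟩
  rintro σ₂ ⟨hf₂, hM₂, e14₂, hreg⟩
  have hc₂ : Ctx n k Z mem o σ₂ := hσ.of_frame hf₂ (by decide) (by decide) (fun _ _ => by rw [hM₂])
  refine Ok.cons (Ok.ins trivial (Ok.cons (Ok.ins trivial ?_)))
  set σ₃ := (σ₂.exec (.realArith .add 3 14 9)).exec (.realArith .sub 2 14 4)
  have hf₃ : Frame [] [2, 3] σ₂ σ₃ :=
    Frame.updR (Frame.updR (Frame.base rfl) (by decide)) (by decide)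
  have hc₃ : Ctx n k Z mem o σ₃ := hc₂.of_frame hf₃ (by decide) (by decide) (fun _ _ => rfl)
  have e2 : σ₃.R 2 = s / 2 - w := by
    simp [σ₃, Store.exec, RealOp.eval, e14₂, hf₂.2.1, ← hwdef]
  have e3 : σ₃.R 3 = s / 2 := by simp [σ₃, Store.exec, RealOp.eval, e14₂, hc₂.real9]
  rw [← hf₃.2.1 0 (by decide), ← hf₃.2.1 1 (by decide)] at hreg
  clear_value σ₃
  refine Ok.cons ((Ok.ite (t := 50 * n + 20) (fun h => ?_) (fun h => ?_)).mono le_rfl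
    fun _ => Ok.nil)
  · have h' : 0 < σ₃.R 2 := by rw [← hc₃.real9]; exact h
    refine (Ok.skip ⟨h', by rw [e2, e3]; ring, ?_⟩).mono (Nat.zero_le _) (fun _ => id)
    rw [e2, e3]
    exact hreg
  · have h' : ¬ 0 < σ₃.R 2 := by rw [← hc₃.real9]; exact h
    rw [e2] at h'
    refine (perturb_ok hL hc₃).mono le_rfl ?_
    rintro τ ⟨ε, hε, hall, t0, t1, t2, t3⟩
    refine ⟨by rw [t2]; exact hε, by rw [t2, t3, e3]; linarith, fun c hc => ?_⟩
    obtain ⟨p, hp, hcol, h1, h2⟩ := hreg c hc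
    refine ⟨p, hp, hcol, ?_⟩
    rw [t0, t1, t2, t3, e3]
    exact region_shift hε (hall p hp) h2

/-! ## The whole program -/

/-- Exchange the two orientations. -/
def swap : Com :=
  block [iadd 4 6 2, iadd 6 7 2, iadd 7 4 2, iadd 4 8 2, iadd 8 9 2, iadd 9 4 2]

theorem Ctx.own {σ σ' : Store} {li lr : List ℕ} (h : Ctx n k Z mem o σ) (hf : Frame li lr σ σ')
    (hi : ∀ r ∈ [0, 1, 2, 3, 6, 7, 8, 9], r ∉ li) (hr : ∀ r ∈ [9, 10, 11], r ∉ lr) :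
    Ctx n k Z σ'.M o σ' :=
  { h.of_frame (σ' := ⟨σ'.I, σ'.R, σ.M, σ'.Z⟩) hf hi hr (fun _ _ => rfl) with
    mem_eq := fun _ _ => rfl }

theorem swap_ok {σ : Store} (hσ : Ctx n k Z mem o σ) (ho : o < 2) (hW : n ^ 2 + 1 ≤ L.W) (hn : 1 ≤ n) :
    Ok L swap σ 6 (fun τ => Frame [4, 6, 7, 8, 9] [] σ τ ∧ τ.M = σ.M ∧ Ctx n k Z mem (1 - o) τ) := by
  refine (Ok.of_wp (p := swap) ?_).mono (by decide) (fun _ => id)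
  have h1 : n ^ (o + 1) ≤ n ^ 2 := Nat.pow_le_pow_right hn (by omega)
  have h2 : n ^ (1 - o + 1) ≤ n ^ 2 := Nat.pow_le_pow_right hn (by omega)
  simp only [swap, wp_block_cons, wp_block_nil, wp_iadd, Function.update_apply, reduceIte,
    Nat.reduceEqDiff, hσ.reg2, hσ.reg6, hσ.reg7, hσ.reg8, hσ.reg9, add_zero]
  have hoo : 1 - (1 - o) = o := by omega
  refine ⟨by omega, by omega, by omega, by omega, by omega, by omega, ?_, trivial, ?_⟩
  · repeat refine Frame.updI ?_ (by decide)
    exact Frame.base rfl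
  · refine ⟨?_, ?_, ?_, ?_, ?_, ?_, ?_, ?_, hσ.real9, hσ.real10, hσ.real11, hσ.mem_eq, hσ.pts⟩ <;>
    simp [hσ.reg0, hσ.reg1, hσ.reg2, hσ.reg3, hoo]

/-- An upper bound for all side lengths. -/
def bounds : Com :=
  block [iset 12 0, isub 13 0 3, ldS 13 8 6 4, ldS 12 8 6 14, rsub 4 4 14, ldS 13 9 7 15,
    ldS 12 9 7 14, rsub 15 15 14, radd 4 4 15, radd 4 4 10, rsub 8 9 4]

/-- The extent of the points in one coordinate. -/
noncomputable def extent (n : ℕ) (Z : ℕ → ℝ) (P : ℕ → ℕ → ℕ) (o : ℕ) : ℝ := srt Z P o (n - 1) - srt Z P o 0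

theorem bounds_ok (hL : Layout n k L Z mem col P) {σ : Store} (hσ : Ctx n k Z mem o σ) (ho : o < 2) :
    Ok L bounds σ 50 (fun τ => Ctx n k Z mem o τ ∧
      τ.R 4 = extent n Z P o + extent n Z P (1 - o) + 1 ∧ τ.R 8 = -τ.R 4) := by
  have hn := hL.one_le_n
  refine (Ok.of_wp (p := bounds) ?_).mono (by decide) (fun _ => id)
  unfold bounds
  simp only [wp_block_cons, wp_iset, wp_isub]
  refine ⟨Nat.zero_le _, ?_⟩
  set σ₁ : Store := ⟨_, _, _, _⟩
  have hf : Frame [4, 5, 12, 13] [4, 8, 14, 15] σ σ₁ :=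
    Frame.updI (Frame.updI (Frame.base rfl) (by decide)) (by decide)
  have e12 : σ₁.I 12 = 0 := by simp [σ₁]
  have e13 : σ₁.I 13 = n - 1 := by simp [σ₁, hσ.reg0, hσ.reg3]
  have hM : σ₁.M = σ.M := rfl
  clear_value σ₁
  have load : ∀ {a D oo d e : ℕ} {τ : Store} {Q : Store → Prop}, e < 2 →
      (D = 8 ∧ oo = 6 ∧ e = o) ∨ (D = 9 ∧ oo = 7 ∧ e = 1 - o) → a = 12 ∨ a = 13 →
      d ∈ [4, 8, 14, 15] → Frame [4, 5, 12, 13] [4, 8, 14, 15] σ τ → τ.M = σ.M → τ.I 12 = 0 →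
      τ.I 13 = n - 1 →
      (∀ τ', Frame [4, 5, 12, 13] [4, 8, 14, 15] σ τ' → τ'.M = σ.M → τ'.I 12 = 0 →
        τ'.I 13 = n - 1 → τ'.R = Function.update τ.R d (srt Z P e (τ.I a)) → Q τ') →
      wp L (ldS a D oo d) Q τ := by
    intro a D oo d e τ Q he hDo ha hd hf hM i12 i13 hQ
    have hc : Ctx n k Z mem o τ := hσ.of_frame hf (by decide) (by decide) (fun _ _ => by rw [hM])
    have ha' : τ.I a < n := by rcases ha with rfl | rfl <;> omega
    refine wp_ldS hL (e := e) (by omega) (by omega) (by omega) hc.reg0 hc.mem_eq hc.pts ha' he ?_ ?_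
      fun v4 v5 => hQ _ (hf.trans ?_) hM (by simp [i12]) (by simp [i13]) rfl
    · rcases hDo with ⟨rfl, rfl, rfl⟩ | ⟨rfl, rfl, rfl⟩
      · exact hc.reg8
      · exact hc.reg9
    · rcases hDo with ⟨rfl, rfl, rfl⟩ | ⟨rfl, rfl, rfl⟩
      · exact hc.reg6
      · exact hc.reg7
    · exact Frame.updI (Frame.updI (Frame.updR (Frame.base hc.pts) hd) (by decide)) (by decide)
  refine load ho (Or.inl ⟨rfl, rfl, rfl⟩) (Or.inr rfl) (by decide) hf hM e12 e13
    fun σ₂ hf₂ hM₂ i12 i13 r₂ => ?_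
  rw [wp_block_cons]
  refine load ho (Or.inl ⟨rfl, rfl, rfl⟩) (Or.inl rfl) (by decide) hf₂ hM₂ i12 i13
    fun σ₃ hf₃ hM₃ j12 j13 r₃ => ?_
  rw [wp_block_cons, wp_rsub, wp_block_cons]
  refine load (e := 1 - o) (by omega) (Or.inr ⟨rfl, rfl, rfl⟩) (Or.inr rfl) (by decide)
    (hf₃.trans (Frame.updR (Frame.base rfl) (by decide))) hM₃ j12 j13
    fun σ₄ hf₄ hM₄ l12 l13 r₄ => ?_
  rw [wp_block_cons]
  refine load (e := 1 - o) (by omega) (Or.inr ⟨rfl, rfl, rfl⟩) (Or.inl rfl) (by decide)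
    hf₄ hM₄ l12 l13 fun σ₅ hf₅ hM₅ m12 m13 r₅ => ?_
  have hc₅ : Ctx n k Z mem o σ₅ := hσ.of_frame hf₅ (by decide) (by decide) (fun _ _ => by rw [hM₅])
  simp only [wp_block_cons, wp_block_nil, wp_rsub, wp_radd]
  refine ⟨hc₅.of_frame (li := []) (lr := [4, 8, 15]) ?_ (by decide) (by decide) (fun _ _ => rfl),
    ?_, ?_⟩
  · repeat refine Frame.updR ?_ (by decide)
    exact Frame.base rfl
  · simp [r₅, r₄, r₃, r₂, e13, i12, j13, l12, extent, hf.2.1, hσ.real10]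
  · simp [hc₅.real9]

theorem extent_nonneg (hL : Layout n k L Z mem col P) (ho : o < 2) : 0 ≤ extent n Z P o := by
  have := hL.one_le_n
  have := hL.sorted o ho 0 (n - 1) (by omega) (by omega)
  simp only [extent, srt]
  linarith

theorem sub_le_extent (hL : Layout n k L Z mem col P) (ho : o < 2) {a b : ℕ} (ha : a < n)
    (hb : b < n) : srt Z P o b - srt Z P o a ≤ extent n Z P o := by
  have h1 := hL.sorted o ho 0 a (by omega) ha
  have h2 := hL.sorted o ho b (n - 1) (by omega) (by omega)
  simp only [extent, srt]
  linarith

/-- The bounding square gives an annulus. -/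
theorem feas_extent (hL : Layout n k L Z mem col P) (ho : o < 2)
    (hcol : ∀ c < k, ∃ p < n, col p = c) (h : extent n Z P (1 - o) ≤ extent n Z P o) :
    Feas n k Z col o (srt Z P o 0) (extent n Z P o) (extent n Z P o / 2) (srt Z P (1 - o) 0) := by
  intro c hc
  have hn := hL.one_le_n
  obtain ⟨p, hp, hpc⟩ := hcol c hc
  have key : ∀ e < 2, srt Z P e 0 ≤ Z (2 * p + e) ∧ Z (2 * p + e) ≤ srt Z P e 0 + extent n Z P e := by
    intro e he
    obtain ⟨a, ha, rfl⟩ := hL.surj p hp e he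
    have h1 := sub_le_extent hL he (a := 0) (b := a) hn ha
    have h2 := hL.sorted e he 0 a (by omega) ha
    simp only [srt] at *
    exact ⟨h2, by linarith⟩
  have h1 := key o ho
  have h2 := key (1 - o) (by omega)
  refine ⟨p, hp, hpc, h1, ⟨h2.1, by linarith⟩, Or.inl ?_⟩
  rcases le_total (Z (2 * p + o) - srt Z P o 0) (extent n Z P o / 2) with h3 | h3
  · exact Or.inl h3
  · exact Or.inr (by linarith)

end CSSA

namespace CSSA

/-- Compute a minimum-width color-spanning annulus. -/
def annulusProgram : Com :=
  block [iset 3 1, rset 10 1, rset 11 (1 / 2), iset 7 1, iadd 8 0 2, imul 9 0 0, ranking, swap,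
    ranking, bounds, pass, swap, pass, finish]

theorem time_bound {n c d : ℕ} (h₁ : d ≤ 2 * c) (h₂ : n ≤ c) (h₃ : 1 ≤ c) :
    1 + (1 + (1 + (1 + (1 + (1 + ((40 * d + 10) + (6 + ((40 * d + 10) + (50 + (40000 * c +
      (6 + (40000 * c + ((50 * n + 40) + 0))))))))))))) ≤ 100000 * c := by
  omega

theorem annulusProgram_ok {L : Lim} {n k : ℕ} {col : ℕ → ℕ} {σ : Store} (h0 : σ.I 0 = n)
    (h1 : σ.I 1 = k) (h2 : σ.I 2 = 0) (h6 : σ.I 6 = 0) (h9 : σ.R 9 = 0) (hn : 1 ≤ n) (hk : 1 ≤ k)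
    (hkn : k ≤ n) (hM : ∀ p < n, σ.M p = col p) (hcol : ∀ p < n, col p < k)
    (hsurj : ∀ c < k, ∃ p < n, col p = c) (hI : n + k ≤ L.sI) (hR : 2 * n ≤ L.sR)
    (hW : 2 * n + k + 10 ≤ L.W) (hW' : n ^ 3 + n ^ 2 + n ≤ L.W) :
    Ok L annulusProgram σ (100000 * (n * n * n)) (fun τ => ∃ w, 0 ≤ w ∧ IsOutput n k σ.Z col w τ ∧
      ∀ o < 2, ∀ p < n, ∀ q < n, ∀ v β, v ≤ (σ.Z (2 * q + o) - σ.Z (2 * p + o)) / 2 →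
        Feas n k σ.Z col o (σ.Z (2 * p + o)) (σ.Z (2 * q + o) - σ.Z (2 * p + o)) v β → w ≤ v) := by
  set Z := σ.Z with hZ
  have hn2 : n ≤ n ^ 2 := by nlinarith
  have hn3 : n ^ 2 ≤ n ^ 3 := Nat.pow_le_pow_right hn (by omega)
  have hnn : n * n = n ^ 2 := by ring
  have hc : n * n * n = n ^ 3 := by ring
  unfold annulusProgram
  refine Ok.mono ?_ (time_bound (n := n) (c := n * n * n) (d := n * (n + 1)) (by rw [hc, Nat.mul_succ, hnn]; omega)
    (by rw [hc]; omega) (by rw [hc]; omega)) (fun _ => id)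
  refine Ok.cons (Ok.ins ?_ (Ok.cons (Ok.ins trivial (Ok.cons (Ok.ins trivial (Ok.cons (Ok.ins ?_
    (Ok.cons (Ok.ins ?_ (Ok.cons (Ok.ins ?_ ?_)))))))))))
  · simp only [Store.Guard]; omega
  · simp only [Store.Guard]; omega
  · simp [Store.Guard, Store.exec, h0, h2]; omega
  · simp [Store.Guard, Store.exec, h0]; rw [hnn]; omega
  set σ₁ := Store.exec _ _
  have hc₁ : Ctx n k Z σ.M 0 σ₁ := by
    refine ⟨?_, ?_, ?_, ?_, ?_, ?_, ?_, ?_, ?_, ?_, ?_, fun _ _ => rfl, rfl⟩ <;>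
    simp [σ₁, Store.exec, IntOp.eval, h0, h1, h2, h6, h9, hnn]
  have hM₁ : σ₁.M = σ.M := rfl
  clear_value σ₁
  refine Ok.cons ((ranking_ok (L := L) (o := 0) hc₁.reg0 hc₁.reg3 hc₁.reg6 hc₁.reg8 (by omega)
    (by omega) ?_ (by omega) hR).mono le_rfl ?_)
  · intro p hp
    have := hcol p hp
    rw [hM₁, hM p hp, show n ^ (0 + 1) * n = n ^ 2 by ring]
    omega
  rintro σ₂ ⟨hf₂, hM₂, -⟩
  have hc₂ := hc₁.own hf₂ (by decide) (by decide)
  refine Ok.cons ((swap_ok (L := L) hc₂ (by omega) (by omega) hn).mono le_rfl ?_)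
  rintro σ₃ ⟨hf₃, hM₃, hc₃⟩
  rw [hc₁.pts] at hM₂
  have hr0 : ∀ p < n, σ₂.M p = col p + n * atRank (fun q => Z (2 * q + 0)) n p := by
    intro p hp
    rw [hM₂ p hp, hM₁, hM p hp, show n ^ (0 + 1) = n by ring]
  refine Ok.cons ((ranking_ok (L := L) (o := 1) hc₃.reg0 hc₃.reg3 hc₃.reg6 hc₃.reg8 (by omega)
    (by omega) ?_ (by omega) hR).mono le_rfl ?_)
  · intro p hp
    have h3 := hcol p hp
    have h4 := (atRank_spec (z := fun q => Z (2 * q + 0)) hp).1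
    have h5 : n * (atRank (fun q => Z (2 * q + 0)) n p + 1) ≤ n * n := Nat.mul_le_mul_left _ h4
    rw [Nat.mul_succ, hnn] at h5
    rw [hM₃, hr0 p hp, show n ^ (1 - 0 + 1) * n = n ^ 3 by ring]
    omega
  rintro σ₄ ⟨hf₄, hM₄, -⟩
  have hc₄ := hc₃.own hf₄ (by decide) (by decide)
  rw [hc₃.pts] at hM₄
  have hr1 : ∀ p < n, σ₄.M p = col p + n * atRank (fun q => Z (2 * q + 0)) n p +
      n ^ 2 * atRank (fun q => Z (2 * q + 1)) n p := by
    intro p hp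
    rw [hM₄ p hp, hM₃, hr0 p hp]
  have hL := layout_of_ranking hn hk hkn hcol hr1 hI hR hW (by omega)
  generalize hP : (fun o p => atRank (fun q => Z (2 * q + o)) n p : ℕ → ℕ → ℕ) = P at hL
  generalize σ₄.M = mem at hc₄ hL
  refine Ok.cons ((bounds_ok hL hc₄ (by omega)).mono le_rfl ?_)
  rintro σ₅ ⟨hc₅, e4, e8⟩
  set w₀ := σ₅.R 4 with hw₀
  have hext : ∀ o < 2, extent n Z P o + 1 ≤ w₀ := by
    intro o ho
    have x0 := extent_nonneg hL (o := 0) (by omega)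
    have x1 := extent_nonneg hL (o := 1) (by omega)
    rw [e4]
    obtain rfl | rfl : o = 0 ∨ o = 1 := by omega
    · simp only [Nat.sub_zero, Nat.sub_self]; linarith
    · simp only [Nat.sub_zero, Nat.sub_self]; linarith
  have hpos : 0 < w₀ := by
    linarith [hext 0 (by omega), extent_nonneg hL (o := 0) (by omega)]
  have hlt : ∀ o < 2, ∀ a < n, ∀ b < n, srt Z P o b - srt Z P o a < w₀ := by
    intro o ho a ha b hb
    linarith [hext o ho, sub_le_extent hL ho ha hb]
  refine Ok.cons ((pass_ok hL (o := 1 - 0) (by omega) hkn hpos (hlt _ (by omega)) hc₅ e8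
    (Or.inl rfl)).mono le_rfl ?_)
  rintro σ₆ ⟨hc₆, e8₆, hrec₆, -, hdone₁⟩
  refine Ok.cons ((swap_ok (L := L) hc₆ (by omega) (by omega) hn).mono le_rfl ?_)
  rintro σ₇ ⟨hf₇, hM₇, hc₇⟩
  refine Ok.cons ((pass_ok hL (by omega) hkn hpos (hlt _ (by omega)) hc₇
    ((hf₇.2.1 8 (by decide)).trans e8₆) (hrec₆.of_frame hf₇ (by decide) (by decide))).mono le_rfl ?_)
  rintro σ₈ ⟨hc₈, -, hrec, hle, hdone₀⟩
  rw [hf₇.2.1 4 (by decide)] at hle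
  have hdone : ∀ o < 2, ∀ a < n, ∀ b < n, PairDone n k Z col P o (σ₈.R 4) a b := by
    intro o ho a ha b hb
    obtain rfl | rfl : o = 0 ∨ o = 1 := by omega
    · exact hdone₀ a ha b hb
    · exact (hdone₁ a ha b hb).mono hle
  have hsmall : ∀ o < 2, extent n Z P (1 - o) ≤ extent n Z P o → σ₈.R 4 < w₀ := by
    intro o ho hoo
    have h3 := hdone o ho 0 hn (n - 1) (by omega) (extent n Z P o / 2) _ le_rfl
      (feas_extent hL ho hsurj hoo)
    linarith [hext o ho, extent_nonneg hL ho]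
  have hne : σ₈.R 4 ≠ w₀ := by
    rcases le_total (extent n Z P 0) (extent n Z P 1) with h | h
    · exact (hsmall 1 (by omega) h).ne
    · exact (hsmall 0 (by omega) h).ne
  obtain ⟨r1, r2, r3, r4⟩ := hrec.resolve_left hne
  refine Ok.cons ((finish_ok hL hc₈ r1 r3 r4).mono le_rfl fun τ hτ => Ok.nil
    ⟨_, r2, hτ, fun o ho p hp q hq v β hv hfe => ?_⟩)
  obtain ⟨a, ha, rfl⟩ := hL.surj p hp o ho
  obtain ⟨b, hb, rfl⟩ := hL.surj q hq o ho
  exact hdone o ho a ha b hb v β hv hfe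

theorem words_bound {n k : ℕ} (hkn : k ≤ n) {C : ℕ} (hC : 4 ≤ C) :
    2 * n + k + 10 ≤ (n + 2) ^ C ∧ n ^ 3 + n ^ 2 + n ≤ (n + 2) ^ C := by
  have h : (n + 2) ^ 4 ≤ (n + 2) ^ C := Nat.pow_le_pow_right (by omega) hC
  have e : (n + 2) ^ 4 = n ^ 4 + 8 * n ^ 3 + 24 * n ^ 2 + 32 * n + 16 := by ring
  have h0 := Nat.zero_le (n ^ 4)
  omega

end CSSA

theorem theorem1 :
    ∃ (prog : CSSA.Program) (C : ℕ),
      ∀ (n k : ℕ) (P : Fin n → CSSA.Plane) (color : Fin n → Fin k),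
        1 ≤ k → Function.Surjective color →
        ∃ T : ℕ,
          -- the running time
          (T : ℝ) ≤ C * ((n : ℝ) ^ 3 + (n : ℝ) ^ 2 * k * Real.log k) ∧
          prog.Halted (prog.run (CSSA.initial P color) T) ∧
          -- the extra space, in cells beyond those of the input
          (∀ t < T, prog.AccessWithin (n + C * k) (2 * n + C * k)
            (prog.run (CSSA.initial P color) t)) ∧
          -- integers have `O(log n)` bits
          (∀ t ≤ T, (prog.run (CSSA.initial P color) t).WordsWithin ((n + 2) ^ C)) ∧
          -- the result
          ∃ A : CSSA.SquareAnnulus, A.IsMinWidth P color ∧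
            (prog.run (CSSA.initial P color) T).Outputs A := by
  obtain ⟨C, hC, hC4⟩ : ∃ C : ℕ, C = 100000 ∧ 4 ≤ C := ⟨100000, rfl, by norm_num⟩
  refine ⟨CSSA.annulusProgram.code 0, C, fun n k P color hk hsurj => ?_⟩
  have hkn : k ≤ n := by simpa using Fintype.card_le_of_surjective color hsurj
  have hn : 1 ≤ n := hk.trans hkn
  obtain ⟨hW, hW'⟩ := CSSA.words_bound hkn hC4
  set c₀ := CSSA.initial P color with hc₀
  let σ : CSSA.Store := ⟨c₀.intReg, c₀.realReg, c₀.intMem, c₀.realMem⟩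
  have hcol : ∀ (p : ℕ) (hp : p < n), σ.M p = color ⟨p, hp⟩ := fun p hp => dif_pos hp
  have hx : ∀ (p : ℕ) (hp : p < n), σ.Z (2 * p) = P ⟨p, hp⟩ 0 := by
    intro p hp
    have h1 : 2 * p / 2 = p := by omega
    have h2 : 2 * p % 2 = 0 := by omega
    simp [σ, hc₀, CSSA.initial, h1, hp]
  have hy : ∀ (p : ℕ) (hp : p < n), σ.Z (2 * p + 1) = P ⟨p, hp⟩ 1 := by
    intro p hp
    have h1 : (2 * p + 1) / 2 = p := by omega
    have h2 : (2 * p + 1) % 2 = 1 := by omega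
    simp [σ, hc₀, CSSA.initial, h1, h2, hp]
  have hcs : ∀ c < k, ∃ p < n, σ.M p = c := by
    intro c hc
    obtain ⟨p, hp⟩ := hsurj ⟨c, hc⟩
    exact ⟨p, p.2, by rw [hcol p p.2, hp]⟩
  have hclt : ∀ p < n, σ.M p < k := fun p hp => by rw [hcol p hp]; exact (color _).2
  have hC1 : k ≤ C * k := Nat.le_mul_of_pos_left k (by omega)
  obtain ⟨T, hT, τ, ⟨w, hw, ⟨ho1, ho2, ho3⟩, hmin⟩, hrun, hacc, hwords⟩ :=
    CSSA.annulusProgram_ok (L := ⟨(n + 2) ^ C, n + C * k, 2 * n + C * k⟩) (σ := σ) (n := n) (k := k)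
      (col := σ.M) rfl rfl rfl rfl rfl hn hk hkn (fun _ _ => rfl) hclt hcs
      (Nat.add_le_add_left hC1 n) (Nat.le_add_right _ _) hW hW' (CSSA.annulusProgram.code 0) 0
      (fun i _ => by rw [zero_add]) ⟨fun r => by
        simp only [CSSA.Store.at, σ, hc₀, CSSA.initial]
        split_ifs <;> omega, fun a => by
        simp only [CSSA.Store.at, σ, hc₀, CSSA.initial]
        split_ifs with h
        · have := (color ⟨a, h⟩).2
          omega
        · omega⟩
  have hstart : σ.at 0 = c₀ := rfl
  rw [hstart] at hrun hacc hwords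
  refine ⟨T, ?_, ?_, hacc, hwords, ?_⟩
  · have h1 : (T : ℝ) ≤ C * (n : ℝ) ^ 3 := by
      rw [hC, show (n : ℝ) ^ 3 = n * n * n by ring]
      exact_mod_cast hT
    have h2 : 0 ≤ Real.log k := Real.log_natCast_nonneg k
    have h3 : 0 ≤ (C : ℝ) * ((n : ℝ) ^ 2 * k * Real.log k) := by positivity
    rw [mul_add]
    linarith
  · rw [hrun]
    simp [CSSA.Program.Halted, CSSA.Com.length_code, CSSA.Store.at]
  · refine ⟨⟨!₂[τ.R 0, τ.R 1], τ.R 2, τ.R 3, ho1, by linarith⟩, ⟨fun i => ?_, fun B hB => ?_⟩, ?_⟩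
    · obtain ⟨p, hp, hpc, h1, h2⟩ := ho3 i i.2
      refine ⟨⟨p, hp⟩, Fin.ext (by rw [← hcol p hp, hpc]), ?_⟩
      simp only [CSSA.far, hx p hp, hy p hp] at h1 h2
      exact ⟨by simpa [CSSA.distInf] using h1, by simpa [CSSA.distInf] using h2⟩
    · rw [CSSA.SquareAnnulus.width_eq, CSSA.SquareAnnulus.width_eq]
      simp only
      rw [ho2]
      have hB' : ∀ c < k, ∃ p < n, σ.M p = c ∧
          B.inner ≤ max |σ.Z (2 * p) - B.center 0| |σ.Z (2 * p + 1) - B.center 1| ∧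
          max |σ.Z (2 * p) - B.center 0| |σ.Z (2 * p + 1) - B.center 1| ≤ B.outer := by
        intro c hc
        obtain ⟨j, hj, h1, h2⟩ := hB ⟨c, hc⟩
        refine ⟨j, j.2, by rw [hcol j j.2, hj], ?_⟩
        rw [hx j j.2, hy j j.2]
        exact ⟨h1, h2⟩
      rcases CSSA.feasAt_of_annulus (X := fun p => σ.Z (2 * p)) (Y := fun p => σ.Z (2 * p + 1)) hk hB'
        with ⟨i, hi, j, hj, v, b, hv, hv', hf⟩ | ⟨i, hi, j, hj, v, b, hv, hv', hf⟩
      · exact (hmin 0 (by omega) i hi j hj v b hv' hf).trans hv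
      · exact (hmin 1 (by omega) i hi j hj v b hv' hf).trans hv
    · rw [hrun]
      simp [CSSA.Config.Outputs, CSSA.Store.at]
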